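/- Let $M$ be a closed surface (a compact connected smooth two-dimensional Riemannian manifold), and let $\mathrm{Diff}^2(M)$ be the group of its $C^2$ diffeomorphisms with the $C^2$ topology. Let $\mu$ be a Borel probability measure on $\mathrm{Diff}^2(M)$ with $$\int \log^+\Big(\sup_{x\in M}\|D_xf\|\Big)+\log^+\Big(\sup_{x\in M}\|D_x(f^{-1})\|\Big)\,d\mu(f)<\infty .$$ For $\omega=(\omega_0,\omega_1,\dots)\in \mathrm{Diff}^2(M)^{\mathbb N}$ put $f_\omega^n=\omega_{n-1}\circ\cdots\circ\omega_0$, and let $\mu^{(N)}$ be the $N$-th convolution power of $\mu$. We say that $\mu$ is *uniformly expanding* if there are $C>0$ and $N\in\mathbb N$ such that $\int \log\frac{\|D_xf(v)\|}{\|v\|}\,d\mu^{(N)}(f)>C$ for all $x\in M$ and all nonzero $v\in T_xM$. A Borel probability measure $\nu$ on $M$ is *$\mu$-stationary* if $\nu=\int f_*\nu\,d\mu(f)$, and such a $\nu$ is *ergodic* if every Borel set $A$ with $\nu(A\,\triangle\, f^{-1}A)=0$ for $\mu$-a.e. $f$ has $\nu(A)\in\{0,1\}$. A $\nu$-measurable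 subbundle $V\subset TM$ is a family of subspaces $V(x)\subset T_xM$ that has, for $\nu$-a.e. $x$, a frame consisting of a fixed number (the rank) of Borel vector fields; it is *$\mu$-a.s. invariant* if $D_xf(V(x))=V(f(x))$ for $\mu$-a.e. $f$ and $\nu$-a.e. $x$. (1) If $\mu$ is not uniformly expanding, then there exist an ergodic $\mu$-stationary measure $\nu$ on $M$, a $\mu$-a.s. invariant $\nu$-measurable subbundle $\hat V\subset TM$ of positive rank, and a real number $\lambda\le 0$ that is the top Lyapunov exponent in $\hat V$: for $\mu^{\mathbb N}\times\nu$-a.e. $(\omega,x)$ every nonzero $v\in\hat V(x)$ satisfies $\limsup_n\frac1n\log\frac{\|D_xf_\omega^n(v)\|}{\|v\|}\le\lambda$, and for some nonzero $v\in\hat V(x)$ the limit exists and equals $\lambda$. (2) Let $m$ be a smooth measure on $M$, that is, a Borel probability measure equivalent to the Riemannian volume, with density bounded away from $0$ and $\infty$. Suppose that $f_*m=m$ for $\mu$-a.e. $f$. Then $\mu$ is uniformly expanding if and only if every ergodic $\mu$-stationary measure $\nu$ on $M$ has the following two properties: (a) $\nu$ has a positive Lyapunov exponent: there is $\lambda>0$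 such that for $\mu^{\mathbb N}\times\nu$-a.e. $(\omega,x)$ some nonzero $v\in T_xM$ satisfies $\lim_n\frac1n\log\frac{\|D_xf_\omega^n(v)\|}{\|v\|}=\lambda$; (b) the stable distribution $$E^s_\omega(x)=\{0\}\cup\Big\{v\in T_xM\setminus\{0\}:\limsup_n\tfrac1n\log\tfrac{\|D_xf_\omega^n(v)\|}{\|v\|}<0\Big\}$$ is not non-random with respect to $\nu$: there is no $\mu$-a.s. invariant $\nu$-measurable subbundle $\hat V\subset TM$ (of any rank) with $\hat V(x)=E^s_\omega(x)$ for $\mu^{\mathbb N}\times\nu$-a.e. $(\omega,x)$. -/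

import Mathlib

open Set Filter MeasureTheory Manifold Bundle
open scoped Topology ContDiff NNReal

noncomputable section

namespace RandomSurface

/-- The model space of surfaces. -/
abbrev Plane : Type := EuclideanSpace ℝ (Fin 2)

/-! ### The space of `C^2` diffeomorphisms and its Borel structure -/

section Diffeo

variable (M : Type*) [TopologicalSpace M] [ChartedSpace Plane M]

/-- `Diff^2(M)`: the `C^2` diffeomorphisms of the surface `M`. -/
abbrev Diff2 : Type _ := Diffeomorph (𝓡 2) (𝓡 2) M M 2

variable [IsManifold (𝓡 2) ∞ M]

/-- The second iterated tangent bundle `TTM`. -/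
abbrev TT : Type _ := TangentBundle (𝓡 2).tangent (TangentBundle (𝓡 2) M)

variable {M}

/-- The second tangent map `TTf : TTM → TTM` of a `C^2` diffeomorphism; in a chart
`TTf (x, v, w, u) = (f x, Df v, Df w, D²f (v, w) + Df u)`. -/
def tangentTwo (f : Diff2 M) : C(TT M, TT M) where
  toFun := tangentMap (𝓡 2).tangent (𝓡 2).tangent (tangentMap (𝓡 2) (𝓡 2) f)
  continuous_toFun := by
    have h1 : ContMDiff (𝓡 2).tangent (𝓡 2).tangent 1 (tangentMap (𝓡 2) (𝓡 2) f) :=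
      f.contMDiff.contMDiff_tangentMap (by norm_num)
    exact h1.continuous_tangentMap le_rfl

/-- The `C^2` topology: `f_n → f` when the maps `TT f_n` converge to `TT f` uniformly on compact
sets, that is, when the derivatives of order at most two converge uniformly on compact sets in
charts. -/
instance : TopologicalSpace (Diff2 M) :=
  TopologicalSpace.induced tangentTwo ContinuousMap.compactOpen

/-- Measures on `Diff^2(M)` are Borel measures for the `C^2` topology. -/
instance : MeasurableSpace (Diff2 M) := borel (Diff2 M)

instance : BorelSpace (Diff2 M) := ⟨rfl⟩

/-- The `N`-th convolution power `μ^{(N)}`: the law of a product of `N` independent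
diffeomorphisms with law `μ`. -/
def convPow (μ : Measure (Diff2 M)) : ℕ → Measure (Diff2 M)
  | 0 => Measure.dirac (Diffeomorph.refl (𝓡 2) M 2)
  | N + 1 => Measure.map (fun p : Diff2 M × Diff2 M => p.2.trans p.1) (μ.prod (convPow μ N))

/-- `f_w^n = w_{n-1} ∘ ⋯ ∘ w_1 ∘ w_0`. -/
def word (w : ℕ → Diff2 M) : ℕ → Diff2 M
  | 0 => Diffeomorph.refl (𝓡 2) M 2
  | n + 1 => (word w n).trans (w n)

/-- `μ^ℕ × ν` on `Diff^2(M)^ℕ × M`. -/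
def pathMeasure [MeasurableSpace M] (μ : Measure (Diff2 M)) [IsProbabilityMeasure μ]
    (ν : Measure M) : Measure ((ℕ → Diff2 M) × M) :=
  (Measure.infinitePi fun _ : ℕ => μ).prod ν

/-- `ν` is `μ`-stationary: `ν = μ * ν = ∫ f_* ν dμ(f)`. -/
def IsStationary [MeasurableSpace M] (μ : Measure (Diff2 M)) (ν : Measure M) : Prop :=
  ∀ A : Set M, MeasurableSet A → ∫⁻ f : Diff2 M, Measure.map f ν A ∂μ = ν A

/-- `ν` is an ergodic `μ`-stationary Borel probability measure: it is stationary and every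
`μ`-almost surely `ν`-invariant Borel set has measure zero or one. -/
structure IsErgodicStationary [MeasurableSpace M] (μ : Measure (Diff2 M)) (ν : Measure M) :
    Prop where
  prob : IsProbabilityMeasure ν
  stationary : IsStationary μ ν
  ergodic : ∀ A : Set M, MeasurableSet A → (∀ᵐ (f : Diff2 M) ∂μ, f ⁻¹' A =ᵐ[ν] A) → ν A = 0 ∨ ν A = 1

/-- `V` is a `ν`-measurable subbundle of `TM` of rank `k`: it has, `ν`-almost everywhere, a frame
of `k` Borel vector fields. -/
def IsMeasurableSubbundle [MeasurableSpace M] (ν : Measure M) (k : ℕ)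
    (V : (x : M) → Submodule ℝ (TangentSpace (𝓡 2) x)) : Prop :=
  ∃ s : Fin k → (x : M) → TangentSpace (𝓡 2) x,
    (∀ i, Measurable[borel M, borel (TangentBundle (𝓡 2) M)]
      (fun x => (⟨x, s i x⟩ : TangentBundle (𝓡 2) M))) ∧
    ∀ᵐ x ∂ν, LinearIndependent ℝ (fun i => s i x) ∧
      Submodule.span ℝ (Set.range fun i => s i x) = V x

/-- `V` is `μ`-almost surely invariant: `D_x f (V x) = V (f x)` for `μ`-almost every `f` and
`ν`-almost every `x`. -/
def IsInvariantSubbundle [MeasurableSpace M] (μ : Measure (Diff2 M)) (ν : Measure M)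
    (V : (x : M) → Submodule ℝ (TangentSpace (𝓡 2) x)) : Prop :=
  ∀ᵐ (f : Diff2 M) ∂μ, ∀ᵐ x ∂ν,
    (V x).map (mfderiv (𝓡 2) (𝓡 2) f x : TangentSpace (𝓡 2) x →ₗ[ℝ] TangentSpace (𝓡 2) (f x))
      = V (f x)

end Diffeo

/-! ### Riemannian notions -/

section Riemannian

variable {M : Type*} [TopologicalSpace M] [ChartedSpace Plane M] [IsManifold (𝓡 2) ∞ M]
  [RiemannianBundle (fun x : M => TangentSpace (𝓡 2) x)]

/-- `log (‖D_x f v‖ / ‖v‖)`. -/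
def logGrowth (f : Diff2 M) (x : M) (v : TangentSpace (𝓡 2) x) : ℝ :=
  Real.log (‖mfderiv (𝓡 2) (𝓡 2) f x v‖ / ‖v‖)

/-- `sup_x ‖D_x f‖`. -/
def cOneSize (f : Diff2 M) : ℝ := ⨆ x : M, ‖mfderiv (𝓡 2) (𝓡 2) f x‖

/-- The first-order logarithmic moment condition
`∫ log⁺ (sup_x ‖D_x f‖) + log⁺ (sup_x ‖D_x (f⁻¹)‖) dμ(f) < ∞`. -/
def HasLogMoment (μ : Measure (Diff2 M)) : Prop :=
  ∫⁻ f : Diff2 M, ENNReal.ofReal (Real.posLog (cOneSize f) + Real.posLog (cOneSize f.symm)) ∂μ < ⊤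

/-- `μ` is uniformly expanding. -/
def UniformlyExpanding (μ : Measure (Diff2 M)) : Prop :=
  ∃ C : ℝ, 0 < C ∧ ∃ N : ℕ, ∀ (x : M) (v : TangentSpace (𝓡 2) x), v ≠ 0 →
    C < ∫ f, logGrowth f x v ∂(convPow μ N)

/-- `(1/n) log (‖D_x f_w^n v‖ / ‖v‖)`. -/
def growthRate (w : ℕ → Diff2 M) (x : M) (v : TangentSpace (𝓡 2) x) (n : ℕ) : ℝ :=
  (1 / (n : ℝ)) * logGrowth (word w n) x v

/-- `upperRate w x v = limsup_n (1/n) log (‖D_x f_w^n v‖ / ‖v‖)`, in `[-∞, ∞]`. -/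
def upperRate (w : ℕ → Diff2 M) (x : M) (v : TangentSpace (𝓡 2) x) : EReal :=
  limsup (fun n : ℕ => (growthRate w x v n : EReal)) atTop

/-- The real number `l` is a Lyapunov exponent of `ν`: for almost every `(w, x)` some nonzero
tangent vector at `x` grows at the exact exponential rate `l`. -/
def IsLyapunovExponent [MeasurableSpace M] (μ : Measure (Diff2 M)) [IsProbabilityMeasure μ]
    (ν : Measure M) (l : ℝ) : Prop :=
  ∀ᵐ p ∂(pathMeasure μ ν), ∃ v : TangentSpace (𝓡 2) p.2, v ≠ 0 ∧
    Tendsto (growthRate p.1 p.2 v) atTop (𝓝 l)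

/-- The real number `l` is the top Lyapunov exponent in `V`: for almost every `(w, x)` it is the
largest exponential growth rate of a nonzero vector of `V x`, and it is attained as a limit. -/
def IsTopExponentIn [MeasurableSpace M] (μ : Measure (Diff2 M)) [IsProbabilityMeasure μ]
    (ν : Measure M) (V : (x : M) → Submodule ℝ (TangentSpace (𝓡 2) x)) (l : ℝ) : Prop :=
  ∀ᵐ p ∂(pathMeasure μ ν),
    (∃ v ∈ V p.2, v ≠ 0 ∧ Tendsto (growthRate p.1 p.2 v) atTop (𝓝 l)) ∧
    ∀ v ∈ V p.2, v ≠ 0 → upperRate p.1 p.2 v ≤ (l : EReal)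

/-- The stable Lyapunov subspace `E_w^s(x)`, as a set of tangent vectors. -/
def stableSet (w : ℕ → Diff2 M) (x : M) : Set (TangentSpace (𝓡 2) x) :=
  {v | v = 0 ∨ upperRate w x v < 0}

/-- The stable distribution is non-random with respect to `ν`: it coincides almost everywhere
with a `μ`-almost surely invariant `ν`-measurable subbundle, of some rank, that does not depend
on `w`. -/
def StableNonRandom [MeasurableSpace M] (μ : Measure (Diff2 M)) [IsProbabilityMeasure μ]
    (ν : Measure M) : Prop :=
  ∃ (k : ℕ) (V : (x : M) → Submodule ℝ (TangentSpace (𝓡 2) x)),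
    IsMeasurableSubbundle ν k V ∧ IsInvariantSubbundle μ ν V ∧
    ∀ᵐ p ∂(pathMeasure μ ν), (V p.2 : Set (TangentSpace (𝓡 2) p.2)) = stableSet p.1 p.2

/-- The coordinate vector field `∂_i` of the chart at `p`, at the point with coordinates `u`. -/
def coordVector (p : M) (i : Fin 2) (u : Plane) :
    TangentSpace (𝓡 2) ((chartAt Plane p).symm u) :=
  mfderiv 𝓘(ℝ, Plane) (𝓡 2) (chartAt Plane p).symm u (EuclideanSpace.single i (1 : ℝ) : Plane)

/-- The Gram matrix `g_{ij}(u)` of the metric in the chart at `p`. -/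
def gramMatrix (p : M) (u : Plane) : Matrix (Fin 2) (Fin 2) ℝ :=
  Matrix.of fun i j => inner ℝ (coordVector p i u) (coordVector p j u)

/-- The Riemannian area `√(det g) du` on the domain of the chart at `p`. -/
def chartVolume [MeasurableSpace M] (p : M) : Measure M :=
  Measure.map (chartAt Plane p).symm
    ((volume.restrict (chartAt Plane p).target).withDensity
      fun u => ENNReal.ofReal (Real.sqrt (gramMatrix p u).det))

variable (M) in
/-- The Riemannian volume of `M`: the smallest measure that dominates the area measures
`√(det g) du` of all the charts. As these agree on overlaps, it restricts to each of them on the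
domain of the chart. -/
def riemannianVolume [MeasurableSpace M] : Measure M := ⨆ p : M, chartVolume p

/-- A smooth measure: a Borel probability measure that is equivalent to the Riemannian volume, in
the sense that its density is bounded away from zero and infinity. Every probability measure with
a positive continuous density on a compact `M` is of this kind. -/
def IsSmoothMeasure [MeasurableSpace M] (m : Measure M) : Prop :=
  IsProbabilityMeasure m ∧ ∃ c : ℝ≥0, 0 < c ∧
    c • riemannianVolume M ≤ m ∧ m ≤ c⁻¹ • riemannianVolume M

end Riemannian

end RandomSurface

end

/-! # Uniform expansion of random walks by surface diffeomorphisms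

The diffeomorphisms act on the unit sphere bundle of `M`, a compact space, by
`(x, v) ↦ (f x, D f v / ‖D f v‖)`. The functions `log ‖D f v‖` form an additive cocycle over this
action, so that the mean growth of a vector under the `N`-th convolution power of `μ` is the sum of
the averages of the mean stretch `Φ v = ∫ log ‖D f v‖ dμ(f)` over the first `N` laws of the random
walk started at `v`. The moment condition makes `Φ` continuous.

The skew product over an ergodic stationary measure is ergodic (`WalkErgodic.ergodic_skew`),
because the section probabilities of an invariant set are bounded harmonic functions. By
Birkhoff's theorem (`tendsto_birkhoffSum_div`), almost every unit vector for an ergodic stationary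
measure `η` on the sphere bundle has the exact growth rate `∫ Φ dη`.

If `μ` is not uniformly expanding, there are unit vectors with bounded mean growth over arbitrarily
long times. The Cesàro averages of the laws of the walk started there accumulate at a stationary
measure with `∫ Φ ≤ 0` (`exists_stationary_limit`), and one can pass to an ergodic one
(`exists_walkErgodic_integral_nonpos`). For an ergodic `η` with `l = ∫ Φ dη`, the vectors that
almost surely grow at most at the rate `l` form linear subspaces `V x`, which the derivatives map
into one another. Over the projection of `η` they are not zero, their dimension is constant by
ergodicity, and so they form a measurable invariant subbundle with top exponent `l`
(`exists_isTopExponentIn`).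

Suppose next that the walk preserves a smooth measure. By the change of variables formula in
charts, all products of the diffeomorphisms distort areas by a bounded factor
(`exists_areaSq_mfderiv_le`). In dimension two, a vector that is expanded at an exact rate `l > 0`
is then accompanied by one that is contracted at the rate `-l` (`exists_expBound_neg`,
`exists_upperRate_neg`): the part of a second vector orthogonal to the expanded one is
exponentially small, and the feet of the perpendiculars converge exponentially fast.

Under uniform expansion, an ergodic stationary measure on `M` lifts to an ergodic stationary
measure on the sphere bundle (`exists_walkErgodic_lift`), whose exponent is positive. There is thus
a contracted vector at almost every point. If the stable distribution were non-random, this vector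
would be contracted along almost every path, although its mean logarithmic growth is linear in
time with positive slope; Fatou's lemma excludes this (`UniformlyExpanding.not_ae_upperRate_neg`).
Conversely, if `μ` is not uniformly expanding and the exponents are positive, the subbundle with
nonpositive top exponent is a line field. Since the plane also contains an expanded and a contracted
vector, the line is the stable subspace (`eq_stableSet`), which is therefore non-random. -/

open scoped ENNReal

set_option linter.unusedSectionVars false

namespace RandomSurface

/-! ### The pointwise ergodic theorem -/

section Birkhoff

variable {Ω : Type*}

/-- The maximum of the first `n + 1` Birkhoff sums, `max_{0 ≤ k ≤ n} ∑_{i < k} f (T^i x)`. -/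
def maxBirkhoffSum (T : Ω → Ω) (f : Ω → ℝ) : ℕ → Ω → ℝ
  | 0 => fun _ => 0
  | n + 1 => fun x => max 0 (f x + maxBirkhoffSum T f n (T x))

lemma maxBirkhoffSum_nonneg (T : Ω → Ω) (f : Ω → ℝ) (n : ℕ) (x : Ω) :
    0 ≤ maxBirkhoffSum T f n x := by
  cases n with
  | zero => exact le_rfl
  | succ n => exact le_max_left _ _

lemma maxBirkhoffSum_le_succ (T : Ω → Ω) (f : Ω → ℝ) (n : ℕ) (x : Ω) :
    maxBirkhoffSum T f n x ≤ maxBirkhoffSum T f (n + 1) x := by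
  induction n generalizing x with
  | zero => exact maxBirkhoffSum_nonneg T f 1 x
  | succ n ih => exact max_le_max le_rfl (by simpa using ih (T x))

lemma birkhoffSum_le_maxBirkhoffSum (T : Ω → Ω) (f : Ω → ℝ) (n : ℕ) (x : Ω) :
    birkhoffSum T f n x ≤ maxBirkhoffSum T f n x := by
  induction n generalizing x with
  | zero => simp [maxBirkhoffSum]
  | succ n ih =>
    rw [birkhoffSum_succ']
    exact (add_le_add le_rfl (ih (T x))).trans (le_max_right _ _)

variable [MeasurableSpace Ω] {P : Measure Ω} {T : Ω → Ω} {f : Ω → ℝ}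

lemma measurable_maxBirkhoffSum (hT : Measurable T) (hf : Measurable f) (n : ℕ) :
    Measurable (maxBirkhoffSum T f n) := by
  induction n with
  | zero => exact measurable_const
  | succ n ih => exact measurable_const.max (hf.add (ih.comp hT))

lemma integrable_maxBirkhoffSum [IsFiniteMeasure P] (hT : MeasurePreserving T P P)
    (hf : Integrable f P) (n : ℕ) : Integrable (maxBirkhoffSum T f n) P := by
  induction n with
  | zero => exact integrable_zero _ _ _
  | succ n ih =>
    have h1 : Integrable (fun x => maxBirkhoffSum T f n (T x)) P :=
      hT.integrable_comp_of_integrable ih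
    exact (integrable_zero _ _ _).sup (hf.add h1)

/-- If `∫ f < 0`, the Birkhoff sums of `f` over an ergodic transformation are almost surely
bounded above: otherwise the increments `M_{n+1} - M_n ∘ T` of the maximal sums, which have
nonnegative integral, decrease to `f` almost everywhere. -/
lemma exists_birkhoffSum_le_of_integral_neg [IsProbabilityMeasure P] (hT : Ergodic T P)
    (hfm : Measurable f) (hf : Integrable f P) (hneg : ∫ x, f x ∂P < 0) :
    ∀ᵐ x ∂P, ∃ C : ℝ, ∀ n, birkhoffSum T f n x ≤ C := by
  let M := maxBirkhoffSum T f
  let E : Set Ω := {x | ∃ C : ℕ, ∀ n, M n x ≤ C}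
  have hMm : ∀ n, Measurable (M n) := measurable_maxBirkhoffSum hT.measurable hfm
  have hE : MeasurableSet E := by
    have : E = ⋃ C : ℕ, ⋂ n, {x | M n x ≤ C} := by ext x; simp [E]
    rw [this]
    exact .iUnion fun C => .iInter fun n => measurableSet_le (hMm n) measurable_const
  have hinv : T ⁻¹' E = E := by
    ext x
    constructor
    · rintro ⟨C, hC⟩
      obtain ⟨D, hD⟩ := exists_nat_ge (max 0 (f x + C))
      refine ⟨D, fun n => le_trans ?_ hD⟩
      cases n with
      | zero => exact le_max_left _ _
      | succ n => exact max_le_max le_rfl (by simpa using hC n)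
    · rintro ⟨C, hC⟩
      obtain ⟨D, hD⟩ := exists_nat_ge (C - f x)
      refine ⟨D, fun n => le_trans ?_ hD⟩
      have := (le_max_right _ _).trans (hC (n + 1))
      linarith
  rcases (hT.toPreErgodic.ae_empty_or_univ hE hinv) with h0 | h1
  · exfalso
    have hunb : ∀ᵐ x ∂P, x ∉ E := by
      filter_upwards [h0] with x hx hxE
      exact (hx.mp hxE : False)
    have hlim : Tendsto (fun n => ∫ x, (M (n + 1) x - M n (T x)) ∂P) atTop (𝓝 (∫ x, f x ∂P)) := by
      refine tendsto_integral_of_dominated_convergence (fun x => |f x|) ?_ hf.abs ?_ ?_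
      · exact fun n => ((hMm _).sub ((hMm n).comp hT.measurable)).aestronglyMeasurable
      · refine fun n => Eventually.of_forall fun x => ?_
        have h2 := maxBirkhoffSum_nonneg T f n (T x)
        simp only [M, maxBirkhoffSum, Real.norm_eq_abs]
        rcases max_cases 0 (f x + maxBirkhoffSum T f n (T x)) with ⟨h, h'⟩ | ⟨h, h'⟩ <;> rw [h]
        · rw [abs_le]
          constructor <;> linarith [neg_le_abs (f x), abs_nonneg (f x)]
        · simp
      · filter_upwards [hunb] with x hx
        have hTx : T x ∉ E := fun h => hx (hinv ▸ h : x ∈ E)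
        have hlarge : ∀ᶠ n in atTop, 0 ≤ f x + M n (T x) := by
          obtain ⟨C, hC⟩ := exists_nat_ge (- f x)
          simp only [E, mem_ofPred_eq, not_exists, not_forall, not_le] at hTx
          obtain ⟨n₀, hn₀⟩ := hTx C
          filter_upwards [eventually_ge_atTop n₀] with n hn
          have : M n₀ (T x) ≤ M n (T x) :=
            monotone_nat_of_le_succ (f := fun n => M n (T x))
              (fun n => maxBirkhoffSum_le_succ T f n (T x)) hn
          linarith
        refine tendsto_const_nhds.congr' ?_
        filter_upwards [hlarge] with n hn
        simp only [M, maxBirkhoffSum] at hn ⊢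
        rw [max_eq_right hn]; ring
    -- `T` preserves the measure and `M n` increases with `n`
    have hnn : ∀ n, 0 ≤ ∫ x, (M (n + 1) x - M n (T x)) ∂P := by
      intro n
      have hi := integrable_maxBirkhoffSum hT.toMeasurePreserving hf
      have hi' : Integrable (fun x => M n (T x)) P :=
        hT.toMeasurePreserving.integrable_comp_of_integrable (hi n)
      rw [integral_sub (hi _) hi']
      have : ∫ x, M n (T x) ∂P = ∫ x, M n x ∂P := by
        rw [← integral_map hT.measurable.aemeasurable, hT.map_eq]
        rw [hT.map_eq]; exact (hMm n).aestronglyMeasurable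
      rw [this, sub_nonneg]
      exact integral_mono (hi _) (hi _) (maxBirkhoffSum_le_succ T f n)
    linarith [ge_of_tendsto' hlim hnn]
  · filter_upwards [h1] with x hx
    obtain ⟨C, hC⟩ : x ∈ E := hx.mpr trivial
    exact ⟨C, fun n => (birkhoffSum_le_maxBirkhoffSum T f n x).trans (hC n)⟩

/-- The upper half of the ergodic theorem: `f - (∫ f + δ)` has negative integral for every `δ > 0`,
so that its Birkhoff sums are bounded above. -/
lemma eventually_birkhoffSum_le [IsProbabilityMeasure P] (hT : Ergodic T P)
    (hfm : Measurable f) (hf : Integrable f P) :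
    ∀ᵐ x ∂P, ∀ ε : ℝ, 0 < ε → ∀ᶠ n : ℕ in atTop,
      birkhoffSum T f n x / n ≤ ∫ x, f x ∂P + ε := by
  set I := ∫ x, f x ∂P
  have key : ∀ k : ℕ, ∀ᵐ x ∂P, ∃ C : ℝ, ∀ n,
      birkhoffSum T (fun x => f x - (I + 1 / (k + 1 : ℝ))) n x ≤ C := by
    intro k
    refine exists_birkhoffSum_le_of_integral_neg hT (hfm.sub_const _)
      (hf.sub (integrable_const _)) ?_
    rw [integral_sub hf (integrable_const _)]
    simp only [integral_const, probReal_univ, one_smul]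
    have : 0 < 1 / (k + 1 : ℝ) := by positivity
    simp only [I]; linarith
  filter_upwards [ae_all_iff.2 key] with x hx ε hε
  obtain ⟨k, hk⟩ := exists_nat_one_div_lt (half_pos hε)
  obtain ⟨C, hC⟩ := hx k
  have hC0 : Tendsto (fun n : ℕ => C / n) atTop (𝓝 0) := tendsto_const_div_atTop_nhds_zero_nat C
  filter_upwards [eventually_gt_atTop 0, hC0.eventually_lt_const (half_pos hε)] with n hn hn2
  have hn' : (0 : ℝ) < n := by exact_mod_cast hn
  have h := hC n
  have hsum : birkhoffSum T (fun x => f x - (I + 1 / (k + 1 : ℝ))) n x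
      = birkhoffSum T f n x - n * (I + 1 / (k + 1 : ℝ)) := by
    simp only [birkhoffSum, Finset.sum_sub_distrib, Finset.sum_const, Finset.card_range,
      nsmul_eq_mul]
  rw [hsum] at h
  rw [div_le_iff₀ hn']
  rw [div_lt_iff₀ hn'] at hn2
  nlinarith

/-- **Birkhoff's pointwise ergodic theorem** for an ergodic transformation. -/
theorem tendsto_birkhoffSum_div [IsProbabilityMeasure P] (hT : Ergodic T P)
    (hfm : Measurable f) (hf : Integrable f P) :
    ∀ᵐ x ∂P, Tendsto (fun n : ℕ => birkhoffSum T f n x / n) atTop (𝓝 (∫ x, f x ∂P)) := by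
  filter_upwards [eventually_birkhoffSum_le hT hfm hf,
    eventually_birkhoffSum_le hT hfm.neg hf.neg] with x h1 h2
  refine tendsto_order.2 ⟨fun a ha => ?_, fun a ha => ?_⟩
  · filter_upwards [h2 ((∫ x, f x ∂P - a) / 2) (by linarith)] with n hn
    have : birkhoffSum T (-f) n x = - birkhoffSum T f n x := by
      simp [birkhoffSum, Finset.sum_neg_distrib]
    rw [this, neg_div] at hn
    simp only [Pi.neg_apply, integral_neg] at hn
    linarith
  · filter_upwards [h1 ((a - ∫ x, f x ∂P) / 2) (by linarith)] with n hn
    linarith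

end Birkhoff

/-! ### Random walks given by random maps -/

section RandomWalk

variable {G X : Type*}

/-- The trajectory `n ↦ w_{n-1} ⋯ w_1 w_0 x` of a point under a sequence of maps. -/
def traj (act : G → X → X) (w : ℕ → G) : ℕ → X → X
  | 0 => id
  | n + 1 => fun x => act (w n) (traj act w n x)

/-- The skew product `(w, x) ↦ (shift w, w₀ x)`. -/
def skew (act : G → X → X) (p : (ℕ → G) × X) : (ℕ → G) × X :=
  (fun n => p.1 (n + 1), act (p.1 0) p.2)

/-- Prepend a letter to a sequence. -/
def seqCons (p : G × (ℕ → G)) : ℕ → G := fun n => Nat.casesOn n p.1 p.2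

lemma skew_iterate (act : G → X → X) (n : ℕ) (p : (ℕ → G) × X) :
    (skew act)^[n] p = (fun k => p.1 (k + n), traj act p.1 n p.2) := by
  induction n with
  | zero => rfl
  | succ n ih =>
    rw [Function.iterate_succ_apply', ih]
    simp only [skew, traj, zero_add, Prod.mk.injEq, and_true]
    funext k
    exact congrArg p.1 (by omega)

variable [MeasurableSpace G] [MeasurableSpace X]

lemma measurable_traj {act : G → X → X} (hact : Measurable (Function.uncurry act)) (n : ℕ) :
    Measurable fun p : (ℕ → G) × X => traj act p.1 n p.2 := by
  induction n with
  | zero => exact measurable_snd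
  | succ n ih =>
    exact hact.comp (((measurable_pi_apply n).comp measurable_fst).prodMk ih)

lemma measurable_skew {act : G → X → X} (hact : Measurable (Function.uncurry act)) :
    Measurable (skew act) := by
  refine Measurable.prodMk ?_ ?_
  · exact measurable_pi_lambda _ fun n => (measurable_pi_apply _).comp measurable_fst
  · have h : Measurable fun p : (ℕ → G) × X => (p.1 0, p.2) :=
      ((measurable_pi_apply 0).comp measurable_fst).prodMk measurable_snd
    exact hact.comp h

lemma measurable_seqCons : Measurable (seqCons : G × (ℕ → G) → ℕ → G) := by
  refine measurable_pi_lambda _ fun n => ?_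
  cases n with
  | zero => exact measurable_fst
  | succ n => exact (measurable_pi_apply n).comp measurable_snd

/-- An infinite product measure is determined by the boxes over initial segments. -/
lemma eq_infinitePi_of_initial {μ : Measure G} [IsProbabilityMeasure μ] {κ : Measure (ℕ → G)}
    (h : ∀ (N : ℕ) (t : ℕ → Set G), (∀ i, MeasurableSet (t i)) →
      κ {w | ∀ i < N, w i ∈ t i} = ∏ i ∈ Finset.range N, μ (t i)) :
    κ = Measure.infinitePi fun _ : ℕ => μ := by
  refine Measure.eq_infinitePi _ fun s t ht => ?_
  -- enlarge the index set to an initial segment, with trivial conditions at the new indices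
  classical
  obtain ⟨N, hN⟩ : ∃ N, s ⊆ Finset.range N :=
    ⟨s.sup id + 1, fun i hi => by
      rw [Finset.mem_range, Nat.lt_succ_iff]; exact Finset.le_sup (f := id) hi⟩
  let t' : ℕ → Set G := fun i => if i ∈ s then t i else univ
  have ht' : ∀ i, MeasurableSet (t' i) := fun i => by
    simp only [t']; split_ifs; exacts [ht i, .univ]
  have hset : (s : Set ℕ).pi t = {w | ∀ i < N, w i ∈ t' i} := by
    ext w
    simp only [Set.mem_pi, Finset.mem_coe, t', mem_ofPred_eq]
    refine ⟨fun h i _ => ?_, fun h i hi => ?_⟩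
    · split_ifs with his
      exacts [h i his, trivial]
    · simpa [hi] using h i (Finset.mem_range.1 (hN hi))
  have hprod : ∏ i ∈ s, μ (t i) = ∏ i ∈ Finset.range N, μ (t' i) := by
    rw [← Finset.prod_subset hN]
    · exact Finset.prod_congr rfl fun i hi => by simp [t', hi]
    · intro i _ hi; simp [t', hi]
  rw [hset, hprod, h N t' ht']

lemma infinitePi_initial (μ : Measure G) [IsProbabilityMeasure μ] (N : ℕ) {t : ℕ → Set G}
    (ht : ∀ i, MeasurableSet (t i)) :
    (Measure.infinitePi fun _ : ℕ => μ) {w | ∀ i < N, w i ∈ t i}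
      = ∏ i ∈ Finset.range N, μ (t i) := by
  rw [← Measure.infinitePi_pi (fun _ : ℕ => μ) fun i _ => ht i]
  congr 1
  ext w
  simp [Set.mem_pi]

lemma measurableSet_initial {t : ℕ → Set G} (ht : ∀ i, MeasurableSet (t i)) (N : ℕ) :
    MeasurableSet {w : ℕ → G | ∀ i < N, w i ∈ t i} := by
  have : {w : ℕ → G | ∀ i < N, w i ∈ t i} = ((Finset.range N : Finset ℕ) : Set ℕ).pi t := by
    ext w; simp [Set.mem_pi]
  rw [this]
  exact .pi (Finset.countable_toSet _) fun i _ => ht i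

/-- The first letter of an i.i.d. sequence is independent of the others, which form an i.i.d.
sequence of the same law. -/
lemma map_seqCons (μ : Measure G) [IsProbabilityMeasure μ] :
    (μ.prod (Measure.infinitePi fun _ : ℕ => μ)).map seqCons
      = Measure.infinitePi fun _ : ℕ => μ := by
  refine eq_infinitePi_of_initial fun N t ht => ?_
  rw [Measure.map_apply measurable_seqCons (measurableSet_initial ht N)]
  cases N with
  | zero => simp
  | succ N =>
    have hpre : seqCons ⁻¹' {w | ∀ i < N + 1, w i ∈ t i}
        = t 0 ×ˢ {w | ∀ i < N, w i ∈ t (i + 1)} := by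
      ext ⟨g, w⟩
      constructor
      · exact fun h => ⟨h 0 (by omega), fun i hi => h (i + 1) (by omega)⟩
      · rintro ⟨h0, h⟩ i hi
        cases i with
        | zero => exact h0
        | succ i => exact h i (by omega)
    rw [hpre, Measure.prod_prod, infinitePi_initial μ N fun i => ht (i + 1),
      Finset.prod_range_succ']
    ring

/-- Conditioning on the first letter of an i.i.d. sequence. -/
lemma infinitePi_apply_eq_lintegral (μ : Measure G) [IsProbabilityMeasure μ] {S : Set (ℕ → G)}
    (hS : MeasurableSet S) :
    (Measure.infinitePi fun _ : ℕ => μ) S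
      = ∫⁻ g, (Measure.infinitePi fun _ : ℕ => μ) {w | seqCons (g, w) ∈ S} ∂μ := by
  conv_lhs => rw [← map_seqCons μ, Measure.map_apply measurable_seqCons hS,
    Measure.prod_apply (measurable_seqCons hS)]
  rfl

/-- `ν` is stationary for the random walk `x ↦ g x`, where `g` has law `μ`. -/
def WalkStationary (act : G → X → X) (μ : Measure G) (ν : Measure X) : Prop :=
  (μ.prod ν).map (Function.uncurry act) = ν

/-- `ν` is ergodic for the random walk: the almost surely invariant sets are trivial. -/
def WalkErgodic (act : G → X → X) (μ : Measure G) (ν : Measure X) : Prop :=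
  ∀ A : Set X, MeasurableSet A → (∀ᵐ g ∂μ, act g ⁻¹' A =ᵐ[ν] A) → ν A = 0 ∨ ν A = 1

variable {act : G → X → X} {μ : Measure G} {ν : Measure X}

lemma WalkStationary.measurePreserving (hact : Measurable (Function.uncurry act))
    (hν : WalkStationary act μ ν) :
    MeasurePreserving (Function.uncurry act) (μ.prod ν) ν := ⟨hact, hν⟩

lemma WalkStationary.integral_comp (hact : Measurable (Function.uncurry act))
    (hν : WalkStationary act μ ν) {h : X → ℝ} (hm : Measurable h) :
    ∫ p, h (act p.1 p.2) ∂(μ.prod ν) = ∫ x, h x ∂ν := by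
  conv_rhs => rw [← hν]
  rw [integral_map hact.aemeasurable hm.aestronglyMeasurable]
  rfl

/-- An almost surely invariant measurable function is constant for an ergodic measure. -/
lemma WalkErgodic.exists_ae_eq_const [SFinite μ] [IsProbabilityMeasure ν]
    (he : WalkErgodic act μ ν) {h : X → ℝ} (hm : Measurable h)
    (hinv : ∀ᵐ p ∂(μ.prod ν), h (act p.1 p.2) = h p.2) : ∃ c : ℝ, ∀ᵐ x ∂ν, h x = c := by
  have key : ∀ U : Set ℝ, MeasurableSet U → (∀ᵐ x ∂ν, h x ∈ U) ∨ (∀ᵐ x ∂ν, h x ∉ U) := by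
    intro U hU
    have h2 : ∀ᵐ g ∂μ, act g ⁻¹' (h ⁻¹' U) =ᵐ[ν] (h ⁻¹' U : Set X) := by
      filter_upwards [Measure.ae_ae_of_ae_prod hinv] with g hg
      filter_upwards [hg] with x hx
      exact propext (show h (act g x) ∈ U ↔ h x ∈ U by rw [hx])
    rcases he _ (hm hU) h2 with h0 | h1
    · right
      exact measure_eq_zero_iff_ae_notMem.1 h0
    · left
      exact (prob_compl_eq_zero_iff (hm hU)).2 h1
  obtain ⟨c, hc⟩ := Filter.exists_eventuallyEq_const_of_forall_separating
    (l := ae ν) (f := h) MeasurableSet key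
  exact ⟨c, hc⟩

variable [IsProbabilityMeasure μ] [IsProbabilityMeasure ν]

/-- The law of the random walk after one step. -/
noncomputable def walkStep (act : G → X → X) (μ : Measure G) (ν : Measure X) : Measure X :=
  (μ.prod ν).map (Function.uncurry act)

lemma isProbabilityMeasure_walkStep (hact : Measurable (Function.uncurry act)) (ν : Measure X)
    [IsProbabilityMeasure ν] : IsProbabilityMeasure (walkStep act μ ν) :=
  Measure.isProbabilityMeasure_map hact.aemeasurable

lemma isProbabilityMeasure_walkStep_iterate (hact : Measurable (Function.uncurry act))
    (ν : Measure X) [IsProbabilityMeasure ν] (k : ℕ) :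
    IsProbabilityMeasure ((walkStep act μ)^[k] ν) := by
  induction k with
  | zero => assumption
  | succ k ih =>
    rw [Function.iterate_succ_apply']
    exact isProbabilityMeasure_walkStep hact _

/-- The skew product maps the law of the random walk started with law `ν` to the law of the random
walk started one step later. -/
lemma map_skew (hact : Measurable (Function.uncurry act)) (ν : Measure X)
    [IsProbabilityMeasure ν] :
    ((Measure.infinitePi fun _ : ℕ => μ).prod ν).map (skew act)
      = (Measure.infinitePi fun _ : ℕ => μ).prod (walkStep act μ ν) := by
  have := isProbabilityMeasure_walkStep (μ := μ) hact ν
  refine (Measure.prod_eq fun s t hs ht => ?_).symm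
  have hpre := measurable_skew hact (hs.prod ht)
  rw [Measure.map_apply (measurable_skew hact) (hs.prod ht), Measure.prod_apply_symm hpre]
  have h1 : ∀ x : X, (Measure.infinitePi fun _ : ℕ => μ)
      ((fun w => (w, x)) ⁻¹' (skew act ⁻¹' s ×ˢ t))
      = (Measure.infinitePi fun _ : ℕ => μ) s *
        μ ((fun g => (g, x)) ⁻¹' (Function.uncurry act ⁻¹' t)) := by
    intro x
    have hm : MeasurableSet ((fun w : ℕ → G => (w, x)) ⁻¹' (skew act ⁻¹' s ×ˢ t)) :=
      measurable_prodMk_right hpre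
    conv_lhs => rw [← map_seqCons μ, Measure.map_apply measurable_seqCons hm]
    have : seqCons ⁻¹' ((fun w : ℕ → G => (w, x)) ⁻¹' (skew act ⁻¹' s ×ˢ t))
        = ((fun g => (g, x)) ⁻¹' (Function.uncurry act ⁻¹' t)) ×ˢ s := by
      ext ⟨g, w⟩
      exact and_comm
    rw [this, Measure.prod_prod, mul_comm]
  simp_rw [h1]
  rw [lintegral_const_mul _ (measurable_measure_prodMk_right (hact ht)),
    ← Measure.prod_apply_symm (hact ht), ← Measure.map_apply hact ht]
  rfl

lemma WalkStationary.measurePreserving_skew (hact : Measurable (Function.uncurry act))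
    (hν : WalkStationary act μ ν) :
    MeasurePreserving (skew act) ((Measure.infinitePi fun _ : ℕ => μ).prod ν)
      ((Measure.infinitePi fun _ : ℕ => μ).prod ν) :=
  ⟨measurable_skew hact, (map_skew hact ν).trans (congrArg _ hν)⟩

/-- The joint law of the `n`-th letter and the `n`-th point of a random walk. -/
lemma map_letter_traj (hact : Measurable (Function.uncurry act)) (ν : Measure X)
    [IsProbabilityMeasure ν] (n : ℕ) :
    ((Measure.infinitePi fun _ : ℕ => μ).prod ν).map (fun p => (p.1 n, traj act p.1 n p.2))
      = μ.prod ((walkStep act μ)^[n] ν) := by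
  have hpr := isProbabilityMeasure_walkStep_iterate (μ := μ) hact ν
  have h1 : ∀ n, ((Measure.infinitePi fun _ : ℕ => μ).prod ν).map (skew act)^[n]
      = (Measure.infinitePi fun _ : ℕ => μ).prod ((walkStep act μ)^[n] ν) := by
    intro n
    induction n with
    | zero => exact Measure.map_id
    | succ n ih =>
      rw [Function.iterate_succ', ← Measure.map_map (measurable_skew hact)
        ((measurable_skew hact).iterate n), ih, map_skew hact, Function.iterate_succ_apply']
  have hmp : MeasurePreserving (fun p : (ℕ → G) × X => (p.1 0, p.2))
      ((Measure.infinitePi fun _ : ℕ => μ).prod ((walkStep act μ)^[n] ν))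
      (μ.prod ((walkStep act μ)^[n] ν)) :=
    (measurePreserving_eval_infinitePi (fun _ : ℕ => μ) 0).prod (MeasurePreserving.id _)
  rw [← hmp.map_eq, ← h1 n, Measure.map_map hmp.measurable ((measurable_skew hact).iterate n)]
  congr 1
  funext p
  simp [skew_iterate]

/-- An integrable function with `h x ≤ h (g x)` almost surely is almost surely invariant under a
stationary random walk. -/
lemma WalkStationary.ae_eq_of_ae_le (hact : Measurable (Function.uncurry act))
    (hν : WalkStationary act μ ν) {h : X → ℝ} (hm : Measurable h) (hi : Integrable h ν)
    (hle : ∀ᵐ p ∂(μ.prod ν), h p.2 ≤ h (act p.1 p.2)) :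
    ∀ᵐ p ∂(μ.prod ν), h (act p.1 p.2) = h p.2 := by
  have h1 : Integrable (fun p : G × X => h (act p.1 p.2)) (μ.prod ν) :=
    (hν.measurePreserving hact).integrable_comp_of_integrable hi
  have h2 : Integrable (fun p : G × X => h p.2) (μ.prod ν) := hi.comp_snd μ
  have h3 : ∫ p, (h (act p.1 p.2) - h p.2) ∂(μ.prod ν) = 0 := by
    rw [integral_sub h1 h2, sub_eq_zero]
    have e1 : ∫ p, h (act p.1 p.2) ∂(μ.prod ν) = ∫ x, h x ∂ν := hν.integral_comp hact hm
    have e2 : ∫ p : G × X, h p.2 ∂(μ.prod ν) = ∫ x, h x ∂ν := by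
      rw [integral_fun_snd]; simp
    rw [e1, e2]
  have h4 := (integral_eq_zero_iff_of_nonneg_ae (by
    filter_upwards [hle] with p hp using sub_nonneg.2 hp) (h1.sub h2)).1 h3
  filter_upwards [h4] with p hp
  simpa [sub_eq_zero] using hp

/-- A bounded harmonic function is almost surely invariant under a stationary random walk, as
`∫ (h (g x) - h x)² = 0`. -/
lemma WalkStationary.ae_eq_of_harmonic (hact : Measurable (Function.uncurry act))
    (hν : WalkStationary act μ ν) {h : X → ℝ} (hm : Measurable h) {C : ℝ} (hC : ∀ x, |h x| ≤ C)
    (hh : ∀ x, h x = ∫ g, h (act g x) ∂μ) :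
    ∀ᵐ p ∂(μ.prod ν), h (act p.1 p.2) = h p.2 := by
  have hm1 : Measurable fun p : G × X => h (act p.1 p.2) := hm.comp hact
  have hm2 : Measurable fun p : G × X => h p.2 := hm.comp measurable_snd
  have hC0 : 0 ≤ C := by
    obtain ⟨x⟩ := nonempty_of_isProbabilityMeasure ν
    exact (abs_nonneg _).trans (hC x)
  have hb : ∀ {f k : G × X → ℝ}, Measurable f → Measurable k → (∀ p, |f p| ≤ C) →
      (∀ p, |k p| ≤ C) → Integrable (fun p => f p * k p) (μ.prod ν) := by
    intro f k hf hk hfC hkC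
    refine Integrable.of_bound (hf.mul hk).aestronglyMeasurable (C * C)
      (Eventually.of_forall fun p => ?_)
    rw [Real.norm_eq_abs, abs_mul]
    exact mul_le_mul (hfC p) (hkC p) (abs_nonneg _) hC0
  have i1 := hb hm1 hm1 (fun p => hC _) (fun p => hC _)
  have i2 := hb hm1 hm2 (fun p => hC _) (fun p => hC _)
  have i3 := hb hm2 hm2 (fun p => hC _) (fun p => hC _)
  have e3 : ∫ p : G × X, h p.2 * h p.2 ∂(μ.prod ν) = ∫ x, h x * h x ∂ν := by
    rw [integral_fun_snd (fun x => h x * h x)]; simp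
  have e1 : ∫ p, h (act p.1 p.2) * h (act p.1 p.2) ∂(μ.prod ν) = ∫ x, h x * h x ∂ν :=
    hν.integral_comp hact (hm.mul hm)
  have e2 : ∫ p, h (act p.1 p.2) * h p.2 ∂(μ.prod ν) = ∫ x, h x * h x ∂ν := by
    rw [integral_prod_symm _ i2]
    refine integral_congr_ae (Eventually.of_forall fun x => ?_)
    simp only
    rw [integral_mul_const, ← hh]
  have hsq : ∫ p, (h (act p.1 p.2) - h p.2) ^ 2 ∂(μ.prod ν) = 0 := by
    have : ∀ p : G × X, (h (act p.1 p.2) - h p.2) ^ 2 = h (act p.1 p.2) * h (act p.1 p.2)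
      - 2 * (h (act p.1 p.2) * h p.2) + h p.2 * h p.2 := fun p => by ring
    simp_rw [this]
    have i4 : Integrable (fun p : G × X => h (act p.1 p.2) * h (act p.1 p.2)
      - 2 * (h (act p.1 p.2) * h p.2)) (μ.prod ν) := i1.sub (i2.const_mul 2)
    rw [integral_add i4 i3, integral_sub i1 (i2.const_mul 2), integral_const_mul, e1, e2, e3]
    ring
  have hint : Integrable (fun p : G × X => (h (act p.1 p.2) - h p.2) ^ 2) (μ.prod ν) := by
    refine ((i1.sub (i2.const_mul 2)).add i3).congr (Eventually.of_forall fun p => ?_)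
    simp only [Pi.add_apply, Pi.sub_apply]; ring
  have h4 := (integral_eq_zero_iff_of_nonneg (fun p => sq_nonneg _) hint).1 hsq
  filter_upwards [h4] with p hp
  simpa [sub_eq_zero] using hp

/-- The skew product over an ergodic stationary measure is ergodic. For an invariant set `B`, the
probabilities of its sections are harmonic, hence constant; invariance under the iterates makes
`B` independent of all boxes, hence of itself. -/
theorem WalkErgodic.ergodic_skew (hact : Measurable (Function.uncurry act))
    (hν : WalkStationary act μ ν) (he : WalkErgodic act μ ν) :
    Ergodic (skew act) ((Measure.infinitePi fun _ : ℕ => μ).prod ν) := by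
  refine ⟨hν.measurePreserving_skew hact, ⟨fun B hB hinv => ?_⟩⟩
  set P : Measure (ℕ → G) := Measure.infinitePi fun _ : ℕ => μ with hP
  -- the probability that the sequence is in a box and `(w, x)` is in `B`
  let q : ℕ → (ℕ → Set G) → X → ℝ≥0∞ := fun N t x => P ({w | ∀ i < N, w i ∈ t i} ∩ {w | (w, x) ∈ B})
  have hsec : ∀ x, MeasurableSet {w : ℕ → G | (w, x) ∈ B} := fun x => measurable_prodMk_right hB
  have hinv' : ∀ g w x, (seqCons (g, w), x) ∈ B ↔ (w, act g x) ∈ B := by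
    intro g w x
    conv_lhs => rw [← hinv]
    rfl
  have hqsucc : ∀ N t, (∀ i, MeasurableSet (t i)) → ∀ x,
      q (N + 1) t x = ∫⁻ g, (t 0).indicator (fun g => q N (fun i => t (i + 1)) (act g x)) g ∂μ := by
    intro N t ht x
    simp only [q]
    rw [hP, infinitePi_apply_eq_lintegral μ ((measurableSet_initial ht _).inter (hsec x))]
    refine lintegral_congr fun g => ?_
    by_cases hg : g ∈ t 0
    · rw [indicator_of_mem hg]
      congr 1
      ext w
      simp only [mem_inter_iff, mem_ofPred_eq, hinv']
      refine and_congr_left fun _ => ⟨fun h i hi => h (i + 1) (by omega), fun h i hi => ?_⟩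
      cases i with
      | zero => exact hg
      | succ i => exact h i (by omega)
    · rw [indicator_of_notMem hg]
      convert measure_empty (μ := P)
      ext w
      simp only [mem_inter_iff, mem_ofPred_eq, mem_empty_iff_false, iff_false, not_and]
      exact fun h => absurd (h 0 (by omega)) hg
  let h : X → ℝ := fun x => (q 0 (fun _ => univ) x).toReal
  have hq0 : ∀ t x, q 0 t x = P {w | (w, x) ∈ B} := fun t x => by simp [q]
  have hm : Measurable h := by
    simp only [h, hq0]
    exact (measurable_measure_prodMk_right hB).ennreal_toReal
  have hqle : ∀ N t x, q N t x ≤ 1 := fun N t x => prob_le_one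
  have hharm : ∀ x, h x = ∫ g, h (act g x) ∂μ := by
    intro x
    have h1 : q 0 (fun _ => univ) x = ∫⁻ g, q 0 (fun _ => univ) (act g x) ∂μ := by
      have := hqsucc 0 (fun _ => univ) (fun _ => .univ) x
      simp only [indicator_univ] at this
      rw [← this]
      simp [q]
    simp only [h]
    rw [h1, integral_toReal]
    · simp only [hq0]
      exact ((measurable_measure_prodMk_right hB).comp
        (hact.comp measurable_prodMk_right)).aemeasurable
    · exact Eventually.of_forall fun g => (hqle _ _ _).trans_lt ENNReal.one_lt_top
  have hinvh := hν.ae_eq_of_harmonic hact hm (C := 1) (fun x => by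
    rw [abs_of_nonneg ENNReal.toReal_nonneg]
    exact ENNReal.toReal_le_of_le_ofReal zero_le_one (by simpa using hqle _ _ _)) hharm
  obtain ⟨c₀, hc₀⟩ := he.exists_ae_eq_const hm hinvh
  let c : ℝ≥0∞ := ENNReal.ofReal c₀
  have hc : ∀ᵐ x ∂ν, P {w | (w, x) ∈ B} = c := by
    filter_upwards [hc₀] with x hx
    rw [← hq0 (fun _ => univ) x]
    simp only [c, ← hx, h]
    rw [ENNReal.ofReal_toReal ((hqle _ _ _).trans_lt ENNReal.one_lt_top).ne]
  have hq : ∀ N t, (∀ i, MeasurableSet (t i)) → ∀ᵐ x ∂ν,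
      q N t x = (∏ i ∈ Finset.range N, μ (t i)) * c := by
    intro N
    induction N with
    | zero =>
      intro t _
      filter_upwards [hc] with x hx
      simp [hq0, hx]
    | succ N ih =>
      intro t ht
      have h1 := ih (fun i => t (i + 1)) fun i => ht (i + 1)
      have h2 : ∀ᵐ p ∂(μ.prod ν), q N (fun i => t (i + 1)) (act p.1 p.2)
          = (∏ i ∈ Finset.range N, μ (t (i + 1))) * c :=
        (hν.measurePreserving hact).quasiMeasurePreserving.ae h1
      have h3 : ∀ᵐ x ∂ν, ∀ᵐ g ∂μ, q N (fun i => t (i + 1)) (act g x)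
          = (∏ i ∈ Finset.range N, μ (t (i + 1))) * c := by
        have h4 : ∀ᵐ p ∂(ν.prod μ), q N (fun i => t (i + 1)) (act p.2 p.1)
          = (∏ i ∈ Finset.range N, μ (t (i + 1))) * c :=
          Measure.measurePreserving_swap.quasiMeasurePreserving.ae h2
        exact Measure.ae_ae_of_ae_prod h4
      filter_upwards [h3] with x hx
      rw [hqsucc N t ht x, Finset.prod_range_succ']
      rw [lintegral_indicator (ht 0)]
      rw [lintegral_congr_ae (ae_restrict_of_ae hx)]
      simp only [lintegral_const, Measure.restrict_apply .univ, univ_inter]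
      ring
  -- the box probabilities determine the restriction of the measure to `B`
  have hrect : ∀ s t, MeasurableSet s → MeasurableSet t →
      ((P.prod ν).restrict B) (s ×ˢ t) = P s * (c * ν t) := by
    intro s t hs ht
    have happ : ∀ s, MeasurableSet s → ((P.prod ν).restrict B) (s ×ˢ t)
        = ∫⁻ x in t, P (s ∩ {w | (w, x) ∈ B}) ∂ν := by
      intro s hs
      rw [Measure.restrict_apply (hs.prod ht), Measure.prod_apply_symm ((hs.prod ht).inter hB),
        ← lintegral_indicator ht]
      refine lintegral_congr fun x => ?_
      by_cases hx : x ∈ t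
      · rw [indicator_of_mem hx]
        congr 1; ext w; simp [hx]
      · rw [indicator_of_notMem hx]
        convert measure_empty (μ := P)
        ext w; simp [hx]
    have hbox : ∀ (N : ℕ) (u : ℕ → Set G), (∀ i, MeasurableSet (u i)) →
        ((P.prod ν).restrict B) ({w | ∀ i < N, w i ∈ u i} ×ˢ t)
          = (∏ i ∈ Finset.range N, μ (u i)) * (c * ν t) := by
      intro N u hu
      rw [happ _ (measurableSet_initial hu N), lintegral_congr_ae (ae_restrict_of_ae (hq N u hu))]
      simp only [lintegral_const, Measure.restrict_apply .univ, univ_inter]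
      ring
    by_cases hct : c * ν t = 0
    · rw [hct, mul_zero]
      refine measure_mono_null (prod_mono (subset_univ s) subset_rfl) ?_
      have := hbox 0 (fun _ => univ) fun _ => .univ
      simpa [hct] using this
    · have hct' : c * ν t ≠ ⊤ := ENNReal.mul_ne_top ENNReal.ofReal_ne_top (measure_ne_top _ _)
      let κ : Measure (ℕ → G) :=
        (c * ν t)⁻¹ • (((P.prod ν).restrict B).restrict (univ ×ˢ t)).map Prod.fst
      have hκ : ∀ s, MeasurableSet s →
          κ s = (c * ν t)⁻¹ * ((P.prod ν).restrict B) (s ×ˢ t) := by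
        intro s hs
        simp only [κ, Measure.smul_apply, smul_eq_mul]
        rw [Measure.map_apply measurable_fst hs, Measure.restrict_apply (measurable_fst hs)]
        congr 2
        ext ⟨w, x⟩; simp
      have hκP : κ = P := by
        refine eq_infinitePi_of_initial fun N u hu => ?_
        rw [hκ _ (measurableSet_initial hu N), hbox N u hu, mul_comm _ (c * ν t), ← mul_assoc,
          ENNReal.inv_mul_cancel hct hct', one_mul]
      have h1 := hκ s hs
      rw [hκP] at h1
      rw [h1, mul_comm _ (c * ν t), ← mul_assoc, ENNReal.mul_inv_cancel hct hct', one_mul]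
  have : IsFiniteMeasure (c • ν) := ν.smul_finite ENNReal.ofReal_ne_top
  have hres : (P.prod ν).restrict B = P.prod (c • ν) := by
    refine (Measure.prod_eq fun s t hs ht => ?_).symm
    rw [hrect s t hs ht, Measure.smul_apply, smul_eq_mul]
  have hcB : (P.prod ν) B = c := by
    have h1 := hrect univ univ .univ .univ
    simpa using h1
  have hcc : c = c * c := by
    have h1 : (P.prod ν).restrict B B = P.prod (c • ν) B := by rw [hres]
    rw [Measure.restrict_apply_self, Measure.prod_smul_right, Measure.smul_apply, smul_eq_mul,
      hcB] at h1
    exact h1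
  have hctop : c ≠ ⊤ := ENNReal.ofReal_ne_top
  rw [eventuallyConst_set']
  rcases eq_or_ne c 0 with h0 | h0
  · left
    rw [h0] at hcB
    exact ae_eq_empty.2 hcB
  · right
    have h1 : c = 1 := by
      have := (ENNReal.mul_eq_left h0 hctop (b := c)).1 hcc.symm
      exact this
    rw [h1] at hcB
    exact ae_eq_univ.2 ((prob_compl_eq_zero_iff hB).2 hcB)

/-- Time averages along the trajectories of an ergodic random walk. -/
theorem WalkErgodic.tendsto_average (hact : Measurable (Function.uncurry act))
    (hν : WalkStationary act μ ν) (he : WalkErgodic act μ ν) {φ : G × X → ℝ}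
    (hφm : Measurable φ) (hφ : Integrable φ (μ.prod ν)) :
    ∀ᵐ p ∂((Measure.infinitePi fun _ : ℕ => μ).prod ν),
      Tendsto (fun n : ℕ => (∑ k ∈ Finset.range n, φ (p.1 k, traj act p.1 k p.2)) / n) atTop
        (𝓝 (∫ q, φ q ∂(μ.prod ν))) := by
  let f : (ℕ → G) × X → ℝ := fun p => φ (p.1 0, p.2)
  have hmp : MeasurePreserving (fun p : (ℕ → G) × X => (p.1 0, p.2))
      ((Measure.infinitePi fun _ : ℕ => μ).prod ν) (μ.prod ν) :=
    (measurePreserving_eval_infinitePi (fun _ : ℕ => μ) 0).prod (MeasurePreserving.id ν)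
  have hf : Integrable f ((Measure.infinitePi fun _ : ℕ => μ).prod ν) :=
    hmp.integrable_comp_of_integrable hφ
  have hint : ∫ p, f p ∂((Measure.infinitePi fun _ : ℕ => μ).prod ν) = ∫ q, φ q ∂(μ.prod ν) := by
    rw [← hmp.map_eq, integral_map hmp.measurable.aemeasurable hφm.aestronglyMeasurable]
  filter_upwards [tendsto_birkhoffSum_div (he.ergodic_skew hact hν)
    (f := f) (hφm.comp hmp.measurable) hf] with p hp
  rw [hint] at hp
  refine hp.congr fun n => ?_
  simp only [birkhoffSum, skew_iterate]
  simp [f]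

end RandomWalk

/-! ### Stationary measures on compact spaces -/

section StationaryMeasures

variable {G X : Type*} [MeasurableSpace G] [MeasurableSpace X] {act : G → X → X} {μ : Measure G}

lemma integral_walkStep [IsProbabilityMeasure μ] (hact : Measurable (Function.uncurry act))
    (ν : Measure X) [IsProbabilityMeasure ν] {φ : X → ℝ} (hφ : Measurable φ)
    (hi : Integrable (fun p : G × X => φ (act p.1 p.2)) (μ.prod ν)) :
    ∫ x, φ x ∂(walkStep act μ ν) = ∫ x, ∫ g, φ (act g x) ∂μ ∂ν := by
  rw [walkStep, integral_map hact.aemeasurable hφ.aestronglyMeasurable]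
  exact integral_prod_symm _ hi

lemma measureReal_mul_integral_cond (ν : Measure X) [IsFiniteMeasure ν] {B : Set X}
    (hB : ν B ≠ 0) (φ : X → ℝ) :
    ν.real B * ∫ x, φ x ∂(ProbabilityTheory.cond ν B) = ∫ x in B, φ x ∂ν := by
  have : ν.real B ≠ 0 := (ENNReal.toReal_pos hB (measure_ne_top _ _)).ne'
  rw [ProbabilityTheory.cond, integral_smul_measure, ENNReal.toReal_inv, smul_eq_mul,
    ← mul_assoc, ← measureReal_def, mul_inv_cancel₀ this, one_mul]

/-- Conditioning a stationary measure on an almost surely invariant set. -/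
lemma WalkStationary.cond [IsProbabilityMeasure μ] {ν : Measure X} [IsProbabilityMeasure ν]
    (hact : Measurable (Function.uncurry act)) (hν : WalkStationary act μ ν) {A : Set X}
    (hA : MeasurableSet A) (hinv : ∀ᵐ g ∂μ, act g ⁻¹' A =ᵐ[ν] A) :
    WalkStationary act μ (ProbabilityTheory.cond ν A) := by
  unfold WalkStationary
  ext E hE
  rw [Measure.map_apply hact hE, Measure.prod_apply (hact hE)]
  have h1 : ∫⁻ g, ProbabilityTheory.cond ν A (Prod.mk g ⁻¹' (Function.uncurry act ⁻¹' E)) ∂μ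
      = ∫⁻ g, (ν A)⁻¹ * ν (Prod.mk g ⁻¹' (Function.uncurry act ⁻¹' (A ∩ E))) ∂μ := by
    refine lintegral_congr_ae ?_
    filter_upwards [hinv] with g hg
    rw [ProbabilityTheory.cond_apply hA]
    congr 1
    refine measure_congr ?_
    filter_upwards [hg] with x hx
    have hx' : act g x ∈ A ↔ x ∈ A := iff_of_eq hx
    exact propext ⟨fun h => ⟨hx'.2 h.1, h.2⟩, fun h => ⟨hx'.1 h.1, h.2⟩⟩
  rw [h1, lintegral_const_mul _ (measurable_measure_prodMk_left (hact (hA.inter hE))),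
    ← Measure.prod_apply (hact (hA.inter hE)), ← Measure.map_apply hact (hA.inter hE), hν,
    ProbabilityTheory.cond_apply hA]

/-- An ergodic stationary measure is the only stationary probability measure that is absolutely
continuous with respect to it. -/
lemma WalkErgodic.eq_of_absolutelyContinuous [IsProbabilityMeasure μ] {ν α : Measure X}
    [IsProbabilityMeasure ν] [IsProbabilityMeasure α] (hact : Measurable (Function.uncurry act))
    (hν : WalkStationary act μ ν) (he : WalkErgodic act μ ν) (hα : WalkStationary act μ α)
    (hac : α ≪ ν) : α = ν := by
  ext E hE
  set P : Measure (ℕ → G) := Measure.infinitePi fun _ : ℕ => μ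
  let φ : G × X → ℝ := fun p => E.indicator (fun _ => (1 : ℝ)) p.2
  have hφm : Measurable φ := (measurable_const.indicator hE).comp measurable_snd
  have hφb : ∀ p, |φ p| ≤ 1 := fun p => by
    simp only [φ]; by_cases hp : p.2 ∈ E <;> simp [hp]
  have hφi : ∀ κ : Measure (G × X), IsProbabilityMeasure κ → Integrable φ κ := fun κ _ =>
    .of_bound hφm.aestronglyMeasurable 1 (Eventually.of_forall hφb)
  have hφint : ∀ κ : Measure X, IsProbabilityMeasure κ → ∫ p, φ p ∂(μ.prod κ) = κ.real E := by
    intro κ _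
    simp only [φ]
    rw [integral_fun_snd (fun x => E.indicator (fun _ => (1 : ℝ)) x), integral_indicator hE]
    simp
  -- the visit frequencies to `E` tend to `ν E` almost surely for `ν`, hence for `α`, while their
  -- mean for `α` is `α E`
  have h1 := he.tendsto_average hact hν hφm (hφi _ inferInstance)
  have h2 := (Measure.AbsolutelyContinuous.rfl (μ := P)).prod hac h1
  have hmp : ∀ k, MeasurePreserving (fun p : (ℕ → G) × X => ((skew act)^[k] p).2)
      (P.prod α) α := fun k =>
    measurePreserving_snd.comp ((hα.measurePreserving_skew hact).iterate k)
  have hk : ∀ k, ∫ p, φ (p.1 k, traj act p.1 k p.2) ∂(P.prod α) = α.real E := by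
    intro k
    have : ∀ p : (ℕ → G) × X, φ (p.1 k, traj act p.1 k p.2)
        = E.indicator (fun _ => (1 : ℝ)) (((skew act)^[k] p).2) := by
      intro p; rw [skew_iterate]
    simp_rw [this]
    rw [← integral_map (φ := fun p : (ℕ → G) × X => ((skew act)^[k] p).2)
      (f := E.indicator (fun _ => (1 : ℝ))) (hmp k).measurable.aemeasurable
      (measurable_const.indicator hE).aestronglyMeasurable, (hmp k).map_eq,
      integral_indicator hE]
    simp
  have hmeas : ∀ k, Measurable fun p : (ℕ → G) × X => φ (p.1 k, traj act p.1 k p.2) := fun k =>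
    (measurable_const.indicator hE).comp (measurable_traj hact k)
  have hlim : Tendsto (fun n : ℕ => ∫ p, (∑ k ∈ Finset.range n, φ (p.1 k, traj act p.1 k p.2)) / n
      ∂(P.prod α)) atTop (𝓝 (∫ _, ∫ q, φ q ∂(μ.prod ν) ∂(P.prod α))) := by
    refine tendsto_integral_of_dominated_convergence (fun _ => 1) ?_ (integrable_const _) ?_ h2
    · exact fun n => ((Finset.measurable_sum _ fun k _ => hmeas k).div_const _).aestronglyMeasurable
    · refine fun n => Eventually.of_forall fun p => ?_
      rw [Real.norm_eq_abs, abs_div, Nat.abs_cast]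
      refine div_le_one_of_le₀ ((Finset.abs_sum_le_sum_abs _ _).trans ?_) (Nat.cast_nonneg n)
      calc ∑ k ∈ Finset.range n, |φ (p.1 k, traj act p.1 k p.2)|
          ≤ ∑ _k ∈ Finset.range n, (1 : ℝ) := Finset.sum_le_sum fun k _ => hφb _
        _ = n := by simp
  have hconst : ∀ᶠ n : ℕ in atTop, ∫ p, (∑ k ∈ Finset.range n, φ (p.1 k, traj act p.1 k p.2)) / n
      ∂(P.prod α) = α.real E := by
    filter_upwards [eventually_gt_atTop 0] with n hn
    rw [integral_div, integral_finsetSum]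
    · simp only [hk, Finset.sum_const, Finset.card_range, nsmul_eq_mul]
      field_simp
    · exact fun k _ => .of_bound (hmeas k).aestronglyMeasurable 1
        (Eventually.of_forall fun p => hφb _)
  have hfin : α.real E = ν.real E := by
    have := tendsto_nhds_unique (tendsto_const_nhds.congr' (hconst.mono fun n hn => hn.symm)) hlim
    rw [hφint ν inferInstance] at this
    simpa using this
  exact (measureReal_eq_measureReal_iff (measure_ne_top _ _) (measure_ne_top _ _)).1 hfin

/-- The average of the laws of the first `N + 1` steps of the random walk. -/
noncomputable def cesaroLaw (act : G → X → X) (μ : Measure G) (ρ : Measure X) (N : ℕ) : Measure X :=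
  ((N : ℝ≥0∞) + 1)⁻¹ • ∑ k ∈ Finset.range (N + 1), (walkStep act μ)^[k] ρ

lemma isProbabilityMeasure_cesaroLaw [IsProbabilityMeasure μ]
    (hact : Measurable (Function.uncurry act)) (ρ : Measure X) [IsProbabilityMeasure ρ] (N : ℕ) :
    IsProbabilityMeasure (cesaroLaw act μ ρ N) := by
  have := isProbabilityMeasure_walkStep_iterate (μ := μ) hact ρ
  constructor
  simp only [cesaroLaw, Measure.smul_apply, Measure.coe_finsetSum, Finset.sum_apply,
    measure_univ, Finset.sum_const, Finset.card_range, nsmul_eq_mul, mul_one, smul_eq_mul]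
  push_cast
  exact ENNReal.inv_mul_cancel (by simp) (by simp [ENNReal.add_eq_top])

lemma integral_cesaroLaw (ρ : Measure X) {φ : X → ℝ}
    (hi : ∀ k, Integrable φ ((walkStep act μ)^[k] ρ)) (N : ℕ) :
    ∫ x, φ x ∂(cesaroLaw act μ ρ N)
      = (∑ k ∈ Finset.range (N + 1), ∫ x, φ x ∂((walkStep act μ)^[k] ρ)) / (N + 1) := by
  rw [cesaroLaw, integral_smul_measure, integral_finsetSum_measure fun k _ => hi k]
  rw [ENNReal.toReal_inv, ENNReal.toReal_add (by simp) (by simp), smul_eq_mul, div_eq_inv_mul]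
  simp

variable [TopologicalSpace X] [CompactSpace X] [T2Space X] [SecondCountableTopology X]
  [BorelSpace X]

lemma integrable_of_continuous {φ : X → ℝ} (hφ : Continuous φ) (ν : Measure X)
    [IsFiniteMeasure ν] : Integrable φ ν :=
  (BoundedContinuousFunction.mkOfCompact ⟨φ, hφ⟩).integrable ν

lemma continuous_integral_probabilityMeasure {φ : X → ℝ} (hφ : Continuous φ) :
    Continuous fun η : ProbabilityMeasure X => ∫ x, φ x ∂(η : Measure X) :=
  ProbabilityMeasure.continuous_integral_boundedContinuousFunction
    (BoundedContinuousFunction.mkOfCompact ⟨φ, hφ⟩)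

lemma measure_eq_of_integral_continuous_eq {α β : Measure X} [IsFiniteMeasure α]
    [IsFiniteMeasure β] (h : ∀ φ : X → ℝ, Continuous φ → ∫ x, φ x ∂α = ∫ x, φ x ∂β) : α = β :=
  ext_of_forall_integral_eq_of_IsFiniteMeasure fun f => h f f.continuous

lemma exists_abs_le_of_continuous {φ : X → ℝ} (hφ : Continuous φ) : ∃ C, ∀ x, |φ x| ≤ C :=
  ⟨‖BoundedContinuousFunction.mkOfCompact ⟨φ, hφ⟩‖, fun x =>
    (BoundedContinuousFunction.mkOfCompact ⟨φ, hφ⟩).norm_coe_le_norm x⟩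

lemma integrable_act_of_continuous [IsProbabilityMeasure μ]
    (hact : Measurable (Function.uncurry act)) {φ : X → ℝ} (hφ : Continuous φ) (ν : Measure X)
    [IsProbabilityMeasure ν] : Integrable (fun p : G × X => φ (act p.1 p.2)) (μ.prod ν) := by
  obtain ⟨C, hC⟩ := exists_abs_le_of_continuous hφ
  exact .of_bound (hφ.measurable.comp hact).aestronglyMeasurable C
    (Eventually.of_forall fun p => hC _)

lemma continuous_integral_act [IsProbabilityMeasure μ] (hact : Measurable (Function.uncurry act))
    (hc : ∀ g, Continuous (act g)) {φ : X → ℝ} (hφ : Continuous φ) :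
    Continuous fun x => ∫ g, φ (act g x) ∂μ := by
  obtain ⟨C, hC⟩ := exists_abs_le_of_continuous hφ
  refine continuous_of_dominated (bound := fun _ => C) ?_ ?_ (integrable_const _) ?_
  · exact fun x => (hφ.measurable.comp (hact.comp measurable_prodMk_right)).aestronglyMeasurable
  · exact fun x => Eventually.of_forall fun g => hC _
  · exact Eventually.of_forall fun g => hφ.comp (hc g)

lemma walkStationary_iff_integral [IsProbabilityMeasure μ]
    (hact : Measurable (Function.uncurry act)) {ν : Measure X} [IsProbabilityMeasure ν] :
    WalkStationary act μ ν ↔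
      ∀ φ : X → ℝ, Continuous φ → ∫ x, ∫ g, φ (act g x) ∂μ ∂ν = ∫ x, φ x ∂ν := by
  have := isProbabilityMeasure_walkStep (μ := μ) hact ν
  constructor
  · intro h φ hφ
    rw [← integral_walkStep hact ν hφ.measurable (integrable_act_of_continuous hact hφ ν)]
    rw [walkStep, h]
  · intro h
    refine measure_eq_of_integral_continuous_eq (α := walkStep act μ ν) fun φ hφ => ?_
    rw [integral_walkStep hact ν hφ.measurable (integrable_act_of_continuous hact hφ ν), h φ hφ]

lemma isClosed_walkStationary [IsProbabilityMeasure μ] (hact : Measurable (Function.uncurry act))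
    (hc : ∀ g, Continuous (act g)) :
    IsClosed {η : ProbabilityMeasure X | WalkStationary act μ (η : Measure X)} := by
  have : {η : ProbabilityMeasure X | WalkStationary act μ (η : Measure X)}
      = ⋂ φ : {φ : X → ℝ // Continuous φ}, {η : ProbabilityMeasure X |
        ∫ x, ∫ g, φ.1 (act g x) ∂μ ∂(η : Measure X) = ∫ x, φ.1 x ∂(η : Measure X)} := by
    ext η
    simp [walkStationary_iff_integral hact]
  rw [this]
  exact isClosed_iInter fun φ => isClosed_eq
    (continuous_integral_probabilityMeasure (continuous_integral_act hact hc φ.2))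
    (continuous_integral_probabilityMeasure φ.2)

/-- **Krylov–Bogolyubov**: Cesàro averages of the laws of the random walk, started from arbitrary
distributions, accumulate on stationary measures. -/
lemma exists_stationary_limit [IsProbabilityMeasure μ] (hact : Measurable (Function.uncurry act))
    (hc : ∀ g, Continuous (act g)) (ρ : ℕ → Measure X) [∀ N, IsProbabilityMeasure (ρ N)] :
    ∃ η : ProbabilityMeasure X, WalkStationary act μ (η : Measure X) ∧
      ∃ U : Ultrafilter ℕ, (U : Filter ℕ) ≤ atTop ∧ ∀ φ : X → ℝ, Continuous φ →
        Tendsto (fun N : ℕ => (∑ k ∈ Finset.range (N + 1),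
          ∫ x, φ x ∂((walkStep act μ)^[k] (ρ N))) / (N + 1)) U (𝓝 (∫ x, φ x ∂(η : Measure X))) := by
  have hpr : ∀ N k, IsProbabilityMeasure ((walkStep act μ)^[k] (ρ N)) := fun N k =>
    isProbabilityMeasure_walkStep_iterate hact (ρ N) k
  let κ : ℕ → ProbabilityMeasure X := fun N =>
    ⟨cesaroLaw act μ (ρ N) N, isProbabilityMeasure_cesaroLaw hact (ρ N) N⟩
  let U : Ultrafilter ℕ := Ultrafilter.of atTop
  have hU : (U : Filter ℕ) ≤ atTop := Ultrafilter.of_le _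
  obtain ⟨η, hη⟩ : ∃ η, Tendsto κ U (𝓝 η) := ⟨_, (U.map κ).le_nhds_lim⟩
  have hlim : ∀ φ : X → ℝ, Continuous φ → Tendsto (fun N : ℕ => (∑ k ∈ Finset.range (N + 1),
      ∫ x, φ x ∂((walkStep act μ)^[k] (ρ N))) / (N + 1)) U (𝓝 (∫ x, φ x ∂(η : Measure X))) := by
    intro φ hφ
    refine (((continuous_integral_probabilityMeasure hφ).tendsto η).comp hη).congr fun N => ?_
    exact integral_cesaroLaw (ρ N) (fun k => integrable_of_continuous hφ _) N
  refine ⟨η, (walkStationary_iff_integral hact).2 fun φ hφ => ?_, U, hU, hlim⟩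
  have h1 := hlim φ hφ
  have h2 := hlim _ (continuous_integral_act (μ := μ) hact hc hφ)
  obtain ⟨C, hC⟩ := exists_abs_le_of_continuous hφ
  have hCκ : ∀ N k, |∫ x, φ x ∂((walkStep act μ)^[k] (ρ N))| ≤ C := fun N k => by
    simpa using norm_integral_le_of_norm_le_const (μ := (walkStep act μ)^[k] (ρ N))
      (f := φ) (Eventually.of_forall hC)
  -- the two averages differ by the first and the last term
  have hdiff : ∀ N : ℕ, |(∑ k ∈ Finset.range (N + 1),
        ∫ x, ∫ g, φ (act g x) ∂μ ∂((walkStep act μ)^[k] (ρ N))) / (N + 1)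
      - (∑ k ∈ Finset.range (N + 1), ∫ x, φ x ∂((walkStep act μ)^[k] (ρ N))) / (N + 1)|
      ≤ 2 * C * (1 / ((N : ℝ) + 1)) := by
    intro N
    have hs : ∀ k, ∫ x, ∫ g, φ (act g x) ∂μ ∂((walkStep act μ)^[k] (ρ N))
        = ∫ x, φ x ∂((walkStep act μ)^[k + 1] (ρ N)) := fun k => by
      rw [Function.iterate_succ_apply', integral_walkStep hact _ hφ.measurable
        (integrable_act_of_continuous hact hφ _)]
    simp_rw [hs]
    rw [← sub_div, ← Finset.sum_sub_distrib, Finset.sum_range_sub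
      (fun k => ∫ x, φ x ∂((walkStep act μ)^[k] (ρ N))), abs_div,
      abs_of_pos (by positivity : (0 : ℝ) < N + 1), div_eq_mul_one_div]
    refine mul_le_mul_of_nonneg_right ?_ (by positivity)
    linarith [abs_sub (∫ x, φ x ∂((walkStep act μ)^[N + 1] (ρ N)))
      (∫ x, φ x ∂((walkStep act μ)^[0] (ρ N))), hCκ N (N + 1), hCκ N 0]
  have h3 : Tendsto (fun N : ℕ => 2 * C * (1 / ((N : ℝ) + 1))) U (𝓝 0) := by
    have := (tendsto_one_div_add_atTop_nhds_zero_nat (𝕜 := ℝ)).const_mul (2 * C)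
    rw [mul_zero] at this
    exact this.mono_left hU
  have h4 := squeeze_zero_norm (f := fun N : ℕ => (∑ k ∈ Finset.range (N + 1),
      ∫ x, ∫ g, φ (act g x) ∂μ ∂((walkStep act μ)^[k] (ρ N))) / (N + 1)
      - (∑ k ∈ Finset.range (N + 1), ∫ x, φ x ∂((walkStep act μ)^[k] (ρ N))) / (N + 1)) hdiff h3
  exact sub_eq_zero.1 (tendsto_nhds_unique (h2.sub h1) h4)

/-- A compact set of probability measures that is stable under conditioning on invariant sets
contains an ergodic measure: a maximum of a strictly convex functional. -/
lemma exists_walkErgodic_of_isClosed (K : Set (ProbabilityMeasure X)) (hK : IsClosed K)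
    (hne : K.Nonempty)
    (hface : ∀ η ∈ K, ∀ A : Set X, MeasurableSet A →
      (∀ᵐ g ∂μ, act g ⁻¹' A =ᵐ[(η : Measure X)] A) → (η : Measure X) A ≠ 0 →
      (η : Measure X) A ≠ 1 → ∃ α ∈ K, (α : Measure X) = ProbabilityTheory.cond (η : Measure X) A) :
    ∃ η ∈ K, WalkErgodic act μ (η : Measure X) := by
  -- test functions, normalized to be bounded by `1`, whose span determines a measure
  let d : ℕ → C(X, ℝ) := TopologicalSpace.denseSeq C(X, ℝ)
  let ψ : ℕ → X → ℝ := fun i x => d i x / (1 + ‖d i‖)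
  have hψ : ∀ i, Continuous (ψ i) := fun i => (d i).continuous.div_const _
  have hψ1 : ∀ i x, |ψ i x| ≤ 1 := fun i x => by
    have h0 : (0 : ℝ) < 1 + ‖d i‖ := by positivity
    simp only [ψ]
    rw [abs_div, abs_of_pos h0, div_le_one h0]
    linarith [(d i).norm_coe_le_norm x, Real.norm_eq_abs (d i x)]
  let I : ℕ → ProbabilityMeasure X → ℝ := fun i η => ∫ x, ψ i x ∂(η : Measure X)
  have hI : ∀ i, Continuous (I i) := fun i => continuous_integral_probabilityMeasure (hψ i)
  have hI1 : ∀ i η, (I i η) ^ 2 ≤ 1 := fun i η => by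
    rw [sq_le_one_iff_abs_le_one]
    simpa using norm_integral_le_of_norm_le_const (μ := (η : Measure X))
      (f := ψ i) (Eventually.of_forall (hψ1 i))
  have hbd : ∀ i η, ‖(1 / 2 : ℝ) ^ i * (I i η) ^ 2‖ ≤ (1 / 2 : ℝ) ^ i := fun i η => by
    rw [Real.norm_of_nonneg (by positivity)]
    exact mul_le_of_le_one_right (by positivity) (hI1 i η)
  have hsum : ∀ η, Summable fun i => (1 / 2 : ℝ) ^ i * (I i η) ^ 2 := fun η =>
    Summable.of_norm_bounded summable_geometric_two (hbd · η)
  -- `F` is continuous, and strictly convex because the test functions separate measures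
  let F : ProbabilityMeasure X → ℝ := fun η => ∑' i, (1 / 2 : ℝ) ^ i * (I i η) ^ 2
  have hF : Continuous F := continuous_tsum
    (fun i => continuous_const.mul ((hI i).pow 2)) summable_geometric_two hbd
  obtain ⟨η, hηK, hmax⟩ := hK.isCompact.exists_isMaxOn hne hF.continuousOn
  refine ⟨η, hηK, fun A hA hinv => ?_⟩
  by_contra hcon
  push Not at hcon
  obtain ⟨hA0, hA1⟩ := hcon
  have hinvc : ∀ᵐ g ∂μ, act g ⁻¹' Aᶜ =ᵐ[(η : Measure X)] (Aᶜ : Set X) := by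
    filter_upwards [hinv] with g hg
    exact hg.compl
  have hAc0 : (η : Measure X) Aᶜ ≠ 0 := fun h => hA1 ((prob_compl_eq_zero_iff hA).1 h)
  have hAc1 : (η : Measure X) Aᶜ ≠ 1 := fun h => hA0 ((prob_compl_eq_one_iff hA).1 h)
  obtain ⟨α, hαK, hα⟩ := hface η hηK A hA hinv hA0 hA1
  obtain ⟨β, hβK, hβ⟩ := hface η hηK Aᶜ hA.compl hinvc hAc0 hAc1
  set t : ℝ := (η : Measure X).real A
  have ht0 : 0 < t := ENNReal.toReal_pos hA0 (measure_ne_top _ _)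
  have ht1 : t < 1 := lt_of_le_of_ne measureReal_le_one fun h => hA1 (by
    rw [← ENNReal.ofReal_toReal (measure_ne_top (η : Measure X) A)]
    change ENNReal.ofReal t = 1
    rw [h, ENNReal.ofReal_one])
  have htc : (η : Measure X).real Aᶜ = 1 - t := by
    rw [measureReal_compl hA]; simp [t]
  -- `η` is a proper convex combination of its conditionings `α` on `A` and `β` on `Aᶜ`
  have hconv : ∀ i, I i η = t * I i α + (1 - t) * I i β := by
    intro i
    simp only [I]
    rw [hα, hβ, ← htc, measureReal_mul_integral_cond _ hA0, measureReal_mul_integral_cond _ hAc0]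
    exact (integral_add_compl hA (integrable_of_continuous (hψ i) _)).symm
  have hdsum : Summable fun i => (1 / 2 : ℝ) ^ i * (I i α - I i β) ^ 2 := by
    refine Summable.of_nonneg_of_le (fun i => by positivity) (fun i => ?_)
      (((hsum α).add (hsum β)).mul_left 2)
    nlinarith [mul_nonneg (pow_nonneg (by norm_num : (0 : ℝ) ≤ 1 / 2) i)
      (sq_nonneg (I i α + I i β))]
  have hFη : F η = t * F α + (1 - t) * F β
      - t * (1 - t) * ∑' i, (1 / 2 : ℝ) ^ i * (I i α - I i β) ^ 2 := by
    simp only [F]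
    rw [← tsum_mul_left, ← tsum_mul_left, ← tsum_mul_left,
      ← ((hsum α).mul_left t).tsum_add ((hsum β).mul_left (1 - t)),
      ← (((hsum α).mul_left t).add ((hsum β).mul_left (1 - t))).tsum_sub
        (hdsum.mul_left (t * (1 - t)))]
    refine tsum_congr fun i => ?_
    rw [hconv i]; ring
  have hD : ∑' i, (1 / 2 : ℝ) ^ i * (I i α - I i β) ^ 2 ≤ 0 := by
    have hFα : F α ≤ F η := hmax hαK
    have hFβ : F β ≤ F η := hmax hβK
    have h1 : 0 < t * (1 - t) := mul_pos ht0 (by linarith)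
    by_contra hpos
    push Not at hpos
    nlinarith [mul_pos h1 hpos, mul_le_mul_of_nonneg_left hFα ht0.le,
      mul_le_mul_of_nonneg_left hFβ (by linarith : (0 : ℝ) ≤ 1 - t)]
  have hII : ∀ i, I i α = I i β := by
    intro i
    have h1 : (1 / 2 : ℝ) ^ i * (I i α - I i β) ^ 2 ≤ 0 :=
      (hdsum.le_tsum i fun j _ => by positivity).trans hD
    have h2 : (I i α - I i β) ^ 2 ≤ 0 := by
      by_contra h; push Not at h
      exact absurd h1 (not_le.2 (mul_pos (by positivity) h))
    exact sub_eq_zero.1 (pow_eq_zero_iff two_ne_zero |>.1 (le_antisymm h2 (sq_nonneg _)))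
  have hαβ : (α : Measure X) = (β : Measure X) := by
    refine measure_eq_of_integral_continuous_eq fun φ hφ => ?_
    have hL : ∀ η : ProbabilityMeasure X,
        Continuous fun φ : C(X, ℝ) => ∫ x, φ x ∂(η : Measure X) := by
      intro η
      refine (LipschitzWith.of_dist_le_mul (K := 1) fun φ φ' => ?_).continuous
      rw [Real.dist_eq, ← integral_sub (integrable_of_continuous φ.continuous _)
        (integrable_of_continuous φ'.continuous _)]
      simpa using norm_integral_le_of_norm_le_const (μ := (η : Measure X))
        (C := dist φ φ') (f := fun x => φ x - φ' x) (Eventually.of_forall fun x => by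
          rw [← dist_eq_norm]; exact ContinuousMap.dist_apply_le_dist x)
    have hd : ∀ φ : C(X, ℝ), ∫ x, φ x ∂(α : Measure X) = ∫ x, φ x ∂(β : Measure X) := by
      refine fun φ => congrFun ((hL α).ext_on (TopologicalSpace.denseRange_denseSeq C(X, ℝ)) (hL β)
        ?_) φ
      rintro _ ⟨i, rfl⟩
      have h0 : (1 + ‖d i‖) ≠ 0 := by positivity
      have := hII i
      simp only [I, ψ, integral_div] at this
      exact (div_left_inj' h0).1 this
    exact hd ⟨φ, hφ⟩
  have h1 : (α : Measure X) A = 1 := by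
    rw [hα]; exact ProbabilityTheory.cond_apply_self hA0 (measure_ne_top _ _)
  have h2 : (β : Measure X) A = 0 := by
    rw [hβ, ProbabilityTheory.cond_apply hA.compl]; simp
  rw [hαβ, h2] at h1
  exact zero_ne_one h1

end StationaryMeasures

/-! ### Ergodic stationary measures with prescribed integral or projection -/

section Factors

variable {G X Y : Type*} [MeasurableSpace G] [MeasurableSpace X] [MeasurableSpace Y]
  {act : G → X → X} {actY : G → Y → Y} {pr : X → Y} {μ : Measure G} [IsProbabilityMeasure μ]

lemma walkStep_map (hact : Measurable (Function.uncurry act))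
    (hactY : Measurable (Function.uncurry actY)) (hpr : Measurable pr)
    (hequiv : ∀ g x, pr (act g x) = actY g (pr x)) (η : Measure X) [IsProbabilityMeasure η] :
    walkStep actY μ (η.map pr) = (walkStep act μ η).map pr := by
  have h1 : μ.prod (η.map pr) = (μ.prod η).map (Prod.map id pr) := by
    rw [← Measure.map_prod_map _ _ measurable_id hpr, Measure.map_id]
  rw [walkStep, walkStep, h1, Measure.map_map hactY (measurable_id.prodMap hpr),
    Measure.map_map hpr hact]
  congr 1
  funext p
  exact (hequiv p.1 p.2).symm

lemma WalkStationary.map (hact : Measurable (Function.uncurry act))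
    (hactY : Measurable (Function.uncurry actY)) (hpr : Measurable pr)
    (hequiv : ∀ g x, pr (act g x) = actY g (pr x)) {η : Measure X} [IsProbabilityMeasure η]
    (h : WalkStationary act μ η) : WalkStationary actY μ (η.map pr) := by
  change walkStep actY μ (η.map pr) = _
  rw [walkStep_map hact hactY hpr hequiv]
  exact congrArg _ h

lemma WalkErgodic.map (hpr : Measurable pr) (hequiv : ∀ g x, pr (act g x) = actY g (pr x))
    {η : Measure X} (h : WalkErgodic act μ η) : WalkErgodic actY μ (η.map pr) := by
  intro A hA hinv
  rw [Measure.map_apply hpr hA]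
  refine h _ (hpr hA) ?_
  filter_upwards [hinv] with g hg
  filter_upwards [ae_of_ae_map hpr.aemeasurable hg] with x hx
  have hx' : actY g (pr x) ∈ A ↔ pr x ∈ A := iff_of_eq hx
  exact propext (show pr (act g x) ∈ A ↔ pr x ∈ A by rw [hequiv, hx'])

variable [TopologicalSpace X] [CompactSpace X] [T2Space X] [SecondCountableTopology X]
  [BorelSpace X]

/-- If for every `N` the random walk has a starting distribution for which the averages of `Φ` over
the first `N + 1` steps have sum at most `1`, then there is an ergodic stationary measure with
`∫ Φ ≤ 0`. -/
theorem exists_walkErgodic_integral_nonpos (hact : Measurable (Function.uncurry act))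
    (hc : ∀ g, Continuous (act g)) {Φ : X → ℝ} (hΦ : Continuous Φ) (ρ : ℕ → Measure X)
    [∀ N, IsProbabilityMeasure (ρ N)]
    (hρ : ∀ N, ∑ k ∈ Finset.range (N + 1), ∫ x, Φ x ∂((walkStep act μ)^[k] (ρ N)) ≤ 1) :
    ∃ η : Measure X, IsProbabilityMeasure η ∧ WalkStationary act μ η ∧ WalkErgodic act μ η ∧
      ∫ x, Φ x ∂η ≤ 0 := by
  obtain ⟨η₀, hη₀, U, hU, hlim⟩ := exists_stationary_limit (μ := μ) hact hc ρ
  have hη₀Φ : ∫ x, Φ x ∂(η₀ : Measure X) ≤ 0 := by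
    refine le_of_tendsto_of_tendsto (hlim Φ hΦ)
      ((tendsto_one_div_add_atTop_nhds_zero_nat (𝕜 := ℝ)).mono_left hU)
      (Eventually.of_forall fun N => ?_)
    exact div_le_div_of_nonneg_right (hρ N) (by positivity)
  -- among the stationary measures that minimize `∫ Φ`, there is an ergodic one
  let I : ProbabilityMeasure X → ℝ := fun η => ∫ x, Φ x ∂(η : Measure X)
  have hI : Continuous I := continuous_integral_probabilityMeasure hΦ
  obtain ⟨η₁, hη₁, hmin⟩ := (isClosed_walkStationary (μ := μ) hact hc).isCompact.exists_isMinOn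
    ⟨η₀, hη₀⟩ hI.continuousOn
  let K : Set (ProbabilityMeasure X) := {η | WalkStationary act μ (η : Measure X) ∧ I η = I η₁}
  have hK : IsClosed K := (isClosed_walkStationary hact hc).inter (isClosed_eq hI continuous_const)
  obtain ⟨η, hηK, herg⟩ := exists_walkErgodic_of_isClosed (act := act) (μ := μ) K hK ⟨η₁, hη₁, rfl⟩
    (by
    intro η hη A hA hinv hA0 hA1
    have hinvc : ∀ᵐ g ∂μ, act g ⁻¹' Aᶜ =ᵐ[(η : Measure X)] (Aᶜ : Set X) := by
      filter_upwards [hinv] with g hg using hg.compl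
    have hAc0 : (η : Measure X) Aᶜ ≠ 0 := fun h => hA1 ((prob_compl_eq_zero_iff hA).1 h)
    let α : ProbabilityMeasure X := ⟨_, ProbabilityTheory.cond_isProbabilityMeasure hA0⟩
    let β : ProbabilityMeasure X := ⟨_, ProbabilityTheory.cond_isProbabilityMeasure hAc0⟩
    have hα : I η₁ ≤ I α := hmin (WalkStationary.cond hact hη.1 hA hinv)
    have hβ : I η₁ ≤ I β := hmin (WalkStationary.cond hact hη.1 hA.compl hinvc)
    refine ⟨α, ⟨WalkStationary.cond hact hη.1 hA hinv, le_antisymm ?_ hα⟩, rfl⟩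
    have hsplit : (η : Measure X).real A * I α + (η : Measure X).real Aᶜ * I β = I η := by
      simp only [I, α, β, ProbabilityMeasure.coe_mk]
      rw [measureReal_mul_integral_cond _ hA0, measureReal_mul_integral_cond _ hAc0]
      exact integral_add_compl hA (integrable_of_continuous hΦ _)
    have htc : (η : Measure X).real Aᶜ = 1 - (η : Measure X).real A := by
      rw [measureReal_compl hA]; simp
    have ht0 : 0 < (η : Measure X).real A := ENNReal.toReal_pos hA0 (measure_ne_top _ _)
    have ht1 : 0 < (η : Measure X).real Aᶜ := ENNReal.toReal_pos hAc0 (measure_ne_top _ _)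
    rw [hη.2] at hsplit
    by_contra hlt
    push Not at hlt
    have h5 := mul_lt_mul_of_pos_left hlt ht0
    have h6 := mul_le_mul_of_nonneg_left hβ ht1.le
    rw [htc] at h6 hsplit
    linarith)
  refine ⟨η, inferInstance, hηK.1, herg, ?_⟩
  have h1 : I η₁ ≤ I η₀ := hmin hη₀
  exact (hηK.2.trans_le h1).trans hη₀Φ

variable [TopologicalSpace Y] [CompactSpace Y] [T2Space Y] [SecondCountableTopology Y]
  [BorelSpace Y]

/-- An ergodic stationary measure of a factor lifts to an ergodic stationary measure. -/
theorem exists_walkErgodic_lift (hact : Measurable (Function.uncurry act))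
    (hc : ∀ g, Continuous (act g)) (hactY : Measurable (Function.uncurry actY))
    (hpr : Continuous pr) (hequiv : ∀ g x, pr (act g x) = actY g (pr x)) {ν : Measure Y}
    [IsProbabilityMeasure ν] (hν : WalkStationary actY μ ν) (he : WalkErgodic actY μ ν)
    (ρ : Measure X) [IsProbabilityMeasure ρ] (hρ : ρ.map pr = ν) :
    ∃ η : Measure X, IsProbabilityMeasure η ∧ WalkStationary act μ η ∧ WalkErgodic act μ η ∧
      η.map pr = ν := by
  have hmap_iff : ∀ η : ProbabilityMeasure X, (η : Measure X).map pr = ν ↔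
      ∀ φ : Y → ℝ, Continuous φ → ∫ x, φ (pr x) ∂(η : Measure X) = ∫ y, φ y ∂ν := by
    intro η
    have : IsProbabilityMeasure ((η : Measure X).map pr) :=
      Measure.isProbabilityMeasure_map hpr.measurable.aemeasurable
    constructor
    · intro h φ hφ
      rw [← h, integral_map hpr.measurable.aemeasurable hφ.measurable.aestronglyMeasurable]
    · intro h
      refine measure_eq_of_integral_continuous_eq fun φ hφ => ?_
      rw [integral_map hpr.measurable.aemeasurable hφ.measurable.aestronglyMeasurable, h φ hφ]
  have hiter : ∀ k, ((walkStep act μ)^[k] ρ).map pr = ν := by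
    intro k
    have := isProbabilityMeasure_walkStep_iterate (μ := μ) hact ρ
    induction k with
    | zero => exact hρ
    | succ k ih =>
      rw [Function.iterate_succ_apply', ← walkStep_map hact hactY hpr.measurable hequiv, ih]
      exact hν
  -- all laws of the walk started from `ρ` project to `ν`, and so does their limit
  obtain ⟨η₀, hη₀, U, hU, hlim⟩ := exists_stationary_limit (μ := μ) hact hc (fun _ => ρ)
  have hη₀ν : (η₀ : Measure X).map pr = ν := by
    refine (hmap_iff η₀).2 fun φ hφ => ?_
    refine tendsto_nhds_unique (hlim _ (hφ.comp hpr)) (tendsto_const_nhds.congr fun N => ?_)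
    have : ∀ k, ∫ x, (φ ∘ pr) x ∂((walkStep act μ)^[k] ρ) = ∫ y, φ y ∂ν := fun k => by
      conv_rhs => rw [← hiter k, integral_map hpr.measurable.aemeasurable
        hφ.measurable.aestronglyMeasurable]
      rfl
    change _ = (∑ k ∈ Finset.range (N + 1), ∫ x, (φ ∘ pr) x ∂((walkStep act μ)^[k] ρ)) / _
    rw [Finset.sum_congr rfl fun k _ => this k, Finset.sum_const, Finset.card_range, nsmul_eq_mul]
    push_cast
    field_simp
  let K : Set (ProbabilityMeasure X) :=
    {η | WalkStationary act μ (η : Measure X) ∧ (η : Measure X).map pr = ν}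
  have hK : IsClosed K := by
    refine (isClosed_walkStationary hact hc).inter ?_
    have : {η : ProbabilityMeasure X | (η : Measure X).map pr = ν}
        = ⋂ φ : {φ : Y → ℝ // Continuous φ}, {η : ProbabilityMeasure X |
          ∫ x, φ.1 (pr x) ∂(η : Measure X) = ∫ y, φ.1 y ∂ν} := by
      ext η; simp [hmap_iff]
    change IsClosed {η : ProbabilityMeasure X | (η : Measure X).map pr = ν}
    rw [this]
    exact isClosed_iInter fun φ => isClosed_eq
      (continuous_integral_probabilityMeasure (φ.2.comp hpr)) continuous_const
  obtain ⟨η, hηK, herg⟩ := exists_walkErgodic_of_isClosed (act := act) (μ := μ) K hK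
    ⟨η₀, hη₀, hη₀ν⟩ (by
    intro η hη A hA hinv hA0 hA1
    have hprob := ProbabilityTheory.cond_isProbabilityMeasure (μ := (η : Measure X)) hA0
    -- the conditioned measure projects to a stationary measure absolutely continuous to `ν`
    have hst := WalkStationary.cond hact hη.1 hA hinv
    refine ⟨⟨_, hprob⟩, ⟨hst, ?_⟩, rfl⟩
    have hpr' : IsProbabilityMeasure ((ProbabilityTheory.cond (η : Measure X) A).map pr) :=
      Measure.isProbabilityMeasure_map hpr.measurable.aemeasurable
    change (ProbabilityTheory.cond (η : Measure X) A).map pr = ν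
    refine he.eq_of_absolutelyContinuous hactY hν
      (hst.map hact hactY hpr.measurable hequiv) ?_
    have hac := (ProbabilityTheory.cond_absolutelyContinuous (μ := (η : Measure X)) (s := A)).map
      hpr.measurable
    rwa [hη.2] at hac)
  exact ⟨η, inferInstance, hηK.1, herg, hηK.2⟩

/-- If almost every point of an extension enjoys a property for almost every path, then almost
every point of the factor has a preimage that does, jointly measurably in the path: disintegrate
the measure over the factor. -/
lemma ae_exists_of_ae_map {Ω : Type*} [MeasurableSpace Ω] {P : Measure Ω} [IsProbabilityMeasure P]
    (hpr : Continuous pr) {η : Measure X} [IsProbabilityMeasure η]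
    {Q : Ω × X → Prop} (hQ : ∀ᵐ p ∂(P.prod η), Q p) :
    ∀ᵐ p ∂(P.prod (η.map pr)), ∃ x, pr x = p.2 ∧ Q (p.1, x) := by
  obtain ⟨x₀⟩ := nonempty_of_isProbabilityMeasure η
  have hne : Nonempty X := ⟨x₀⟩
  obtain ⟨N, hNsub, hNm, hN0⟩ := exists_measurable_superset_of_null hQ
  have hprm := hpr.measurable
  let ρ : Measure (Y × X) := η.map fun x => (pr x, x)
  have hpm : Measurable fun x : X => (pr x, x) := hprm.prodMk measurable_id
  have hρ : IsProbabilityMeasure ρ := Measure.isProbabilityMeasure_map hpm.aemeasurable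
  have hfst : ρ.fst = η.map pr := by
    rw [Measure.fst, Measure.map_map measurable_fst hpm]; rfl
  have hpol : PolishSpace X := by
    let _ := TopologicalSpace.metrizableSpaceMetric X
    infer_instance
  let κ := ρ.condKernel
  have hdis : (η.map pr).compProd κ = ρ := by rw [← hfst]; exact ρ.disintegrate κ
  have hprpr : IsProbabilityMeasure (η.map pr) :=
    Measure.isProbabilityMeasure_map hprm.aemeasurable
  let B : Set (Ω × (Y × X)) := {q | pr q.2.2 ≠ q.2.1 ∨ (q.1, q.2.2) ∈ N}
  have hB : MeasurableSet B := by
    have h1 : MeasurableSet {q : Ω × (Y × X) | pr q.2.2 = q.2.1} :=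
      measurableSet_eq_fun (hprm.comp (measurable_snd.comp measurable_snd))
        (measurable_fst.comp measurable_snd)
    have h2 : MeasurableSet {q : Ω × (Y × X) | (q.1, q.2.2) ∈ N} :=
      (measurable_fst.prodMk (measurable_snd.comp measurable_snd)) hNm
    exact h1.compl.union h2
  have hB0 : (P.prod ρ) B = 0 := by
    have h1 : P.prod ρ = (P.prod η).map (Prod.map id fun x => (pr x, x)) := by
      rw [← Measure.map_prod_map _ _ measurable_id hpm, Measure.map_id]
    rw [h1, Measure.map_apply (measurable_id.prodMap hpm) hB]
    convert hN0
    ext ⟨w, x⟩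
    simp [B]
  -- the fibre measures of the exceptional set vanish
  let S : Ω × Y → ℝ≥0∞ := fun p => κ p.2 {x | (p.1, (p.2, x)) ∈ B}
  have hS : Measurable S := by
    let κ' : ProbabilityTheory.Kernel (Ω × Y) X := κ.comap Prod.snd measurable_snd
    have hB' : MeasurableSet {q : (Ω × Y) × X | (q.1.1, (q.1.2, q.2)) ∈ B} :=
      ((measurable_fst.comp measurable_fst).prodMk
        ((measurable_snd.comp measurable_fst).prodMk measurable_snd)) hB
    exact ProbabilityTheory.Kernel.measurable_kernel_prodMk_left (κ := κ') hB'
  have hint : ∫⁻ p, S p ∂(P.prod (η.map pr)) = 0 := by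
    rw [lintegral_prod _ hS.aemeasurable]
    rw [Measure.prod_apply hB] at hB0
    rw [← hB0]
    refine lintegral_congr fun w => ?_
    rw [← hdis, Measure.compProd_apply (measurable_prodMk_left hB)]
    rfl
  filter_upwards [(lintegral_eq_zero_iff hS).1 hint] with p hp
  by_contra hcon
  push Not at hcon
  have huniv : {x | (p.1, (p.2, x)) ∈ B} = univ := by
    refine eq_univ_of_forall fun x => ?_
    by_cases hx : pr x = p.2
    · exact Or.inr (hNsub (hcon x hx))
    · exact Or.inl hx
  have hp' : κ p.2 {x | (p.1, (p.2, x)) ∈ B} = 0 := hp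
  rw [huniv, measure_univ] at hp'
  exact one_ne_zero hp'

end Factors

/-! ### Continuity and measurability of the action of diffeomorphisms -/

lemma secondCountableTopology_tangentBundle {E H : Type*} [NormedAddCommGroup E] [NormedSpace ℝ E]
    [TopologicalSpace H] (I : ModelWithCorners ℝ E H) (N : Type*) [TopologicalSpace N]
    [ChartedSpace H N] [IsManifold I 1 N] [SecondCountableTopology E] [SecondCountableTopology H]
    [SecondCountableTopology N] : SecondCountableTopology (TangentBundle I N) := by
  obtain ⟨s, hs, hsu⟩ := countable_cover_nhds (X := N) (U := fun x => (chartAt H x).source)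
    fun x => (chartAt H x).open_source.mem_nhds (mem_chart_source _ x)
  have : SecondCountableTopology (ModelProd H E) :=
    inferInstanceAs (SecondCountableTopology (H × E))
  refine ChartedSpace.secondCountable_of_countable_cover (ModelProd H E)
    (s := (fun x => (⟨x, 0⟩ : TangentBundle I N)) '' s) ?_ (hs.image _)
  refine eq_univ_of_forall fun p => ?_
  have : p.1 ∈ ⋃ x ∈ s, (chartAt H x).source := hsu ▸ mem_univ _
  simp only [mem_iUnion] at this ⊢
  obtain ⟨x, hx, hp⟩ := this
  refine ⟨_, mem_image_of_mem _ hx, ?_⟩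
  rw [TangentBundle.mem_chart_source_iff]
  exact hp

section Diffeo

lemma secondCountableTopology_of_compact {M : Type*} [TopologicalSpace M] [ChartedSpace Plane M]
    [CompactSpace M] : SecondCountableTopology M :=
  ChartedSpace.secondCountable_of_sigmaCompact Plane M

lemma mdifferentiable_diff2 {M : Type*} [TopologicalSpace M] [ChartedSpace Plane M] (f : Diff2 M) :
    MDifferentiable (𝓡 2) (𝓡 2) f :=
  f.contMDiff.mdifferentiable (by norm_num)

variable {M : Type*} [TopologicalSpace M] [ChartedSpace Plane M] [IsManifold (𝓡 2) ∞ M]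

lemma locallyCompactSpace_TT : LocallyCompactSpace (TT M) :=
  Manifold.locallyCompact_of_finiteDimensional (M := TT M) ((𝓡 2).tangent).tangent

lemma secondCountableTopology_TT [CompactSpace M] : SecondCountableTopology (TT M) := by
  have := secondCountableTopology_of_compact (M := M)
  have := secondCountableTopology_tangentBundle (𝓡 2) M
  have : SecondCountableTopology (ModelProd Plane Plane) :=
    inferInstanceAs (SecondCountableTopology (Plane × Plane))
  exact secondCountableTopology_tangentBundle (𝓡 2).tangent (TangentBundle (𝓡 2) M)

instance secondCountableTopology_diff2 [CompactSpace M] : SecondCountableTopology (Diff2 M) := by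
  have := secondCountableTopology_TT (M := M)
  have := locallyCompactSpace_TT (M := M)
  exact TopologicalSpace.secondCountableTopology_induced _ _ tangentTwo

lemma mdifferentiable_tangentMap_diff2 (f : Diff2 M) :
    MDifferentiable (𝓡 2).tangent (𝓡 2).tangent (tangentMap (𝓡 2) (𝓡 2) f) := by
  have h1 : ContMDiff (𝓡 2).tangent (𝓡 2).tangent 1 (tangentMap (𝓡 2) (𝓡 2) f) :=
    f.contMDiff.contMDiff_tangentMap (by norm_num)
  exact h1.mdifferentiable (by norm_num)

lemma tangentMap_trans (f g : Diff2 M) :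
    tangentMap (𝓡 2) (𝓡 2) (f.trans g) = tangentMap (𝓡 2) (𝓡 2) g ∘ tangentMap (𝓡 2) (𝓡 2) f :=
  tangentMap_comp (mdifferentiable_diff2 g) (mdifferentiable_diff2 f)

lemma tangentTwo_trans (f g : Diff2 M) :
    tangentTwo (f.trans g) = (tangentTwo g).comp (tangentTwo f) := by
  ext1 p
  change tangentMap _ _ (tangentMap (𝓡 2) (𝓡 2) (f.trans g)) p = _
  rw [tangentMap_trans, tangentMap_comp (mdifferentiable_tangentMap_diff2 g)
    (mdifferentiable_tangentMap_diff2 f)]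
  rfl

lemma continuous_tangentTwo : Continuous (tangentTwo : Diff2 M → C(TT M, TT M)) :=
  continuous_induced_dom

/-- Composition is continuous in the `C²` topology: composition of continuous maps is continuous in
the compact-open topology of the locally compact space `TTM`. -/
lemma continuous_diff2_comp : Continuous fun p : Diff2 M × Diff2 M => p.2.trans p.1 := by
  have := locallyCompactSpace_TT (M := M)
  refine continuous_induced_rng.2 ?_
  have : (tangentTwo ∘ fun p : Diff2 M × Diff2 M => p.2.trans p.1)
      = fun p => (tangentTwo p.1).comp (tangentTwo p.2) := by
    funext p; exact tangentTwo_trans _ _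
  rw [this]
  exact (continuous_tangentTwo.comp continuous_fst).compCM
    (continuous_tangentTwo.comp continuous_snd)

/-- The tangent maps depend jointly continuously on the diffeomorphism and the vector: they are
the restrictions of the second tangent maps to the zero section of `TTM → TM`. -/
lemma continuous_tangentMap_diff2 :
    Continuous fun p : Diff2 M × TangentBundle (𝓡 2) M => tangentMap (𝓡 2) (𝓡 2) p.1 p.2 := by
  have := locallyCompactSpace_TT (M := M)
  have h0 : Continuous (zeroSection (Plane × Plane)
      (TangentSpace (𝓡 2).tangent : TangentBundle (𝓡 2) M → Type _)) :=
    (Bundle.contMDiff_zeroSection ℝ (IB := (𝓡 2).tangent) (n := 0) _).continuous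
  have h1 : Continuous fun p : Diff2 M × TangentBundle (𝓡 2) M => tangentTwo p.1
      (zeroSection (Plane × Plane) (TangentSpace (𝓡 2).tangent) p.2) :=
    (continuous_tangentTwo.comp continuous_fst).eval (h0.comp continuous_snd)
  exact (FiberBundle.continuous_proj (Plane × Plane)
    (TangentSpace (𝓡 2).tangent : TangentBundle (𝓡 2) M → Type _)).comp h1

lemma continuous_diff2_apply : Continuous fun p : Diff2 M × M => p.1 p.2 := by
  have h0 : Continuous (zeroSection Plane (TangentSpace (𝓡 2) : M → Type _)) :=
    (Bundle.contMDiff_zeroSection ℝ (IB := 𝓡 2) (n := 0) _).continuous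
  exact (FiberBundle.continuous_proj Plane (TangentSpace (𝓡 2) : M → Type _)).comp
    (continuous_tangentMap_diff2.comp (continuous_fst.prodMk (h0.comp continuous_snd)))

end Diffeo

section SphereBundle

variable {M : Type*} [TopologicalSpace M] [ChartedSpace Plane M] [IsManifold (𝓡 2) ∞ M]

lemma continuous_smul_tangentBundle {X : Type*} [TopologicalSpace X]
    {p : X → TangentBundle (𝓡 2) M} {c : X → ℝ} (hp : Continuous p) (hc : Continuous c) :
    Continuous fun x => (⟨(p x).1, c x • (p x).2⟩ : TangentBundle (𝓡 2) M) := by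
  rw [continuous_iff_continuousAt] at hp ⊢
  intro x
  have h := (FiberBundle.continuousAt_totalSpace Plane (fun x => p x)).1 (hp x)
  refine (FiberBundle.continuousAt_totalSpace Plane _).2 ⟨h.1, ?_⟩
  refine (hc.continuousAt.smul h.2).congr ?_
  have hx : ∀ᶠ y in 𝓝 x, (p y).1 ∈
      (trivializationAt Plane (TangentSpace (𝓡 2) : M → Type _) (p x).1).baseSet :=
    h.1 ((trivializationAt Plane (TangentSpace (𝓡 2) : M → Type _) (p x).1).open_baseSet.mem_nhds
      (FiberBundle.mem_baseSet_trivializationAt' _))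
  filter_upwards [hx] with y hy
  exact (((trivializationAt Plane (TangentSpace (𝓡 2) : M → Type _) (p x).1).linear ℝ hy).map_smul
    (c y) (p y).2).symm

lemma t2Space_tangentBundle [T2Space M] : T2Space (TangentBundle (𝓡 2) M) := by
  have hc : Continuous (TotalSpace.proj : TangentBundle (𝓡 2) M → M) :=
    FiberBundle.continuous_proj Plane (TangentSpace (𝓡 2) : M → Type _)
  refine ⟨fun p q hpq => ?_⟩
  by_cases h : p.1 = q.1
  · let e := trivializationAt Plane (TangentSpace (𝓡 2) : M → Type _) p.1
    have hp : p ∈ e.source := e.mem_source.2 (FiberBundle.mem_baseSet_trivializationAt' _)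
    have hq : q ∈ e.source := e.mem_source.2 (h ▸ FiberBundle.mem_baseSet_trivializationAt' _)
    obtain ⟨u, v, hu, hv, hpu, hqv, huv⟩ := t2_separation (e.injOn.ne hp hq hpq)
    refine ⟨e.source ∩ e ⁻¹' u, e.source ∩ e ⁻¹' v,
      e.continuousOn_toFun.isOpen_inter_preimage e.open_source hu,
      e.continuousOn_toFun.isOpen_inter_preimage e.open_source hv, ⟨hp, hpu⟩, ⟨hq, hqv⟩, ?_⟩
    exact (huv.preimage e).mono inter_subset_right inter_subset_right
  · obtain ⟨u, v, hu, hv, hpu, hqv, huv⟩ := t2_separation h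
    exact ⟨_, _, hu.preimage hc, hv.preimage hc, hpu, hqv, huv.preimage _⟩

variable [RiemannianBundle (fun x : M => TangentSpace (𝓡 2) x)]

variable (M) in
/-- The unit sphere bundle of a Riemannian surface. -/
def SphereBundle : Type _ := {p : TangentBundle (𝓡 2) M // ‖p.2‖ = 1}

noncomputable instance : TopologicalSpace (SphereBundle M) := instTopologicalSpaceSubtype

noncomputable instance : MeasurableSpace (SphereBundle M) := borel _

instance : BorelSpace (SphereBundle M) := ⟨rfl⟩

/-- The base point of a unit vector. -/
def SphereBundle.base (s : SphereBundle M) : M := s.1.1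

lemma continuous_sphereBundle_val : Continuous (Subtype.val : SphereBundle M → TangentBundle (𝓡 2) M) :=
  continuous_subtype_val

lemma SphereBundle.continuous_base : Continuous (SphereBundle.base : SphereBundle M → M) :=
  (FiberBundle.continuous_proj Plane (TangentSpace (𝓡 2) : M → Type _)).comp
    continuous_sphereBundle_val

lemma SphereBundle.vec_ne_zero (s : SphereBundle M) : s.1.2 ≠ 0 := by
  intro h
  have := s.2
  rw [h, norm_zero] at this
  exact zero_ne_one this

instance [T2Space M] : T2Space (SphereBundle M) := by
  have := t2Space_tangentBundle (M := M)
  exact inferInstanceAs (T2Space {p : TangentBundle (𝓡 2) M // ‖p.2‖ = 1})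

instance [CompactSpace M] : SecondCountableTopology (SphereBundle M) := by
  have := secondCountableTopology_of_compact (M := M)
  have := secondCountableTopology_tangentBundle (𝓡 2) M
  exact TopologicalSpace.Subtype.secondCountableTopology {p : TangentBundle (𝓡 2) M | ‖p.2‖ = 1}

lemma mfderiv_diff2_injective (f : Diff2 M) (x : M) :
    Function.Injective (mfderiv (𝓡 2) (𝓡 2) f x) :=
  (f.mfderivToContinuousLinearEquiv (by norm_num) x).injective

lemma mfderiv_diff2_ne_zero (f : Diff2 M) (x : M) {v : TangentSpace (𝓡 2) x} (hv : v ≠ 0) :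
    mfderiv (𝓡 2) (𝓡 2) f x v ≠ 0 := fun h =>
  hv (mfderiv_diff2_injective f x (h.trans (map_zero _).symm))

/-- The unit vector in the direction of a nonzero tangent vector. -/
noncomputable def unitVec (x : M) (v : TangentSpace (𝓡 2) x) (hv : v ≠ 0) : SphereBundle M :=
  ⟨⟨x, ‖v‖⁻¹ • v⟩, by
    change ‖‖v‖⁻¹ • v‖ = 1
    rw [norm_smul, norm_inv, norm_norm, inv_mul_cancel₀ (norm_ne_zero_iff.2 hv)]⟩

/-- The action of diffeomorphisms on unit tangent vectors, `(x, v) ↦ (f x, D f v / ‖D f v‖)`. -/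
noncomputable def sphereAct (f : Diff2 M) (s : SphereBundle M) : SphereBundle M :=
  unitVec (f s.1.1) (mfderiv (𝓡 2) (𝓡 2) f s.1.1 s.1.2) (mfderiv_diff2_ne_zero f _ s.vec_ne_zero)

/-- The logarithmic stretch `log ‖D f v‖` of a unit vector. -/
noncomputable def stretch (p : Diff2 M × SphereBundle M) : ℝ :=
  Real.log ‖mfderiv (𝓡 2) (𝓡 2) p.1 p.2.1.1 p.2.1.2‖

lemma base_sphereAct (f : Diff2 M) (s : SphereBundle M) : (sphereAct f s).base = f s.base := rfl

variable [IsContMDiffRiemannianBundle (𝓡 2) ∞ Plane (fun x : M => TangentSpace (𝓡 2) x)]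

lemma isContinuousRiemannianBundle_tangent :
    IsContinuousRiemannianBundle Plane (fun x : M => TangentSpace (𝓡 2) x) := by
  obtain ⟨g, hg, h⟩ := IsContMDiffRiemannianBundle.exists_contMDiff (IB := 𝓡 2) (n := ∞)
    (F := Plane) (E := fun x : M => TangentSpace (𝓡 2) x)
  exact ⟨g, hg.continuous, h⟩

/-- The Riemannian norm is a continuous function on the tangent bundle. -/
lemma continuous_norm_tangentBundle :
    Continuous fun p : TangentBundle (𝓡 2) M => ‖p.2‖ := by
  have := isContinuousRiemannianBundle_tangent (M := M)
  have h : Continuous fun p : TangentBundle (𝓡 2) M => inner ℝ p.2 p.2 :=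
    Continuous.inner_bundle (F := Plane) (E := fun x : M => TangentSpace (𝓡 2) x)
      (b := fun p : TangentBundle (𝓡 2) M => p.1) continuous_id continuous_id
  have h2 : (fun p : TangentBundle (𝓡 2) M => ‖p.2‖) = fun p => Real.sqrt (inner ℝ p.2 p.2) := by
    funext p
    rw [real_inner_self_eq_norm_sq, Real.sqrt_sq (norm_nonneg _)]
  rw [h2]
  exact h.sqrt

/-- The unit sphere bundle of a compact surface is compact: over a compact neighbourhood of each
point, the unit vectors have bounded coordinates. -/
instance [T2Space M] [CompactSpace M] : CompactSpace (SphereBundle M) := by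
  have := isContinuousRiemannianBundle_tangent (M := M)
  have := t2Space_tangentBundle (M := M)
  have : LocallyCompactSpace M := inferInstance
  let S : Set (TangentBundle (𝓡 2) M) := {p | ‖p.2‖ = 1}
  have hS : IsClosed S := isClosed_eq continuous_norm_tangentBundle continuous_const
  have hproj : Continuous (TotalSpace.proj : TangentBundle (𝓡 2) M → M) :=
    FiberBundle.continuous_proj Plane (TangentSpace (𝓡 2) : M → Type _)
  have hloc : ∀ x : M, ∃ K ∈ 𝓝 x, IsCompact (S ∩ TotalSpace.proj ⁻¹' K) := by
    intro x
    let e := trivializationAt Plane (TangentSpace (𝓡 2) : M → Type _) x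
    obtain ⟨C, hC, hCx⟩ := eventually_norm_trivializationAt_lt Plane
      (fun x : M => TangentSpace (𝓡 2) x) x
    have hbase : e.baseSet ∈ 𝓝 x :=
      e.open_baseSet.mem_nhds (FiberBundle.mem_baseSet_trivializationAt' _)
    obtain ⟨K, hK, hKsub, hKc⟩ := LocallyCompactSpace.local_compact_nhds x _ (inter_mem hbase hCx)
    refine ⟨K, hK, ?_⟩
    have hprod : IsCompact (K ×ˢ Metric.closedBall (0 : Plane) C) :=
      hKc.prod (isCompact_closedBall 0 C)
    have himg : IsCompact (e.toOpenPartialHomeomorph.symm '' (K ×ˢ Metric.closedBall (0 : Plane) C)) := by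
      refine hprod.image_of_continuousOn (e.toOpenPartialHomeomorph.continuousOn_symm.mono ?_)
      rintro ⟨y, u⟩ ⟨hy, -⟩
      exact e.mem_target.2 (hKsub hy).1
    refine himg.of_isClosed_subset (hS.inter (hKc.isClosed.preimage hproj)) ?_
    rintro p ⟨hp1, hp2⟩
    have hpb : p.1 ∈ e.baseSet := (hKsub hp2).1
    refine ⟨e p, ⟨?_, ?_⟩, e.left_inv (e.mem_source.2 hpb)⟩
    · rw [e.coe_fst' hpb]; exact hp2
    · rw [mem_closedBall_zero_iff]
      have h1 : e.continuousLinearMapAt ℝ p.1 p.2 = (e p).2 := by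
        rw [Trivialization.continuousLinearMapAt_apply, e.coe_linearMapAt_of_mem hpb]
      rw [← h1]
      refine (ContinuousLinearMap.le_opNorm _ _).trans ?_
      have hp1' : ‖p.2‖ = 1 := hp1
      rw [hp1', mul_one]
      exact (hKsub hp2).2.le
  choose K hK hKS using hloc
  obtain ⟨t, ht⟩ := CompactSpace.elim_nhds_subcover K hK
  have hScomp : IsCompact S := by
    have h1 : S = ⋃ x ∈ t, S ∩ TotalSpace.proj ⁻¹' (K x) := by
      rw [← inter_iUnion₂, ← preimage_iUnion₂, ht]
      simp
    rw [h1]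
    exact t.isCompact_biUnion fun x _ => hKS x
  exact isCompact_iff_compactSpace.1 hScomp

lemma continuous_norm_mfderiv :
    Continuous fun p : Diff2 M × SphereBundle M => ‖mfderiv (𝓡 2) (𝓡 2) p.1 p.2.1.1 p.2.1.2‖ := by
  have h1 : Continuous fun p : Diff2 M × SphereBundle M => tangentMap (𝓡 2) (𝓡 2) p.1 p.2.1 :=
    continuous_tangentMap_diff2.comp
      (continuous_fst.prodMk (continuous_sphereBundle_val.comp continuous_snd))
  exact continuous_norm_tangentBundle.comp h1

lemma continuous_sphereAct :
    Continuous fun p : Diff2 M × SphereBundle M => sphereAct p.1 p.2 := by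
  refine Continuous.subtype_mk ?_ _
  have h1 : Continuous fun p : Diff2 M × SphereBundle M => tangentMap (𝓡 2) (𝓡 2) p.1 p.2.1 :=
    continuous_tangentMap_diff2.comp
      (continuous_fst.prodMk (continuous_sphereBundle_val.comp continuous_snd))
  exact continuous_smul_tangentBundle h1 (continuous_norm_mfderiv.inv₀ fun p =>
    norm_ne_zero_iff.2 (mfderiv_diff2_ne_zero _ _ p.2.vec_ne_zero))

lemma continuous_stretch : Continuous (stretch : Diff2 M × SphereBundle M → ℝ) :=
  continuous_norm_mfderiv.log fun p => norm_ne_zero_iff.2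
    (mfderiv_diff2_ne_zero _ _ p.2.vec_ne_zero)

end SphereBundle

/-! ### The derivative cocycle on the unit sphere bundle -/

section Cocycle

variable {M : Type*} [TopologicalSpace M] [ChartedSpace Plane M] [IsManifold (𝓡 2) ∞ M]
  [RiemannianBundle (fun x : M => TangentSpace (𝓡 2) x)]

lemma mfderiv_trans_apply (f g : Diff2 M) (x : M) (v : TangentSpace (𝓡 2) x) :
    mfderiv (𝓡 2) (𝓡 2) (f.trans g) x v
      = mfderiv (𝓡 2) (𝓡 2) g (f x) (mfderiv (𝓡 2) (𝓡 2) f x v) :=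
  mfderiv_comp_apply x (mdifferentiable_diff2 g _) (mdifferentiable_diff2 f _) v

lemma mfderiv_refl_apply (x : M) (v : TangentSpace (𝓡 2) x) :
    mfderiv (𝓡 2) (𝓡 2) (Diffeomorph.refl (𝓡 2) M 2) x v = v := by
  change mfderiv (𝓡 2) (𝓡 2) id x v = v
  rw [mfderiv_id]; rfl

lemma SphereBundle.norm_vec (s : SphereBundle M) : ‖s.1.2‖ = 1 := s.2

lemma unitVec_congr {x y : M} (h : x = y) {v : TangentSpace (𝓡 2) x} {w : TangentSpace (𝓡 2) y}
    (hv : v ≠ 0) (hw : w ≠ 0) (hvw : HEq v w) : unitVec x v hv = unitVec y w hw := by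
  subst h; obtain rfl := eq_of_heq hvw; rfl

lemma unitVec_smul {x : M} {v : TangentSpace (𝓡 2) x} (hv : v ≠ 0) {c : ℝ} (hc : 0 < c)
    (hcv : c • v ≠ 0) : unitVec x (c • v) hcv = unitVec x v hv := by
  refine Subtype.ext (congrArg (TotalSpace.mk x) ?_)
  rw [norm_smul, Real.norm_of_nonneg hc.le, smul_smul]
  congr 1
  field_simp

lemma unitVec_self (s : SphereBundle M) : unitVec s.1.1 s.1.2 s.vec_ne_zero = s := by
  refine Subtype.ext (congrArg (TotalSpace.mk s.1.1) ?_)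
  rw [s.norm_vec, inv_one, one_smul]

lemma sphereAct_unitVec (f : Diff2 M) (x : M) (v : TangentSpace (𝓡 2) x) (hv : v ≠ 0) :
    sphereAct f (unitVec x v hv)
      = unitVec (f x) (mfderiv (𝓡 2) (𝓡 2) f x v) (mfderiv_diff2_ne_zero f x hv) := by
  have h1 : mfderiv (𝓡 2) (𝓡 2) f x (‖v‖⁻¹ • v) = ‖v‖⁻¹ • mfderiv (𝓡 2) (𝓡 2) f x v :=
    map_smul _ _ _
  have hne : ‖v‖⁻¹ • mfderiv (𝓡 2) (𝓡 2) f x v ≠ 0 :=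
    smul_ne_zero (inv_ne_zero (norm_ne_zero_iff.2 hv)) (mfderiv_diff2_ne_zero f x hv)
  rw [← unitVec_smul (mfderiv_diff2_ne_zero f x hv) (inv_pos.2 (norm_pos_iff.2 hv)) hne]
  exact unitVec_congr rfl _ _ (heq_of_eq h1)

lemma sphereAct_refl (s : SphereBundle M) : sphereAct (Diffeomorph.refl (𝓡 2) M 2) s = s := by
  conv_rhs => rw [← unitVec_self s]
  exact unitVec_congr rfl _ _ (heq_of_eq (mfderiv_refl_apply _ _))

lemma sphereAct_trans (f g : Diff2 M) (s : SphereBundle M) :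
    sphereAct (f.trans g) s = sphereAct g (sphereAct f s) := by
  change _ = sphereAct g (unitVec (f s.1.1) _ _)
  rw [sphereAct_unitVec]
  exact unitVec_congr rfl _ _ (heq_of_eq (mfderiv_trans_apply f g _ _))

lemma stretch_unitVec (f : Diff2 M) (x : M) (v : TangentSpace (𝓡 2) x) (hv : v ≠ 0) :
    stretch (f, unitVec x v hv) = logGrowth f x v := by
  change Real.log ‖mfderiv (𝓡 2) (𝓡 2) f x (‖v‖⁻¹ • v)‖ = _
  rw [map_smul, norm_smul, norm_inv, norm_norm, logGrowth, div_eq_inv_mul]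

lemma stretch_eq_logGrowth (f : Diff2 M) (s : SphereBundle M) :
    stretch (f, s) = logGrowth f s.1.1 s.1.2 := by
  rw [← stretch_unitVec f _ _ s.vec_ne_zero, unitVec_self]

/-- The cocycle identity for the logarithmic stretch. -/
lemma stretch_trans (f g : Diff2 M) (s : SphereBundle M) :
    stretch (f.trans g, s) = stretch (f, s) + stretch (g, sphereAct f s) := by
  have h := norm_ne_zero_iff.2 (mfderiv_diff2_ne_zero f s.1.1 s.vec_ne_zero)
  change _ = _ + stretch (g, unitVec (f s.1.1) _ _)
  rw [stretch_unitVec]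
  have h2 := norm_ne_zero_iff.2 (mfderiv_diff2_ne_zero g (f s.1.1)
    (mfderiv_diff2_ne_zero f s.1.1 s.vec_ne_zero))
  rw [logGrowth, Real.log_div h2 h]
  change Real.log ‖mfderiv (𝓡 2) (𝓡 2) (f.trans g) s.1.1 s.1.2‖
    = Real.log ‖mfderiv (𝓡 2) (𝓡 2) f s.1.1 s.1.2‖ + _
  rw [mfderiv_trans_apply]
  exact (add_sub_cancel _ _).symm

lemma stretch_refl (s : SphereBundle M) : stretch (Diffeomorph.refl (𝓡 2) M 2, s) = 0 := by
  change Real.log ‖mfderiv (𝓡 2) (𝓡 2) (Diffeomorph.refl (𝓡 2) M 2) s.1.1 s.1.2‖ = 0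
  rw [mfderiv_refl_apply]
  exact (congrArg Real.log s.norm_vec).trans Real.log_one

lemma traj_sphereAct (w : ℕ → Diff2 M) (n : ℕ) (s : SphereBundle M) :
    traj sphereAct w n s = sphereAct (word w n) s := by
  induction n with
  | zero => exact (sphereAct_refl s).symm
  | succ n ih =>
    change sphereAct (w n) (traj sphereAct w n s) = sphereAct ((word w n).trans (w n)) s
    rw [ih, sphereAct_trans]

lemma stretch_word (w : ℕ → Diff2 M) (n : ℕ) (s : SphereBundle M) :
    stretch (word w n, s) = ∑ k ∈ Finset.range n, stretch (w k, traj sphereAct w k s) := by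
  induction n with
  | zero => exact stretch_refl s
  | succ n ih =>
    rw [Finset.sum_range_succ, ← ih, traj_sphereAct]
    exact stretch_trans _ _ _

lemma growthRate_eq (w : ℕ → Diff2 M) (s : SphereBundle M) (n : ℕ) :
    growthRate w s.1.1 s.1.2 n
      = (∑ k ∈ Finset.range n, stretch (w k, traj sphereAct w k s)) / n := by
  rw [growthRate, ← stretch_eq_logGrowth, stretch_word, one_div, div_eq_inv_mul]

variable [IsContMDiffRiemannianBundle (𝓡 2) ∞ Plane (fun x : M => TangentSpace (𝓡 2) x)]
  [T2Space M] [CompactSpace M]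

/-- The supremum `sup |log ‖D f v‖|` over the unit vectors `v`. -/
noncomputable def maxStretch (f : Diff2 M) : ℝ :=
  sSup ((fun s : SphereBundle M => |stretch (f, s)|) '' univ)

lemma continuous_maxStretch : Continuous (maxStretch : Diff2 M → ℝ) :=
  isCompact_univ.continuous_sSup (f := fun (f : Diff2 M) (s : SphereBundle M) => |stretch (f, s)|)
    continuous_stretch.abs

lemma abs_stretch_le (f : Diff2 M) (s : SphereBundle M) : |stretch (f, s)| ≤ maxStretch f := by
  refine le_csSup ?_ (mem_image_of_mem _ (mem_univ s))
  exact (isCompact_univ.image (continuous_stretch.comp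
    (continuous_const.prodMk continuous_id)).abs).bddAbove

lemma maxStretch_nonneg (f : Diff2 M) : 0 ≤ maxStretch f :=
  Real.sSup_nonneg (by rintro _ ⟨s, -, rfl⟩; exact abs_nonneg _)

/-- The supremum in `cOneSize` is over a bounded family. -/
lemma norm_mfderiv_le_cOneSize (f : Diff2 M) (x : M) :
    ‖mfderiv (𝓡 2) (𝓡 2) f x‖ ≤ cOneSize f := by
  refine le_ciSup (f := fun x => ‖mfderiv (𝓡 2) (𝓡 2) f x‖) ?_ x
  refine ⟨Real.exp (maxStretch f), ?_⟩
  rintro _ ⟨y, rfl⟩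
  refine ContinuousLinearMap.opNorm_le_of_unit_norm (Real.exp_pos _).le fun v hv => ?_
  have hv0 : v ≠ 0 := by rintro rfl; simp at hv
  have h1 := (le_abs_self _).trans (abs_stretch_le f (⟨⟨y, v⟩, hv⟩ : SphereBundle M))
  rw [← Real.exp_log (norm_pos_iff.2 (mfderiv_diff2_ne_zero f y hv0))]
  exact Real.exp_le_exp.2 h1

lemma stretch_le_posLog (f : Diff2 M) (s : SphereBundle M) :
    stretch (f, s) ≤ Real.posLog (cOneSize f) := by
  have hpos := norm_pos_iff.2 (mfderiv_diff2_ne_zero f s.1.1 s.vec_ne_zero)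
  have h1 : ‖mfderiv (𝓡 2) (𝓡 2) f s.1.1 s.1.2‖ ≤ cOneSize f := by
    have := (mfderiv (𝓡 2) (𝓡 2) f s.1.1).le_opNorm s.1.2
    rw [s.norm_vec, mul_one] at this
    exact this.trans (norm_mfderiv_le_cOneSize f _)
  exact (Real.log_le_log hpos h1).trans (le_max_right _ _)

lemma maxStretch_le (f : Diff2 M) :
    maxStretch f ≤ Real.posLog (cOneSize f) + Real.posLog (cOneSize f.symm) := by
  refine Real.sSup_le ?_ (add_nonneg Real.posLog_nonneg Real.posLog_nonneg)
  rintro _ ⟨s, -, rfl⟩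
  have h1 := stretch_le_posLog f s
  have h2 := stretch_le_posLog f.symm (sphereAct f s)
  have h3 := stretch_trans f f.symm s
  rw [Diffeomorph.self_trans_symm, stretch_refl] at h3
  have h4 : 0 ≤ Real.posLog (cOneSize f) := Real.posLog_nonneg
  have h5 : 0 ≤ Real.posLog (cOneSize f.symm) := Real.posLog_nonneg
  exact abs_le.2 ⟨by linarith, by linarith⟩

lemma integrable_maxStretch {μ : Measure (Diff2 M)} (hμ : HasLogMoment μ) :
    Integrable maxStretch μ := by
  refine ⟨continuous_maxStretch.measurable.aestronglyMeasurable, ?_⟩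
  refine lt_of_le_of_lt (lintegral_mono fun f => ?_) hμ
  rw [Real.enorm_of_nonneg (maxStretch_nonneg f)]
  exact ENNReal.ofReal_le_ofReal (maxStretch_le f)

lemma measurable_sphereAct :
    Measurable (Function.uncurry (sphereAct : Diff2 M → SphereBundle M → SphereBundle M)) :=
  continuous_sphereAct.measurable

lemma measurable_stretch : Measurable (stretch : Diff2 M × SphereBundle M → ℝ) :=
  continuous_stretch.measurable

/-- The mean logarithmic stretch `∫ log ‖D f v‖ dμ(f)` of a unit vector. -/
noncomputable def meanStretch (μ : Measure (Diff2 M)) (s : SphereBundle M) : ℝ :=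
  ∫ f, stretch (f, s) ∂μ

variable {μ : Measure (Diff2 M)}

lemma continuous_meanStretch (hμ : HasLogMoment μ) : Continuous (meanStretch μ) := by
  refine continuous_of_dominated (bound := maxStretch) ?_ ?_ (integrable_maxStretch hμ) ?_
  · exact fun s => (measurable_stretch.comp measurable_prodMk_right).aestronglyMeasurable
  · exact fun s => Eventually.of_forall fun f => abs_stretch_le f s
  · exact Eventually.of_forall fun f => continuous_stretch.comp
      (continuous_const.prodMk continuous_id)

variable [IsProbabilityMeasure μ]

lemma integrable_stretch (hμ : HasLogMoment μ) (η : Measure (SphereBundle M))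
    [IsProbabilityMeasure η] : Integrable stretch (μ.prod η) :=
  Integrable.mono' ((integrable_maxStretch hμ).comp_fst η)
    measurable_stretch.aestronglyMeasurable (Eventually.of_forall fun p => abs_stretch_le p.1 p.2)

lemma integral_stretch (hμ : HasLogMoment μ) (η : Measure (SphereBundle M))
    [IsProbabilityMeasure η] : ∫ p, stretch p ∂(μ.prod η) = ∫ s, meanStretch μ s ∂η :=
  integral_prod_symm _ (integrable_stretch hμ η)

/-- Almost every unit vector for an ergodic stationary measure on the sphere bundle has an exact
growth rate, the mean stretch. -/
lemma tendsto_growthRate (hμ : HasLogMoment μ) {η : Measure (SphereBundle M)}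
    [IsProbabilityMeasure η] (hη : WalkStationary sphereAct μ η)
    (he : WalkErgodic sphereAct μ η) :
    ∀ᵐ p ∂((Measure.infinitePi fun _ : ℕ => μ).prod η),
      Tendsto (growthRate p.1 p.2.1.1 p.2.1.2) atTop (𝓝 (∫ s, meanStretch μ s ∂η)) := by
  rw [← integral_stretch hμ η]
  filter_upwards [he.tendsto_average measurable_sphereAct hη measurable_stretch
    (integrable_stretch hμ η)] with p hp
  exact hp.congr fun n => (growthRate_eq p.1 p.2 n).symm

lemma measurable_diff2_comp : Measurable fun p : Diff2 M × Diff2 M => p.2.trans p.1 :=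
  continuous_diff2_comp.measurable

lemma isProbabilityMeasure_convPow (N : ℕ) : IsProbabilityMeasure (convPow μ N) := by
  induction N with
  | zero => exact Measure.dirac.isProbabilityMeasure
  | succ N ih => exact Measure.isProbabilityMeasure_map measurable_diff2_comp.aemeasurable

/-- The law of the random walk on the sphere bundle after `N` steps is given by the convolution
power. -/
lemma map_convPow (s : SphereBundle M) (N : ℕ) :
    (convPow μ N).map (fun f => sphereAct f s)
      = (walkStep sphereAct μ)^[N] (Measure.dirac s) := by
  have hm : Measurable fun f : Diff2 M => sphereAct f s :=
    measurable_sphereAct.comp measurable_prodMk_right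
  induction N with
  | zero =>
    rw [convPow, Measure.map_dirac' hm, sphereAct_refl]; rfl
  | succ N ih =>
    have := isProbabilityMeasure_convPow (μ := μ) N
    rw [Function.iterate_succ_apply', ← ih, walkStep, convPow,
      Measure.map_map hm measurable_diff2_comp]
    have h1 : μ.prod ((convPow μ N).map fun f => sphereAct f s)
        = (μ.prod (convPow μ N)).map (Prod.map id fun f => sphereAct f s) := by
      rw [← Measure.map_prod_map _ _ measurable_id hm, Measure.map_id]
    rw [h1, Measure.map_map measurable_sphereAct (measurable_id.prodMap hm)]
    congr 1
    funext p
    exact sphereAct_trans _ _ _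

/-- The mean growth of a vector under a convolution power is the sum of the averages of the mean
stretch over the laws of the walk. -/
lemma integrable_stretch_convPow_and_integral_eq (hμ : HasLogMoment μ) (s : SphereBundle M)
    (N : ℕ) : Integrable (fun f => stretch (f, s)) (convPow μ N) ∧
      ∫ f, stretch (f, s) ∂(convPow μ N) = ∑ k ∈ Finset.range N,
        ∫ s', meanStretch μ s' ∂((walkStep sphereAct μ)^[k] (Measure.dirac s)) := by
  have hst : Measurable fun f : Diff2 M => stretch (f, s) :=
    measurable_stretch.comp measurable_prodMk_right
  have hm : Measurable fun f : Diff2 M => sphereAct f s :=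
    measurable_sphereAct.comp measurable_prodMk_right
  induction N with
  | zero =>
    refine ⟨integrable_dirac' hst.stronglyMeasurable (by simp), ?_⟩
    rw [convPow, integral_dirac' _ _ hst.stronglyMeasurable, stretch_refl]
    simp
  | succ N ih =>
    have hpr := isProbabilityMeasure_convPow (μ := μ) N
    have hpr2 := isProbabilityMeasure_walkStep_iterate (μ := μ) measurable_sphereAct
      (Measure.dirac s) N
    have i1 : Integrable (fun p : Diff2 M × Diff2 M => stretch (p.2, s)) (μ.prod (convPow μ N)) :=
      ih.1.comp_snd μ
    have hmp : MeasurePreserving (Prod.map id fun f => sphereAct f s) (μ.prod (convPow μ N))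
        (μ.prod ((walkStep sphereAct μ)^[N] (Measure.dirac s))) :=
      (MeasurePreserving.id μ).prod ⟨hm, map_convPow s N⟩
    have i2 : Integrable (fun p : Diff2 M × Diff2 M => stretch (p.1, sphereAct p.2 s))
        (μ.prod (convPow μ N)) := hmp.integrable_comp_of_integrable (integrable_stretch hμ _)
    have e2 : ∫ p : Diff2 M × Diff2 M, stretch (p.1, sphereAct p.2 s) ∂(μ.prod (convPow μ N))
        = ∫ s', meanStretch μ s' ∂((walkStep sphereAct μ)^[N] (Measure.dirac s)) := by
      rw [← integral_stretch hμ, ← hmp.map_eq, integral_map hmp.measurable.aemeasurable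
        measurable_stretch.aestronglyMeasurable]
      rfl
    have hfun : (fun p : Diff2 M × Diff2 M => stretch (p.2.trans p.1, s))
        = fun p => stretch (p.2, s) + stretch (p.1, sphereAct p.2 s) := by
      funext p; exact stretch_trans _ _ _
    constructor
    · rw [convPow, integrable_map_measure hst.aestronglyMeasurable
        measurable_diff2_comp.aemeasurable]
      change Integrable (fun p : Diff2 M × Diff2 M => stretch (p.2.trans p.1, s)) _
      rw [hfun]
      exact i1.add i2
    · rw [convPow, integral_map measurable_diff2_comp.aemeasurable hst.aestronglyMeasurable,
        hfun, integral_add i1 i2, e2, Finset.sum_range_succ, ← ih.2,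
        integral_fun_snd (fun f => stretch (f, s))]
      simp

end Cocycle

/-! ### Measurable invariant subbundles -/

section Frame

variable {M : Type*} [TopologicalSpace M] [ChartedSpace Plane M] [IsManifold (𝓡 2) ∞ M]

/-- Subsets of the tangent bundle are measurable when they are Borel. -/
noncomputable instance measurableSpaceTangentBundle :
    MeasurableSpace (TangentBundle (𝓡 2) M) := borel _

instance borelSpaceTangentBundle : BorelSpace (TangentBundle (𝓡 2) M) := ⟨rfl⟩

lemma finrank_tangentSpace (x : M) : Module.finrank ℝ (TangentSpace (𝓡 2) x) = 2 :=
  finrank_euclideanSpace_fin (𝕜 := ℝ) (n := 2)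

lemma finiteDimensional_tangentSpace (x : M) : FiniteDimensional ℝ (TangentSpace (𝓡 2) x) :=
  inferInstanceAs (FiniteDimensional ℝ Plane)

/-- In a tangent plane, a nonzero subspace of a proper subspace is equal to it. -/
lemma submodule_tangentSpace_eq_of_le {x : M} {U W : Submodule ℝ (TangentSpace (𝓡 2) x)}
    (hUW : U ≤ W) (hU : U ≠ ⊥) (hW : W ≠ ⊤) : U = W := by
  have := finiteDimensional_tangentSpace x
  refine Submodule.eq_of_le_of_finrank_le hUW ?_
  have h1 : 1 ≤ Module.finrank ℝ U := Nat.one_le_iff_ne_zero.2 fun h =>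
    hU (Submodule.finrank_eq_zero.1 h)
  have h2 := Submodule.finrank_lt hW
  rw [finrank_tangentSpace] at h2
  omega

/-- A surface has a Borel (possibly discontinuous) global frame: use the trivialization of the
first member of a countable family that is defined at the point. -/
lemma exists_measurable_frame [SecondCountableTopology M] [MeasurableSpace M] [BorelSpace M] :
    ∃ F : (x : M) → Plane ≃ₗ[ℝ] TangentSpace (𝓡 2) x,
      Measurable fun p : M × Plane => (⟨p.1, F p.1 p.2⟩ : TangentBundle (𝓡 2) M) := by
  rcases isEmpty_or_nonempty M with hM | hM
  · exact ⟨fun x => isEmptyElim x, measurable_of_empty _⟩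
  let e : M → Trivialization Plane (TotalSpace.proj : TangentBundle (𝓡 2) M → M) :=
    fun x => trivializationAt Plane (TangentSpace (𝓡 2) : M → Type _) x
  obtain ⟨s, hs, hsu⟩ := countable_cover_nhds (X := M) (U := fun x => (e x).baseSet)
    fun x => (e x).open_baseSet.mem_nhds (FiberBundle.mem_baseSet_trivializationAt' _)
  have hsne : s.Nonempty := by
    rw [nonempty_iff_ne_empty]
    rintro rfl
    obtain ⟨x⟩ := hM
    have : x ∈ ⋃ x ∈ (∅ : Set M), (e x).baseSet := hsu ▸ mem_univ x
    simp at this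
  obtain ⟨c, rfl⟩ := hs.exists_eq_range hsne
  have hcov : ∀ x, ∃ n, x ∈ (e (c n)).baseSet := fun x => by
    have : x ∈ ⋃ y ∈ range c, (e y).baseSet := hsu ▸ mem_univ x
    simpa using this
  classical
  let j : M → ℕ := fun x => Nat.find (hcov x)
  have hj : ∀ x, x ∈ (e (c (j x))).baseSet := fun x => Nat.find_spec (hcov x)
  have hlin : ∀ y, (e y).IsLinear ℝ := fun y => inferInstance
  refine ⟨fun x => ((e (c (j x))).linearEquivAt ℝ x (hj x)).symm, ?_⟩
  let g : ℕ → M × Plane → TangentBundle (𝓡 2) M := fun n =>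
    (e (c n)).target.piecewise (fun p => (e (c n)).toOpenPartialHomeomorph.symm p)
      (fun p => zeroSection Plane (TangentSpace (𝓡 2) : M → Type _) p.1)
  have h0 : Continuous (zeroSection Plane (TangentSpace (𝓡 2) : M → Type _)) :=
    (Bundle.contMDiff_zeroSection ℝ (IB := 𝓡 2) (n := 0) _).continuous
  have hg : ∀ n, Measurable (g n) := fun n =>
    ContinuousOn.measurable_piecewise (e (c n)).toOpenPartialHomeomorph.continuousOn_symm
      (h0.comp continuous_fst).continuousOn (e (c n)).open_target.measurableSet
  have hmeas := Measurable.find (p := fun n (q : M × Plane) => q.1 ∈ (e (c n)).baseSet) hg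
    (fun n => measurable_fst (e (c n)).open_baseSet.measurableSet) fun q => hcov q.1
  convert hmeas using 1
  funext q
  have hq : (q.1, q.2) ∈ (e (c (j q.1))).target := (e (c (j q.1))).mk_mem_target.2 (hj q.1)
  have h1 : g (j q.1) q = (e (c (j q.1))).toOpenPartialHomeomorph.symm q :=
    piecewise_eq_of_mem _ _ _ hq
  change _ = g (j q.1) q
  rw [h1, ← Trivialization.mk_symm _ (hj q.1)]
  rfl

end Frame

section InvariantSubbundle

variable {M : Type*} [TopologicalSpace M] [ChartedSpace Plane M] [IsManifold (𝓡 2) ∞ M]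
  [RiemannianBundle (fun x : M => TangentSpace (𝓡 2) x)]

lemma finrank_map_mfderiv (f : Diff2 M) (x : M) (U : Submodule ℝ (TangentSpace (𝓡 2) x)) :
    Module.finrank ℝ (U.map (mfderiv (𝓡 2) (𝓡 2) f x :
      TangentSpace (𝓡 2) x →ₗ[ℝ] TangentSpace (𝓡 2) (f x))) = Module.finrank ℝ U :=
  (LinearEquiv.finrank_eq (Submodule.equivMapOfInjective _ (mfderiv_diff2_injective f x) U)).symm

variable [T2Space M] [CompactSpace M] [MeasurableSpace M] [BorelSpace M]

lemma measurable_diff2_apply :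
    Measurable (Function.uncurry fun (f : Diff2 M) (x : M) => f x) := by
  have := secondCountableTopology_of_compact (M := M)
  exact continuous_diff2_apply.measurable

lemma measurable_tangentMap_diff2 :
    Measurable fun p : Diff2 M × TangentBundle (𝓡 2) M => tangentMap (𝓡 2) (𝓡 2) p.1 p.2 := by
  have := secondCountableTopology_of_compact (M := M)
  have : IsManifold (𝓡 2) 1 M := IsManifold.of_le (n := ∞) (by norm_num)
  have := secondCountableTopology_tangentBundle (𝓡 2) M
  exact continuous_tangentMap_diff2.measurable

variable {μ : Measure (Diff2 M)} [IsProbabilityMeasure μ] {ν : Measure M} [IsProbabilityMeasure ν]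
  {V : (x : M) → Submodule ℝ (TangentSpace (𝓡 2) x)}

/-- A subbundle with a Borel frame that is almost surely mapped into itself is almost surely
invariant, since its rank is constant along the random walk. -/
lemma isInvariantSubbundle_of_forall (hν : WalkStationary (fun (f : Diff2 M) (x : M) => f x) μ ν)
    {k : ℕ} (hVm : MeasurableSet {p : TangentBundle (𝓡 2) M | p.2 ∈ V p.1})
    (hV : ∀ x, ∀ v ∈ V x, ∀ᵐ (f : Diff2 M) ∂μ, mfderiv (𝓡 2) (𝓡 2) f x v ∈ V (f x))
    (hk : IsMeasurableSubbundle ν k V) : IsInvariantSubbundle μ ν V := by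
  obtain ⟨s, hs, hsV⟩ := hk
  have hs' : ∀ i, Measurable fun x => (⟨x, s i x⟩ : TangentBundle (𝓡 2) M) := fun i => by
    have := hs i
    rwa [← BorelSpace.measurable_eq (α := M)] at this
  have hdim : ∀ᵐ x ∂ν, Module.finrank ℝ (V x) = k := by
    filter_upwards [hsV] with x hx
    rw [← hx.2, finrank_span_eq_card hx.1, Fintype.card_fin]
  have hdim2 : ∀ᵐ (f : Diff2 M) ∂μ, ∀ᵐ x ∂ν, Module.finrank ℝ (V (f x)) = k :=
    Measure.ae_ae_of_ae_prod
      ((hν.measurePreserving measurable_diff2_apply).quasiMeasurePreserving.ae hdim)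
  -- the frame vectors are measurable, so the quantifiers over `x` and `f` can be exchanged
  have hmem : ∀ i, ∀ᵐ (f : Diff2 M) ∂μ, ∀ᵐ x ∂ν, s i x ∈ V x →
      mfderiv (𝓡 2) (𝓡 2) f x (s i x) ∈ V (f x) := fun i => by
    have hm1 : MeasurableSet {q : Diff2 M × M | s i q.2 ∈ V q.2} :=
      ((hs' i).comp measurable_snd) hVm
    have hm2 : MeasurableSet {q : Diff2 M × M |
        mfderiv (𝓡 2) (𝓡 2) q.1 q.2 (s i q.2) ∈ V (q.1 q.2)} :=
      (measurable_tangentMap_diff2.comp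
        (measurable_fst.prodMk ((hs' i).comp measurable_snd))) hVm
    refine (Measure.ae_ae_comm (p := fun (f : Diff2 M) x => s i x ∈ V x →
      mfderiv (𝓡 2) (𝓡 2) f x (s i x) ∈ V (f x)) (hm1.himp hm2)).2
      (Eventually.of_forall fun x => ?_)
    by_cases hx : s i x ∈ V x
    · filter_upwards [hV x _ hx] with f hf using fun _ => hf
    · exact Eventually.of_forall fun f h => absurd h hx
  filter_upwards [hdim2, ae_all_iff.2 hmem] with f hf1 hf2
  filter_upwards [hf1, ae_all_iff.2 hf2, hsV, hdim] with x h1 h2 h3 h4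
  have := finiteDimensional_tangentSpace (f x)
  refine Submodule.eq_of_le_of_finrank_eq ?_ (by rw [finrank_map_mfderiv, h1, h4])
  rw [Submodule.map_le_iff_le_comap, ← h3.2, Submodule.span_le]
  rintro _ ⟨i, rfl⟩
  exact h2 i (h3.2 ▸ Submodule.subset_span ⟨i, rfl⟩)

lemma linearIndependent_frame {x : M} (L : Plane ≃ₗ[ℝ] TangentSpace (𝓡 2) x) :
    LinearIndependent ℝ (fun i : Fin 2 => L (EuclideanSpace.single i 1)) ∧
      Submodule.span ℝ (range fun i : Fin 2 => L (EuclideanSpace.single i 1)) = ⊤ := by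
  let b := ((EuclideanSpace.basisFun (Fin 2) ℝ).toBasis).map L
  have hb : (fun i : Fin 2 => L (EuclideanSpace.single i 1)) = b := by
    funext i; simp [b]
  rw [hb]
  exact ⟨b.linearIndependent, b.span_eq⟩

lemma eq_top_of_frame {x : M} (L : Plane ≃ₗ[ℝ] TangentSpace (𝓡 2) x)
    {U : Submodule ℝ (TangentSpace (𝓡 2) x)} (hU : ∀ i : Fin 2, L (EuclideanSpace.single i 1) ∈ U) :
    U = ⊤ := by
  rw [eq_top_iff, ← (linearIndependent_frame L).2, Submodule.span_le]
  rintro _ ⟨i, rfl⟩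
  exact hU i

lemma exists_frame_coord {x : M} (L : Plane ≃ₗ[ℝ] TangentSpace (𝓡 2) x)
    (v : TangentSpace (𝓡 2) x) : ∃ a b : ℝ,
      v = a • L (EuclideanSpace.single 0 1) + b • L (EuclideanSpace.single 1 1) := by
  refine ⟨L.symm v 0, L.symm v 1, ?_⟩
  rw [← map_smul, ← map_smul, ← map_add, ← LinearEquiv.symm_apply_eq]
  ext i
  fin_cases i <;> simp

/-- A nonzero family of subspaces of the tangent planes that is Borel as a subset of `TM` and is
mapped into itself by almost every diffeomorphism is, with respect to an ergodic stationary
measure, a measurable invariant subbundle: the set where the subspace is the whole plane is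
invariant, and elsewhere the slope of the line is a Borel function. -/
lemma exists_isMeasurableSubbundle (hν : WalkStationary (fun (f : Diff2 M) (x : M) => f x) μ ν)
    (he : WalkErgodic (fun (f : Diff2 M) (x : M) => f x) μ ν)
    (hVm : MeasurableSet {p : TangentBundle (𝓡 2) M | p.2 ∈ V p.1})
    (hV : ∀ x, ∀ v ∈ V x, ∀ᵐ (f : Diff2 M) ∂μ, mfderiv (𝓡 2) (𝓡 2) f x v ∈ V (f x))
    (hne : ∀ᵐ x ∂ν, V x ≠ ⊥) :
    ∃ k, 0 < k ∧ IsMeasurableSubbundle ν k V ∧ IsInvariantSubbundle μ ν V := by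
  have := secondCountableTopology_of_compact (M := M)
  suffices h : ∃ k, 0 < k ∧ IsMeasurableSubbundle ν k V by
    obtain ⟨k, hk, h⟩ := h
    exact ⟨k, hk, h, isInvariantSubbundle_of_forall hν hVm hV h⟩
  obtain ⟨F, hF⟩ := exists_measurable_frame (M := M)
  have hFv : ∀ v : Plane, Measurable fun x : M => (⟨x, F x v⟩ : TangentBundle (𝓡 2) M) :=
    fun v => hF.comp measurable_prodMk_right
  have hmemV : ∀ v : Plane, MeasurableSet {x : M | F x v ∈ V x} := fun v => hFv v hVm
  let D : Set M := {x | V x = ⊤}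
  have hD : MeasurableSet D := by
    have : D = ⋂ i : Fin 2, {x : M | F x (EuclideanSpace.single i 1) ∈ V x} := by
      ext x
      rw [mem_iInter]
      exact ⟨fun h i => by
        have h' : V x = ⊤ := h
        change _ ∈ V x
        rw [h']; trivial, fun h => eq_top_of_frame (F x) h⟩
    rw [this]
    exact MeasurableSet.iInter fun i => hmemV _
  have hDinv : ∀ᵐ p ∂(μ.prod ν), D.indicator (fun _ => (1 : ℝ)) p.2
      ≤ D.indicator (fun _ => (1 : ℝ)) (p.1 p.2) := by
    have hind : Measurable (D.indicator fun _ => (1 : ℝ)) := measurable_const.indicator hD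
    have hms : MeasurableSet {p : Diff2 M × M | D.indicator (fun _ => (1 : ℝ)) p.2
      ≤ D.indicator (fun _ => (1 : ℝ)) (p.1 p.2)} :=
      measurableSet_le (hind.comp measurable_snd) (hind.comp measurable_diff2_apply)
    rw [Measure.ae_prod_iff_ae_ae hms]
    refine (Measure.ae_ae_comm hms).2 (Eventually.of_forall fun x => ?_)
    by_cases hx : x ∈ D
    · have hx' : V x = ⊤ := hx
      have h1 := ae_all_iff.2 fun i : Fin 2 =>
        hV x (F x (EuclideanSpace.single i 1)) (by rw [hx']; trivial)
      filter_upwards [h1] with f hf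
      have hfx : f x ∈ D := by
        have := finiteDimensional_tangentSpace (f x)
        have hle : (⊤ : Submodule ℝ (TangentSpace (𝓡 2) x)).map (mfderiv (𝓡 2) (𝓡 2) f x :
            TangentSpace (𝓡 2) x →ₗ[ℝ] TangentSpace (𝓡 2) (f x)) ≤ V (f x) := by
          rw [Submodule.map_le_iff_le_comap, ← (linearIndependent_frame (F x)).2,
            Submodule.span_le]
          rintro _ ⟨i, rfl⟩
          exact hf i
        refine Submodule.eq_top_of_finrank_eq (le_antisymm (Submodule.finrank_le _) ?_)
        have h2 := Submodule.finrank_mono hle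
        rw [finrank_map_mfderiv, finrank_top, finrank_tangentSpace] at h2
        exact (finrank_tangentSpace (f x)).le.trans h2
      change D.indicator (fun _ => (1 : ℝ)) x ≤ D.indicator (fun _ => (1 : ℝ)) (f x)
      rw [indicator_of_mem hx, indicator_of_mem hfx]
    · refine Eventually.of_forall fun f => ?_
      change D.indicator (fun _ => (1 : ℝ)) x ≤ D.indicator (fun _ => (1 : ℝ)) (f x)
      rw [indicator_of_notMem hx]
      exact indicator_nonneg (fun _ _ => zero_le_one) _
  -- `D` is mapped into itself, so it is almost surely invariant by stationarity
  have hD01 : ν D = 0 ∨ ν D = 1 := by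
    refine he D hD ?_
    have h1 := hν.ae_eq_of_ae_le measurable_diff2_apply (measurable_const.indicator hD)
      ((integrable_const (1 : ℝ)).indicator hD) hDinv
    filter_upwards [Measure.ae_ae_of_ae_prod h1] with f hf
    filter_upwards [hf] with x hx
    have hx' : D.indicator (fun _ => (1 : ℝ)) (f x) = D.indicator (fun _ => (1 : ℝ)) x := hx
    refine propext ?_
    change f x ∈ D ↔ x ∈ D
    by_cases h : x ∈ D <;> by_cases h' : f x ∈ D <;> simp [h, h'] at hx' ⊢
  have hconv : ∀ {s : (x : M) → TangentSpace (𝓡 2) x},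
      (Measurable fun x : M => (⟨x, s x⟩ : TangentBundle (𝓡 2) M)) →
      Measurable[borel M, borel (TangentBundle (𝓡 2) M)]
        (fun x => (⟨x, s x⟩ : TangentBundle (𝓡 2) M)) := fun h => by
    rwa [BorelSpace.measurable_eq (α := M)] at h
  rcases hD01 with h0 | h1
  · -- The subspaces are lines: the line is spanned by `F x e₁`, or by `F x (e₀ + t e₁)` for the
    -- unique slope `t` for which this vector belongs to it.
    let e : Fin 2 → Plane := fun i => EuclideanSpace.single i 1
    let A : Set M := {x | F x (e 1) ∈ V x}
    let W : Set (M × ℝ) := {q | q.1 ∉ A ∧ F q.1 (e 0 + q.2 • e 1) ∈ V q.1}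
    have hA : MeasurableSet A := hmemV _
    have hslope : Measurable fun q : M × ℝ =>
        (⟨q.1, F q.1 (e 0 + q.2 • e 1)⟩ : TangentBundle (𝓡 2) M) := by
      have h1 : Continuous fun q : M × ℝ => (e 0 + q.2 • e 1 : Plane) := by fun_prop
      exact hF.comp (measurable_fst.prodMk h1.measurable)
    have hW : MeasurableSet W :=
      MeasurableSet.inter (measurable_fst hA.compl) (hslope hVm)
    have huniq : ∀ x t t', (x, t) ∈ W → (x, t') ∈ W → t = t' := by
      rintro x t t' ⟨hx, h1⟩ ⟨-, h2⟩
      by_contra hne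
      refine hx ?_
      have h3 : F x (e 0 + t • e 1) - F x (e 0 + t' • e 1) = (t - t') • F x (e 1) := by
        rw [← map_sub, ← map_smul]; congr 1; module
      have h4 := (V x).sub_mem h1 h2
      change F x (e 0 + t • e 1) - F x (e 0 + t' • e 1) ∈ V x at h4
      rw [h3] at h4
      exact ((V x).smul_mem_iff (sub_ne_zero.2 hne)).1 h4
    classical
    let τ : M → ℝ := fun x => if h : ∃ t, (x, t) ∈ W then h.choose else 0
    have hτW : ∀ x t, (x, t) ∈ W → τ x = t := fun x t h => by
      have hex : ∃ t, (x, t) ∈ W := ⟨t, h⟩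
      simp only [τ, dif_pos hex]
      exact huniq x _ _ hex.choose_spec h
    have hstd : StandardBorelSpace M := by
      let _ := TopologicalSpace.metrizableSpaceMetric M
      infer_instance
    -- the slope is a Borel function, as images under injective Borel maps are Borel
    have himg : ∀ B : Set (M × ℝ), MeasurableSet B → MeasurableSet (Prod.fst '' (W ∩ B)) :=
      fun B hB => (hW.inter hB).image_of_measurable_injOn measurable_fst (by
        rintro ⟨x, t⟩ h ⟨x', t'⟩ h' (rfl : x = x')
        exact congrArg (Prod.mk x) (huniq x t t' h.1 h'.1))
    have hτ : Measurable τ := by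
      intro B hB
      have hset : τ ⁻¹' B = Prod.fst '' (W ∩ Prod.snd ⁻¹' B) ∪
          ((Prod.fst '' (W ∩ univ))ᶜ ∩ {_x | (0 : ℝ) ∈ B}) := by
        ext x
        by_cases hex : ∃ t, (x, t) ∈ W
        · obtain ⟨t, ht⟩ := hex
          have h1 : x ∈ Prod.fst '' (W ∩ univ) := ⟨(x, t), ⟨ht, trivial⟩, rfl⟩
          rw [mem_preimage, hτW x t ht]
          constructor
          · exact fun h => Or.inl ⟨(x, t), ⟨ht, h⟩, rfl⟩
          · rintro (⟨⟨x', t'⟩, ⟨h2, h3⟩, rfl⟩ | ⟨h2, -⟩)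
            · exact huniq _ _ _ h2 ht ▸ h3
            · exact absurd h1 h2
        · have h1 : τ x = 0 := dif_neg hex
          rw [mem_preimage, h1]
          constructor
          · refine fun h => Or.inr ⟨?_, h⟩
            rintro ⟨⟨x', t'⟩, ⟨h2, -⟩, rfl⟩
            exact hex ⟨t', h2⟩
          · rintro (⟨⟨x', t'⟩, ⟨h2, -⟩, rfl⟩ | ⟨-, h2⟩)
            · exact absurd ⟨t', h2⟩ hex
            · exact h2
      rw [hset]
      exact (himg _ (measurable_snd hB)).union
        ((himg _ MeasurableSet.univ).compl.inter (MeasurableSet.const _))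
    let s : (x : M) → TangentSpace (𝓡 2) x := fun x =>
      if x ∈ A then F x (e 1) else F x (e 0 + τ x • e 1)
    have hs : Measurable fun x : M => (⟨x, s x⟩ : TangentBundle (𝓡 2) M) := by
      have h1 := @Measurable.piecewise _ _ _ _ _ _ _ (fun x => Classical.propDecidable (x ∈ A)) hA
        (hFv (e 1)) (hslope.comp (measurable_id.prodMk hτ))
      convert h1 using 1
      funext x
      by_cases hx : x ∈ A
      · simp only [piecewise_eq_of_mem _ _ _ hx, s, if_pos hx]
      · simp only [piecewise_eq_of_notMem _ _ _ hx, s, if_neg hx]; rfl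
    refine ⟨1, one_pos, fun _ => s, fun _ => hconv hs, ?_⟩
    have hDae : ∀ᵐ x ∂ν, x ∉ D := measure_eq_zero_iff_ae_notMem.1 h0
    filter_upwards [hDae, hne] with x hxD hxne
    have hsmem : s x ∈ V x ∧ s x ≠ 0 := by
      by_cases hx : x ∈ A
      · have : s x = F x (e 1) := if_pos hx
        rw [this]
        exact ⟨hx, (map_ne_zero_iff _ (F x).injective).2 (by simp [e])⟩
      · obtain ⟨v, hv, hv0⟩ := (Submodule.ne_bot_iff _).1 hxne
        obtain ⟨a, b, hab⟩ := exists_frame_coord (F x) v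
        have ha : a ≠ 0 := by
          rintro rfl
          rw [zero_smul, zero_add] at hab
          have hb : b ≠ 0 := by rintro rfl; exact hv0 (by simpa using hab)
          exact hx (((V x).smul_mem_iff hb).1 (hab ▸ hv))
        have hW' : (x, a⁻¹ * b) ∈ W := by
          refine ⟨hx, ?_⟩
          have h2 := (V x).smul_mem a⁻¹ hv
          have h3 : F x (e 0 + (a⁻¹ * b) • e 1) = a⁻¹ • v := by
            rw [hab, map_add, map_smul, smul_add, smul_smul, smul_smul, inv_mul_cancel₀ ha,
              one_smul]
          change F x (e 0 + (a⁻¹ * b) • e 1) ∈ V x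
          rw [h3]; exact h2
        have h4 : s x = F x (e 0 + τ x • e 1) := if_neg hx
        rw [h4, hτW x _ hW']
        refine ⟨hW'.2, (map_ne_zero_iff _ (F x).injective).2 fun h => ?_⟩
        have := congrArg (fun u : Plane => u 0) h
        simp [e] at this
    refine ⟨linearIndependent_unique_iff.2 hsmem.2, ?_⟩
    rw [range_const]
    refine submodule_tangentSpace_eq_of_le ?_ ?_ hxD
    · rw [Submodule.span_singleton_le_iff_mem]; exact hsmem.1
    · rw [Ne, Submodule.span_singleton_eq_bot]; exact hsmem.2
  · refine ⟨2, two_pos, fun i x => F x (EuclideanSpace.single i 1), fun i => hconv (hFv _), ?_⟩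
    have hDae : ∀ᵐ x ∂ν, x ∈ D := (mem_ae_iff_prob_eq_one hD).2 h1
    filter_upwards [hDae] with x hx
    have hx' : V x = ⊤ := hx
    rw [hx']
    exact linearIndependent_frame (F x)

end InvariantSubbundle

/-! ### Exponential bounds and growth rates -/

/-- `ExpBound a l` says that the sequence `a` grows at most at the exponential rate `l`. -/
def ExpBound (a : ℕ → ℝ) (l : ℝ) : Prop :=
  ∀ ε > 0, ∀ᶠ n : ℕ in atTop, a n ≤ Real.exp ((l + ε) * n)

lemma eventually_mul_exp_le (C : ℝ) {b c : ℝ} (hbc : b < c) :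
    ∀ᶠ n : ℕ in atTop, C * Real.exp (b * n) ≤ Real.exp (c * n) := by
  have h1 : Tendsto (fun n : ℕ => (c - b) * (n : ℝ)) atTop atTop :=
    tendsto_natCast_atTop_atTop.const_mul_atTop (sub_pos.2 hbc)
  filter_upwards [(Real.tendsto_exp_atTop.comp h1).eventually_ge_atTop C] with n hn
  have h2 : c * n = (c - b) * n + b * n := by ring
  rw [h2, Real.exp_add]
  exact mul_le_mul_of_nonneg_right hn (Real.exp_pos _).le

/-- Constant factors do not matter in an exponential bound. -/
lemma expBound_of_mul {a : ℕ → ℝ} {l : ℝ}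
    (h : ∀ ε > 0, ∃ C : ℝ, ∀ᶠ n : ℕ in atTop, a n ≤ C * Real.exp ((l + ε) * n)) :
    ExpBound a l := by
  intro ε hε
  obtain ⟨C, hC⟩ := h (ε / 2) (half_pos hε)
  filter_upwards [hC, eventually_mul_exp_le C (show l + ε / 2 < l + ε by linarith)] with n h1 h2
  exact h1.trans h2

lemma ExpBound.mono {a b : ℕ → ℝ} {l l' : ℝ} (h : ExpBound a l) (hab : ∀ n, b n ≤ a n)
    (hl : l ≤ l') : ExpBound b l' := by
  intro ε hε
  filter_upwards [h ε hε] with n hn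
  refine (hab n).trans (hn.trans (Real.exp_le_exp.2 ?_))
  gcongr

lemma ExpBound.add {a b : ℕ → ℝ} {l : ℝ} (ha : ExpBound a l) (hb : ExpBound b l) :
    ExpBound (fun n => a n + b n) l :=
  expBound_of_mul fun ε hε => ⟨2, by
    filter_upwards [ha ε hε, hb ε hε] with n h1 h2; linarith⟩

lemma ExpBound.const_mul {a : ℕ → ℝ} {l : ℝ} (ha : ExpBound a l) {C : ℝ} (hC : 0 ≤ C) :
    ExpBound (fun n => C * a n) l :=
  expBound_of_mul fun ε hε => ⟨C, by
    filter_upwards [ha ε hε] with n h1 using mul_le_mul_of_nonneg_left h1 hC⟩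

lemma ExpBound.shift {a : ℕ → ℝ} {l : ℝ} (ha : ExpBound a l) :
    ExpBound (fun n => a (n + 1)) l :=
  expBound_of_mul fun ε hε => ⟨Real.exp (l + ε), by
    filter_upwards [(tendsto_add_atTop_nat 1).eventually (ha ε hε)] with n hn
    rw [← Real.exp_add]
    refine hn.trans (Real.exp_le_exp.2 (le_of_eq ?_))
    push_cast; ring⟩

lemma expBound_iff_nat {a : ℕ → ℝ} {l : ℝ} : ExpBound a l ↔
    ∀ m : ℕ, ∃ n₀ : ℕ, ∀ n, n₀ ≤ n → a n ≤ Real.exp ((l + 1 / (m + 1)) * n) := by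
  constructor
  · intro h m
    exact eventually_atTop.1 (h (1 / (m + 1)) (by positivity))
  · intro h ε hε
    obtain ⟨m, hm⟩ := exists_nat_one_div_lt hε
    obtain ⟨n₀, hn₀⟩ := h m
    filter_upwards [eventually_ge_atTop n₀] with n hn
    refine (hn₀ n hn).trans (Real.exp_le_exp.2 ?_)
    gcongr

section Growth

variable {M : Type*} [TopologicalSpace M] [ChartedSpace Plane M] [IsManifold (𝓡 2) ∞ M]
  [RiemannianBundle (fun x : M => TangentSpace (𝓡 2) x)]

lemma norm_mfderiv_word_le_iff (w : ℕ → Diff2 M) {x : M} {v : TangentSpace (𝓡 2) x} (hv : v ≠ 0)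
    {n : ℕ} (hn : 0 < n) (c : ℝ) : growthRate w x v n ≤ c ↔
      ‖mfderiv (𝓡 2) (𝓡 2) (word w n) x v‖ ≤ ‖v‖ * Real.exp (c * n) := by
  have h0 := norm_pos_iff.2 hv
  have h1 := norm_pos_iff.2 (mfderiv_diff2_ne_zero (word w n) x hv)
  have hn' : (0 : ℝ) < n := by exact_mod_cast hn
  rw [growthRate, logGrowth, one_div, ← div_eq_inv_mul, div_le_iff₀ hn',
    Real.log_le_iff_le_exp (div_pos h1 h0), div_le_iff₀ h0, mul_comm ‖v‖]

/-- The upper growth rate in terms of exponential bounds of the norms. -/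
lemma upperRate_le_iff (w : ℕ → Diff2 M) {x : M} {v : TangentSpace (𝓡 2) x} (hv : v ≠ 0) (l : ℝ) :
    upperRate w x v ≤ (l : EReal) ↔
      ExpBound (fun n => ‖mfderiv (𝓡 2) (𝓡 2) (word w n) x v‖) l := by
  have h0 := norm_pos_iff.2 hv
  rw [upperRate, limsup_le_iff]
  constructor
  · intro h
    refine expBound_of_mul fun ε hε => ⟨‖v‖, ?_⟩
    filter_upwards [h ((l + ε : ℝ) : EReal) (by exact_mod_cast lt_add_of_pos_right l hε),
      eventually_gt_atTop 0] with n hn hn0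
    exact (norm_mfderiv_word_le_iff w hv hn0 _).1 (by exact_mod_cast hn.le)
  · intro h y hy
    obtain ⟨c, hc1, hc2⟩ := EReal.lt_iff_exists_real_btwn.1 hy
    have hlc : l < c := by exact_mod_cast hc1
    have h2 := h ((c - l) / 2) (by linarith)
    filter_upwards [h2, eventually_mul_exp_le ‖v‖⁻¹ (show l + (c - l) / 2 < c by linarith),
      eventually_gt_atTop 0] with n hn1 hn2 hn0
    refine lt_of_le_of_lt ?_ hc2
    have h3 : growthRate w x v n ≤ c := by
      refine (norm_mfderiv_word_le_iff w hv hn0 c).2 (hn1.trans ?_)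
      rwa [inv_mul_le_iff₀ h0] at hn2
    exact_mod_cast h3

lemma upperRate_eq_of_tendsto {w : ℕ → Diff2 M} {x : M} {v : TangentSpace (𝓡 2) x} {l : ℝ}
    (h : Tendsto (growthRate w x v) atTop (𝓝 l)) : upperRate w x v = l :=
  ((continuous_coe_real_ereal.tendsto l).comp h).limsup_eq

/-- The subspace of the tangent vectors at `x` that grow along `w` at most at the rate `l`. -/
def slowSpace (w : ℕ → Diff2 M) (l : ℝ) (x : M) : Submodule ℝ (TangentSpace (𝓡 2) x) where
  carrier := {v | ExpBound (fun n => ‖mfderiv (𝓡 2) (𝓡 2) (word w n) x v‖) l}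
  zero_mem' := fun ε _ => Eventually.of_forall fun n => by
    simpa using (Real.exp_pos _).le
  add_mem' := fun {a b} ha hb => (ha.add hb).mono (fun n => by
    rw [map_add]; exact norm_add_le _ _) le_rfl
  smul_mem' := fun c v hv => (hv.const_mul (norm_nonneg c)).mono (fun n => by
    rw [map_smul, norm_smul]) le_rfl

lemma mem_slowSpace {w : ℕ → Diff2 M} {l : ℝ} {x : M} {v : TangentSpace (𝓡 2) x} :
    v ∈ slowSpace w l x ↔
      ExpBound (fun n => ‖mfderiv (𝓡 2) (𝓡 2) (word w n) x v‖) l := Iff.rfl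

lemma mem_slowSpace_of_tendsto {w : ℕ → Diff2 M} {x : M} {v : TangentSpace (𝓡 2) x} {l : ℝ}
    (hv : v ≠ 0) (h : Tendsto (growthRate w x v) atTop (𝓝 l)) : v ∈ slowSpace w l x :=
  (upperRate_le_iff w hv l).1 (upperRate_eq_of_tendsto h).le

lemma word_seqCons (f : Diff2 M) (w : ℕ → Diff2 M) (n : ℕ) :
    word (seqCons (f, w)) (n + 1) = f.trans (word w n) := by
  induction n with
  | zero => rfl
  | succ n ih =>
    change (word (seqCons (f, w)) (n + 1)).trans (w n) = f.trans ((word w n).trans (w n))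
    rw [ih]; rfl

/-- Growth along a path does not depend on the first step. -/
lemma mfderiv_mem_slowSpace {f : Diff2 M} {w : ℕ → Diff2 M} {l : ℝ} {x : M}
    {v : TangentSpace (𝓡 2) x} (hv : v ∈ slowSpace (seqCons (f, w)) l x) :
    mfderiv (𝓡 2) (𝓡 2) f x v ∈ slowSpace w l (f x) := by
  refine (ExpBound.shift hv).mono (fun n => ?_) le_rfl
  rw [word_seqCons, mfderiv_trans_apply]
  exact le_rfl

variable [T2Space M] [CompactSpace M]

lemma measurable_word (n : ℕ) : Measurable fun w : ℕ → Diff2 M => word w n := by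
  induction n with
  | zero => exact measurable_const
  | succ n ih =>
    exact continuous_diff2_comp.measurable.comp ((measurable_pi_apply n).prodMk ih)

variable [IsContMDiffRiemannianBundle (𝓡 2) ∞ Plane (fun x : M => TangentSpace (𝓡 2) x)]
  [MeasurableSpace M] [BorelSpace M]

lemma measurable_norm_mfderiv_word (n : ℕ) :
    Measurable fun q : (ℕ → Diff2 M) × TangentBundle (𝓡 2) M =>
      ‖mfderiv (𝓡 2) (𝓡 2) (word q.1 n) q.2.1 q.2.2‖ :=
  (continuous_norm_tangentBundle (M := M)).measurable.comp
    (measurable_tangentMap_diff2.comp (((measurable_word n).comp measurable_fst).prodMk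
      measurable_snd))

lemma measurableSet_slowSpace (l : ℝ) :
    MeasurableSet {q : (ℕ → Diff2 M) × TangentBundle (𝓡 2) M | q.2.2 ∈ slowSpace q.1 l q.2.1} := by
  simp only [mem_slowSpace, expBound_iff_nat, ofPred_forall, ofPred_exists]
  exact MeasurableSet.iInter fun m => MeasurableSet.iUnion fun n₀ => MeasurableSet.iInter fun n =>
    MeasurableSet.iInter fun _ =>
      measurableSet_le (measurable_norm_mfderiv_word n) measurable_const

variable (μ : Measure (Diff2 M)) [IsProbabilityMeasure μ]

/-- The subspace of the tangent vectors at `x` that almost surely grow at most at the rate `l`. -/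
def asSlowSpace (l : ℝ) (x : M) : Submodule ℝ (TangentSpace (𝓡 2) x) where
  carrier := {v | ∀ᵐ w ∂(Measure.infinitePi fun _ : ℕ => μ), v ∈ slowSpace w l x}
  zero_mem' := by
    change ∀ᵐ w ∂(Measure.infinitePi fun _ : ℕ => μ), 0 ∈ slowSpace w l x
    exact Eventually.of_forall fun w => zero_mem _
  add_mem' := fun {a b} ha hb => by
    change ∀ᵐ w ∂(Measure.infinitePi fun _ : ℕ => μ), a + b ∈ slowSpace w l x
    filter_upwards [ha, hb] with w h1 h2 using add_mem h1 h2
  smul_mem' := fun c v hv => by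
    change ∀ᵐ w ∂(Measure.infinitePi fun _ : ℕ => μ), c • v ∈ slowSpace w l x
    filter_upwards [hv] with w h1 using Submodule.smul_mem _ _ h1

lemma mem_asSlowSpace {l : ℝ} {x : M} {v : TangentSpace (𝓡 2) x} : v ∈ asSlowSpace μ l x ↔
    ∀ᵐ w ∂(Measure.infinitePi fun _ : ℕ => μ), v ∈ slowSpace w l x := Iff.rfl

lemma measurableSet_asSlowSpace (l : ℝ) :
    MeasurableSet {p : TangentBundle (𝓡 2) M | p.2 ∈ asSlowSpace μ l p.1} := by
  have h := measurable_measure_prodMk_right (μ := Measure.infinitePi fun _ : ℕ => μ)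
    (measurableSet_slowSpace (M := M) l).compl
  exact h (measurableSet_singleton 0)

lemma mfderiv_mem_asSlowSpace {l : ℝ} {x : M} {v : TangentSpace (𝓡 2) x}
    (hv : v ∈ asSlowSpace μ l x) :
    ∀ᵐ (f : Diff2 M) ∂μ, mfderiv (𝓡 2) (𝓡 2) f x v ∈ asSlowSpace μ l (f x) := by
  rw [mem_asSlowSpace, ← map_seqCons μ] at hv
  have h1 := ae_of_ae_map measurable_seqCons.aemeasurable hv
  filter_upwards [Measure.ae_ae_of_ae_prod h1] with f hf
  exact (mem_asSlowSpace μ).2 (hf.mono fun w hw => mfderiv_mem_slowSpace hw)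

end Growth

/-! ### Failure of uniform expansion -/

section NonExpanding

variable {M : Type*} [TopologicalSpace M] [ChartedSpace Plane M] [IsManifold (𝓡 2) ∞ M]
  [RiemannianBundle (fun x : M => TangentSpace (𝓡 2) x)] [T2Space M] [CompactSpace M]
  [MeasurableSpace M] [BorelSpace M] {μ : Measure (Diff2 M)} [IsProbabilityMeasure μ]
  {ν : Measure M}

lemma isStationary_iff [IsProbabilityMeasure ν] :
    IsStationary μ ν ↔ WalkStationary (fun (f : Diff2 M) (x : M) => f x) μ ν := by
  have hm := measurable_diff2_apply (M := M)
  have key : ∀ A : Set M, MeasurableSet A → ∫⁻ f : Diff2 M, Measure.map f ν A ∂μ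
      = (μ.prod ν).map (Function.uncurry fun (f : Diff2 M) (x : M) => f x) A := fun A hA => by
    rw [Measure.map_apply hm hA, Measure.prod_apply (hm hA)]
    refine lintegral_congr fun f => ?_
    rw [Measure.map_apply f.continuous.measurable hA]
    rfl
  constructor
  · exact fun h => Measure.ext fun A hA => (key A hA).symm.trans (h A hA)
  · intro h A hA
    rw [key A hA]
    exact congrArg (fun κ : Measure M => κ A) h

lemma isErgodicStationary_iff [IsProbabilityMeasure ν] : IsErgodicStationary μ ν ↔
    WalkStationary (fun (f : Diff2 M) (x : M) => f x) μ ν ∧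
      WalkErgodic (fun (f : Diff2 M) (x : M) => f x) μ ν :=
  ⟨fun h => ⟨isStationary_iff.1 h.stationary, h.ergodic⟩,
    fun h => ⟨inferInstance, isStationary_iff.2 h.1, h.2⟩⟩

variable [IsContMDiffRiemannianBundle (𝓡 2) ∞ Plane (fun x : M => TangentSpace (𝓡 2) x)]

/-- For an ergodic stationary measure on the sphere bundle with mean stretch `l`, the vectors that
almost surely grow at most at the rate `l` form a measurable invariant subbundle over the
projected measure, and `l` is the top exponent in it. -/
theorem exists_isTopExponentIn (hμ : HasLogMoment μ) {η : Measure (SphereBundle M)}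
    [IsProbabilityMeasure η] (hη : WalkStationary sphereAct μ η)
    (he : WalkErgodic sphereAct μ η) :
    IsErgodicStationary μ (η.map SphereBundle.base) ∧
      ∃ (k : ℕ) (V : (x : M) → Submodule ℝ (TangentSpace (𝓡 2) x)), 0 < k ∧
        IsMeasurableSubbundle (η.map SphereBundle.base) k V ∧
        IsInvariantSubbundle μ (η.map SphereBundle.base) V ∧
        IsTopExponentIn μ (η.map SphereBundle.base) V (∫ s, meanStretch μ s ∂η) := by
  have := secondCountableTopology_of_compact (M := M)
  have hbm := (SphereBundle.continuous_base (M := M)).measurable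
  have hpr : IsProbabilityMeasure (η.map SphereBundle.base) :=
    Measure.isProbabilityMeasure_map hbm.aemeasurable
  have hst := WalkStationary.map measurable_sphereAct measurable_diff2_apply hbm
    (fun f s => base_sphereAct f s) hη
  have her := WalkErgodic.map (actY := fun (f : Diff2 M) (x : M) => f x) hbm
    (fun f s => base_sphereAct f s) he
  refine ⟨isErgodicStationary_iff.2 ⟨hst, her⟩, ?_⟩
  set l := ∫ s, meanStretch μ s ∂η
  let V := asSlowSpace (M := M) μ l
  have hval : Measurable fun s : SphereBundle M => s.1 :=
    Continuous.measurable (α := SphereBundle M) continuous_sphereBundle_val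
  have hlim := tendsto_growthRate hμ hη he
  -- the vectors with exact rate `l` belong to `V`, which is therefore not zero
  have hVs : ∀ᵐ s ∂η, s.1.2 ∈ V s.1.1 := by
    have hms : MeasurableSet {p : (ℕ → Diff2 M) × SphereBundle M |
        p.2.1.2 ∈ slowSpace p.1 l p.2.1.1} :=
      (measurable_fst.prodMk (hval.comp measurable_snd))
        (measurableSet_slowSpace l)
    have h1 : ∀ᵐ p ∂((Measure.infinitePi fun _ : ℕ => μ).prod η),
        p.2.1.2 ∈ slowSpace p.1 l p.2.1.1 :=
      hlim.mono fun p hp => mem_slowSpace_of_tendsto p.2.vec_ne_zero hp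
    exact (Measure.ae_ae_comm hms).1 (Measure.ae_ae_of_ae_prod h1)
  have hVs' : ∀ᵐ p ∂((Measure.infinitePi fun _ : ℕ => μ).prod η), p.2.1.2 ∈ V p.2.1.1 :=
    Measure.quasiMeasurePreserving_snd.ae hVs
  have hex := ae_exists_of_ae_map SphereBundle.continuous_base (hlim.and hVs')
  have hne : ∀ᵐ x ∂(η.map SphereBundle.base), V x ≠ ⊥ := by
    obtain ⟨w, hw⟩ := (Measure.ae_ae_of_ae_prod hex).exists
    filter_upwards [hw] with x hx
    obtain ⟨s, rfl, -, hs⟩ := hx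
    exact fun h => s.vec_ne_zero ((Submodule.mem_bot ℝ).1 (h ▸ hs))
  obtain ⟨k, hk, hkV, hinv⟩ := exists_isMeasurableSubbundle hst her
    (measurableSet_asSlowSpace μ l) (fun x v hv => mfderiv_mem_asSlowSpace μ hv) hne
  refine ⟨k, V, hk, hkV, hinv, ?_⟩
  obtain ⟨σ, hσ, hσV⟩ := hkV
  -- a finite frame suffices to exchange the quantifiers over vectors and paths
  have hslow : ∀ i, ∀ᵐ p ∂((Measure.infinitePi fun _ : ℕ => μ).prod (η.map SphereBundle.base)),
      σ i p.2 ∈ slowSpace p.1 l p.2 := fun i => by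
    have hσi := hσ i
    rw [← BorelSpace.measurable_eq (α := M)] at hσi
    have hms : MeasurableSet {p : (ℕ → Diff2 M) × M | σ i p.2 ∈ slowSpace p.1 l p.2} :=
      (measurable_fst.prodMk (hσi.comp measurable_snd)) (measurableSet_slowSpace l)
    refine (Measure.ae_prod_iff_ae_ae hms).2 ((Measure.ae_ae_comm hms).2 ?_)
    filter_upwards [hσV] with x hx
    have h1 : σ i x ∈ V x := hx.2.le (Submodule.subset_span (mem_range_self i))
    exact h1
  have hσV' : ∀ᵐ p ∂((Measure.infinitePi fun _ : ℕ => μ).prod (η.map SphereBundle.base)),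
      Submodule.span ℝ (range fun i => σ i p.2) = V p.2 :=
    Measure.quasiMeasurePreserving_snd.ae (hσV.mono fun x hx => hx.2)
  filter_upwards [hex, ae_all_iff.2 hslow, hσV'] with p h1 h2 h3
  refine ⟨?_, fun v hv hv0 => (upperRate_le_iff p.1 hv0 l).2 ?_⟩
  · obtain ⟨w, x⟩ := p
    obtain ⟨s, rfl, hs1, hs2⟩ := h1
    exact ⟨s.1.2, hs2, s.vec_ne_zero, hs1⟩
  · have hle : V p.2 ≤ slowSpace p.1 l p.2 := by
      refine h3.ge.trans (Submodule.span_le.2 ?_)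
      rintro _ ⟨i, rfl⟩
      exact h2 i
    exact hle hv

/-- Without uniform expansion there are unit vectors whose mean growth over arbitrarily long times
is at most `1`; the averages of the laws of the random walk started there accumulate at a
stationary measure with nonpositive mean stretch. -/
lemma exists_walkErgodic_meanStretch_nonpos (hμ : HasLogMoment μ) (h : ¬ UniformlyExpanding μ) :
    ∃ η : Measure (SphereBundle M), IsProbabilityMeasure η ∧ WalkStationary sphereAct μ η ∧
      WalkErgodic sphereAct μ η ∧ ∫ s, meanStretch μ s ∂η ≤ 0 := by
  have := secondCountableTopology_of_compact (M := M)
  have hs : ∀ N : ℕ, ∃ s : SphereBundle M, ∑ k ∈ Finset.range (N + 1),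
      ∫ s', meanStretch μ s' ∂((walkStep sphereAct μ)^[k] (Measure.dirac s)) ≤ 1 := fun N => by
    by_contra hN
    push Not at hN
    refine h ⟨1, one_pos, N + 1, fun x v hv => ?_⟩
    have h1 := hN (unitVec x v hv)
    rw [← (integrable_stretch_convPow_and_integral_eq hμ _ _).2] at h1
    simpa only [stretch_unitVec] using h1
  choose s hs using hs
  exact exists_walkErgodic_integral_nonpos measurable_sphereAct
    (fun f => continuous_sphereAct.comp (continuous_const.prodMk continuous_id))
    (continuous_meanStretch hμ) (fun N => Measure.dirac (s N)) hs

end NonExpanding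

/-! ### Area distortion of measure-preserving diffeomorphisms -/

section AreaSq

variable {E : Type*} [NormedAddCommGroup E] [InnerProductSpace ℝ E]

/-- The squared area of the parallelogram spanned by two vectors, their Gram determinant. -/
noncomputable def areaSq (a b : E) : ℝ := ‖a‖ ^ 2 * ‖b‖ ^ 2 - inner ℝ a b ^ 2

lemma areaSq_nonneg (a b : E) : 0 ≤ areaSq a b := by
  have h := abs_real_inner_le_norm a b
  have h2 := sq_le_sq' (by linarith [neg_abs_le (inner ℝ a b), abs_nonneg (inner ℝ a b)])
    ((le_abs_self _).trans h)
  rw [areaSq]; nlinarith [h2]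

lemma areaSq_combination (a b : E) (p q r s : ℝ) :
    areaSq (p • a + q • b) (r • a + s • b) = (p * s - r * q) ^ 2 * areaSq a b := by
  simp only [areaSq, ← real_inner_self_eq_norm_sq, inner_add_left, inner_add_right,
    real_inner_smul_left, real_inner_smul_right, real_inner_comm a b]
  ring

/-- Polarization expresses the Gram determinant through norms only. -/
lemma areaSq_eq_norm (a b : E) :
    areaSq a b = ‖a‖ ^ 2 * ‖b‖ ^ 2 - ((‖a + b‖ ^ 2 - ‖a - b‖ ^ 2) / 4) ^ 2 := by
  rw [areaSq, norm_add_sq_real, norm_sub_sq_real]; ring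

lemma det_plane (L : Plane →L[ℝ] Plane) : L.det =
    L (EuclideanSpace.single 0 1) 0 * L (EuclideanSpace.single 1 1) 1
      - L (EuclideanSpace.single 1 1) 0 * L (EuclideanSpace.single 0 1) 1 := by
  rw [ContinuousLinearMap.det,
    ← LinearMap.det_toMatrix (EuclideanSpace.basisFun (Fin 2) ℝ).toBasis, Matrix.det_fin_two]
  simp [LinearMap.toMatrix_apply]

lemma apply_eq_frame (T : Plane →ₗ[ℝ] E) (u : Plane) :
    T u = u 0 • T (EuclideanSpace.single 0 1) + u 1 • T (EuclideanSpace.single 1 1) := by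
  rw [← map_smul, ← map_smul, ← map_add]
  congr 1
  ext i
  fin_cases i <;> simp

lemma areaSq_comp (L : Plane →L[ℝ] Plane) (T : Plane →ₗ[ℝ] E) :
    areaSq (T (L (EuclideanSpace.single 0 1))) (T (L (EuclideanSpace.single 1 1)))
      = L.det ^ 2 * areaSq (T (EuclideanSpace.single 0 1)) (T (EuclideanSpace.single 1 1)) := by
  rw [apply_eq_frame T (L (EuclideanSpace.single 0 1)),
    apply_eq_frame T (L (EuclideanSpace.single 1 1)), areaSq_combination, det_plane]

end AreaSq

section Jacobian

variable {M : Type*} [TopologicalSpace M] [ChartedSpace Plane M] [IsManifold (𝓡 2) ∞ M]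
  [RiemannianBundle (fun x : M => TangentSpace (𝓡 2) x)]

/-- The squared area element of a parametrization `g` of a surface. -/
noncomputable def areaElementSq (g : Plane → M) (u : Plane) : ℝ :=
  areaSq (E := TangentSpace (𝓡 2) (g u))
    (mfderiv 𝓘(ℝ, Plane) (𝓡 2) g u (EuclideanSpace.single 0 (1 : ℝ) : Plane))
    (mfderiv 𝓘(ℝ, Plane) (𝓡 2) g u (EuclideanSpace.single 1 (1 : ℝ) : Plane))

/-- The base point `g u` enters the type of the derivative, so that equality of the germs is used
through heterogeneous equality. -/
lemma areaElementSq_congr {g₁ g₂ : Plane → M} {u : Plane} (h : g₁ =ᶠ[𝓝 u] g₂) :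
    areaElementSq g₁ u = areaElementSq g₂ u := by
  have key : ∀ (y : M) (T : Plane →L[ℝ] TangentSpace (𝓡 2) y), g₁ u = y →
      HEq (mfderiv 𝓘(ℝ, Plane) (𝓡 2) g₁ u) T →
      areaElementSq g₁ u = areaSq (E := TangentSpace (𝓡 2) y) (T (EuclideanSpace.single 0 (1 : ℝ)))
        (T (EuclideanSpace.single 1 (1 : ℝ))) := by
    rintro y T rfl hT
    obtain rfl := eq_of_heq hT
    rfl
  exact key _ _ h.eq_of_nhds (heq_of_eq h.mfderiv_eq)

lemma det_gramMatrix (p : M) (u : Plane) :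
    (gramMatrix p u).det = areaElementSq (chartAt Plane p).symm u := by
  rw [Matrix.det_fin_two, areaElementSq, areaSq, ← real_inner_self_eq_norm_sq,
    ← real_inner_self_eq_norm_sq]
  have h : gramMatrix p u 1 0 = gramMatrix p u 0 1 :=
    real_inner_comm (coordVector p 0 u) (coordVector p 1 u)
  rw [h, sq]
  rfl

/-- Change of variables for the squared area element. -/
lemma areaElementSq_comp {g : Plane → M} {h : Plane → Plane} {u : Plane}
    (hg : MDifferentiableAt 𝓘(ℝ, Plane) (𝓡 2) g (h u)) (hh : DifferentiableAt ℝ h u) :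
    areaElementSq (g ∘ h) u = (fderiv ℝ h u).det ^ 2 * areaElementSq g (h u) := by
  have h1 : mfderiv 𝓘(ℝ, Plane) (𝓡 2) (g ∘ h) u
      = (mfderiv 𝓘(ℝ, Plane) (𝓡 2) g (h u)).comp (mfderiv 𝓘(ℝ, Plane) 𝓘(ℝ, Plane) h u) :=
    mfderiv_comp u hg hh.mdifferentiableAt
  rw [mfderiv_eq_fderiv] at h1
  have key : ∀ (y : M) (L : Plane →L[ℝ] Plane) (S T : Plane →L[ℝ] TangentSpace (𝓡 2) y),
      S = T.comp L → areaSq (E := TangentSpace (𝓡 2) y) (S (EuclideanSpace.single 0 (1 : ℝ)))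
        (S (EuclideanSpace.single 1 (1 : ℝ))) = L.det ^ 2 *
        areaSq (E := TangentSpace (𝓡 2) y) (T (EuclideanSpace.single 0 (1 : ℝ)))
        (T (EuclideanSpace.single 1 (1 : ℝ))) := by
    rintro y L S T rfl
    exact areaSq_comp L (T : Plane →ₗ[ℝ] TangentSpace (𝓡 2) y)
  exact key (g (h u)) (fderiv ℝ h u) _ _ h1

lemma isManifold_one : IsManifold (𝓡 2) 1 M := IsManifold.of_le (n := ∞) (by norm_num)

lemma mdifferentiableAt_chart_symm (p : M) {u : Plane} (hu : u ∈ (chartAt Plane p).target) :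
    MDifferentiableAt 𝓘(ℝ, Plane) (𝓡 2) (chartAt Plane p).symm u := by
  have := isManifold_one (M := M)
  exact mdifferentiableAt_atlas_symm (I := 𝓡 2) (chart_mem_atlas Plane p) hu

lemma mdifferentiableAt_chart (p : M) {x : M} (hx : x ∈ (chartAt Plane p).source) :
    MDifferentiableAt (𝓡 2) 𝓘(ℝ, Plane) (chartAt Plane p) x := by
  have := isManifold_one (M := M)
  exact mdifferentiableAt_atlas (I := 𝓡 2) (chart_mem_atlas Plane p) hx

lemma measurableSet_inter_preimage {X Y : Type*} [TopologicalSpace X] [MeasurableSpace X]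
    [BorelSpace X] [TopologicalSpace Y] [MeasurableSpace Y] [BorelSpace Y] {g : X → Y}
    {s : Set X} (hs : MeasurableSet s) (hg : ContinuousOn g s) {B : Set Y}
    (hB : MeasurableSet B) : MeasurableSet (s ∩ g ⁻¹' B) := by
  have h1 : Measurable (s.domRestrict g) := (continuousOn_iff_continuous_domRestrict.1 hg).measurable
  have h2 := hs.subtype_image (h1 hB)
  convert h2 using 1
  ext x
  exact ⟨fun h => ⟨⟨x, h.1⟩, h.2, rfl⟩, by rintro ⟨y, hy, rfl⟩; exact ⟨y.2, hy⟩⟩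

variable [MeasurableSpace M] [BorelSpace M]

/-- The area measure of a chart, in coordinates. It is defined as an image measure under the inverse
of the chart, which is a total function with arbitrary values off the target of the chart; being
continuous on the target, it is almost everywhere measurable for the restricted measure. -/
lemma chartVolume_image_symm (q : M) {U : Set Plane} (hU : U ⊆ (chartAt Plane q).target)
    (hUm : MeasurableSet U) : chartVolume q ((chartAt Plane q).symm '' U)
      = ∫⁻ u in U, ENNReal.ofReal √(areaElementSq (chartAt Plane q).symm u) := by
  set e := chartAt Plane q
  have hT : MeasurableSet e.target := e.open_target.measurableSet
  have hA : MeasurableSet (e.symm '' U) := by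
    rw [e.symm_image_eq_source_inter_preimage hU]
    exact measurableSet_inter_preimage e.open_source.measurableSet e.continuousOn hUm
  have hae : AEMeasurable e.symm ((volume.restrict e.target).withDensity
      fun u => ENNReal.ofReal √(gramMatrix q u).det) :=
    (e.continuousOn_symm.aemeasurable hT).mono_ac (withDensity_absolutelyContinuous _ _)
  rw [chartVolume, Measure.map_apply_of_aemeasurable hae hA, withDensity_apply' _ _,
    Measure.restrict_restrict']
  swap; · exact hT
  have hset : e.symm ⁻¹' (e.symm '' U) ∩ e.target = U := by
    ext u
    constructor
    · rintro ⟨⟨u', hu', h⟩, hu⟩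
      rwa [← e.symm.injOn (hU hu') hu h]
    · exact fun hu => ⟨⟨u, hu, rfl⟩, hU hu⟩
  rw [hset]
  simp only [det_gramMatrix]
  rfl

lemma chartVolume_compl_source (q : M) : chartVolume q (chartAt Plane q).sourceᶜ = 0 := by
  set e := chartAt Plane q
  have hT : MeasurableSet e.target := e.open_target.measurableSet
  have hae : AEMeasurable e.symm ((volume.restrict e.target).withDensity
      fun u => ENNReal.ofReal √(gramMatrix q u).det) :=
    (e.continuousOn_symm.aemeasurable hT).mono_ac (withDensity_absolutelyContinuous _ _)
  rw [chartVolume, Measure.map_apply_of_aemeasurable hae e.open_source.measurableSet.compl]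
  refine withDensity_absolutelyContinuous _ _ ?_
  rw [Measure.restrict_apply' hT]
  convert measure_empty (μ := (volume : Measure Plane))
  rw [eq_empty_iff_forall_notMem]
  rintro u ⟨h1, h2⟩
  exact h1 (e.map_target h2)

/-- The area of the image of a coordinate domain under a diffeomorphism, computed in a chart of
the target, is the integral of the area element of the induced parametrization. -/
lemma chartVolume_image (f : Diff2 M) (p q : M) {U : Set Plane}
    (hU : U ⊆ (chartAt Plane p).target) (hUm : MeasurableSet U)
    (hf : ∀ u ∈ U, f ((chartAt Plane p).symm u) ∈ (chartAt Plane q).source) :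
    chartVolume q ((f ∘ (chartAt Plane p).symm) '' U)
      = ∫⁻ u in U, ENNReal.ofReal √(areaElementSq (f ∘ (chartAt Plane p).symm) u) := by
  set e := chartAt Plane p
  set e' := chartAt Plane q
  let h : Plane → Plane := e' ∘ f ∘ e.symm
  have hfe : ContinuousOn (f ∘ e.symm) e.target := f.continuous.comp_continuousOn e.continuousOn_symm
  have hO : IsOpen (e.target ∩ (f ∘ e.symm) ⁻¹' e'.source) :=
    hfe.isOpen_inter_preimage e.open_target e'.open_source
  have hh : ∀ u ∈ U, DifferentiableAt ℝ h u := fun u hu => by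
    have h1 : MDifferentiableAt 𝓘(ℝ, Plane) 𝓘(ℝ, Plane) h u :=
      (mdifferentiableAt_chart q (hf u hu)).comp u
        ((mdifferentiable_diff2 f _).comp u (mdifferentiableAt_chart_symm p (hU hu)))
    exact mdifferentiableAt_iff_differentiableAt.1 h1
  have himg : (f ∘ e.symm) '' U = e'.symm '' (h '' U) := by
    rw [← image_comp]
    refine image_congr fun u hu => ?_
    exact (e'.left_inv (hf u hu)).symm
  have hinj : InjOn h U := fun u hu v hv huv =>
    e.symm.injOn (hU hu) (hU hv) (f.injective (e'.injOn (hf u hu) (hf v hv) huv))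
  have hhU : h '' U ⊆ e'.target := by
    rintro _ ⟨u, hu, rfl⟩
    exact e'.map_source (hf u hu)
  have hhUm : MeasurableSet (h '' U) :=
    measurable_image_of_fderivWithin hUm
      (fun u hu => (hh u hu).hasFDerivAt.hasFDerivWithinAt) hinj
  rw [himg, chartVolume_image_symm q hhU hhUm, lintegral_image_eq_lintegral_abs_det_fderiv_mul
    volume hUm (fun u hu => (hh u hu).hasFDerivAt.hasFDerivWithinAt) hinj]
  refine setLIntegral_congr_fun hUm fun u hu => ?_
  have heq : f ∘ e.symm =ᶠ[𝓝 u] e'.symm ∘ h := by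
    filter_upwards [hO.mem_nhds ⟨hU hu, hf u hu⟩] with v hv
    exact (e'.left_inv hv.2).symm
  rw [areaElementSq_congr heq, areaElementSq_comp
    (mdifferentiableAt_chart_symm q (hhU (mem_image_of_mem h hu))) (hh u hu),
    Real.sqrt_mul (sq_nonneg _), Real.sqrt_sq_eq_abs, ENNReal.ofReal_mul (abs_nonneg _)]

end Jacobian

/-- A bound for the area distortion of one parallelogram holds for all of them. -/
lemma areaSq_le_of_frame {E E' : Type*} [NormedAddCommGroup E] [InnerProductSpace ℝ E]
    [NormedAddCommGroup E'] [InnerProductSpace ℝ E'] (T : Plane →ₗ[ℝ] E) (D : E →ₗ[ℝ] E') {K : ℝ}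
    (h : areaSq (D (T (EuclideanSpace.single 0 1))) (D (T (EuclideanSpace.single 1 1)))
      ≤ K * areaSq (T (EuclideanSpace.single 0 1)) (T (EuclideanSpace.single 1 1)))
    (a b : Plane) : areaSq (D (T a)) (D (T b)) ≤ K * areaSq (T a) (T b) := by
  rw [apply_eq_frame T a, apply_eq_frame T b]
  simp only [map_add, map_smul]
  rw [areaSq_combination, areaSq_combination, mul_left_comm]
  exact mul_le_mul_of_nonneg_left h (sq_nonneg _)

section AreaDistortion

variable {M : Type*} [TopologicalSpace M] [ChartedSpace Plane M] [IsManifold (𝓡 2) ∞ M]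
  [RiemannianBundle (fun x : M => TangentSpace (𝓡 2) x)]

section Volume

variable [MeasurableSpace M] [BorelSpace M]

/-- The area measures of two charts agree on the overlap, so that on the domain of the first chart
the second measure is at most the first. -/
lemma chartVolume_le (p q : M) {A : Set M} (hA : MeasurableSet A)
    (hAp : A ⊆ (chartAt Plane p).source) : chartVolume q A ≤ chartVolume p A := by
  set e := chartAt Plane p
  set e' := chartAt Plane q
  let B := A ∩ e'.source
  have hB : MeasurableSet B := hA.inter e'.open_source.measurableSet
  let U := e.target ∩ e.symm ⁻¹' B
  have hU : MeasurableSet U :=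
    measurableSet_inter_preimage e.open_target.measurableSet e.continuousOn_symm hB
  have hUB : e.symm '' U = B := by
    ext x
    constructor
    · rintro ⟨u, hu, rfl⟩; exact hu.2
    · intro hx
      have h1 := e.left_inv (hAp hx.1)
      exact ⟨e x, ⟨e.map_source (hAp hx.1), by rw [mem_preimage, h1]; exact hx⟩, h1⟩
  have h1 := chartVolume_image (Diffeomorph.refl (𝓡 2) M 2) p q inter_subset_left hU
    fun u hu => hu.2.2
  have h2 := chartVolume_image_symm p inter_subset_left hU
  have h3 : chartVolume q (e.symm '' U) = chartVolume p (e.symm '' U) := h1.trans h2.symm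
  rw [hUB] at h3
  calc chartVolume q A ≤ chartVolume q (B ∪ e'.sourceᶜ) := measure_mono fun x hx => by
        by_cases h : x ∈ e'.source
        · exact Or.inl ⟨hx, h⟩
        · exact Or.inr h
    _ ≤ chartVolume q B + chartVolume q e'.sourceᶜ := measure_union_le _ _
    _ = chartVolume p B := by rw [chartVolume_compl_source, add_zero, h3]
    _ ≤ chartVolume p A := measure_mono inter_subset_left

/-- On the domain of a chart, the Riemannian volume is at most the area measure of the chart, as is
the area measure of any other chart. -/
lemma riemannianVolume_le (p : M) {A : Set M} (hA : MeasurableSet A)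
    (hAp : A ⊆ (chartAt Plane p).source) : riemannianVolume M A ≤ chartVolume p A := by
  have hS := (chartAt Plane p).open_source.measurableSet
  -- the supremum of measures is bounded by any common upper bound, and off the chart domain the
  -- bound may be as large as possible
  have hle : riemannianVolume M
      ≤ chartVolume p + (⊤ : Measure M).restrict (chartAt Plane p).sourceᶜ := by
    refine iSup_le fun q => Measure.le_iff.2 fun B hB => ?_
    rw [Measure.add_apply, Measure.restrict_apply hB, ← measure_inter_add_sdiff B hS]
    refine add_le_add ?_ ?_
    · exact (chartVolume_le p q (hB.inter hS) inter_subset_right).trans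
        (measure_mono inter_subset_left)
    · exact (le_top : chartVolume q ≤ ⊤) _
  refine (hle A).trans_eq ?_
  rw [Measure.add_apply, Measure.restrict_apply hA]
  have h0 : A ∩ (chartAt Plane p).sourceᶜ = ∅ := by
    rw [← sdiff_eq, sdiff_eq_empty]; exact hAp
  rw [h0, measure_empty, add_zero]

end Volume

variable [IsContMDiffRiemannianBundle (𝓡 2) ∞ Plane (fun x : M => TangentSpace (𝓡 2) x)]

lemma continuousOn_areaElementSq (f : Diff2 M) (p : M) :
    ContinuousOn (areaElementSq (f ∘ (chartAt Plane p).symm)) (chartAt Plane p).target := by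
  have := isManifold_one (M := M)
  set e := chartAt Plane p
  -- by polarization, only norms of images of fixed coordinate vectors are involved
  have hnorm : ∀ v : Plane, ContinuousOn (fun u =>
      ‖mfderiv (𝓡 2) (𝓡 2) f (e.symm u) (mfderiv 𝓘(ℝ, Plane) (𝓡 2) e.symm u v)‖) e.target := by
    intro v
    have h1 : ContinuousOn (tangentMapWithin 𝓘(ℝ, Plane) (𝓡 2) e.symm e.target)
        (TotalSpace.proj ⁻¹' e.target) :=
      (contMDiffOn_chart_symm (I := 𝓡 2) (n := 1)).continuousOn_tangentMapWithin le_rfl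
        e.open_target.uniqueMDiffOn
    have h2 : Continuous fun u : Plane => (⟨u, v⟩ : TangentBundle 𝓘(ℝ, Plane) Plane) :=
      (tangentBundleModelSpaceHomeomorph 𝓘(ℝ, Plane)).symm.continuous.comp
        (continuous_id.prodMk continuous_const)
    have h3 : ContinuousOn (fun u => tangentMapWithin 𝓘(ℝ, Plane) (𝓡 2) e.symm e.target ⟨u, v⟩)
        e.target := h1.comp h2.continuousOn fun u hu => hu
    have h4 : Continuous fun p : TangentBundle (𝓡 2) M => tangentMap (𝓡 2) (𝓡 2) f p :=
      continuous_tangentMap_diff2.comp (continuous_const.prodMk continuous_id)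
    have h5 := (continuous_norm_tangentBundle (M := M)).comp_continuousOn (h4.comp_continuousOn h3)
    refine h5.congr fun u hu => ?_
    change _ = ‖mfderiv (𝓡 2) (𝓡 2) f (e.symm u)
      (mfderivWithin 𝓘(ℝ, Plane) (𝓡 2) e.symm e.target u v)‖
    rw [mfderivWithin_of_isOpen e.open_target hu]
  let nrm : Plane → Plane → ℝ := fun v u =>
    ‖mfderiv (𝓡 2) (𝓡 2) f (e.symm u) (mfderiv 𝓘(ℝ, Plane) (𝓡 2) e.symm u v)‖
  let e₀ : Plane := EuclideanSpace.single 0 (1 : ℝ)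
  let e₁ : Plane := EuclideanSpace.single 1 (1 : ℝ)
  have hform : ContinuousOn (fun u => nrm e₀ u ^ 2 * nrm e₁ u ^ 2
      - ((nrm (e₀ + e₁) u ^ 2 - nrm (e₀ - e₁) u ^ 2) / 4) ^ 2) e.target :=
    (((hnorm e₀).pow 2).mul ((hnorm e₁).pow 2)).sub
      (((((hnorm (e₀ + e₁)).pow 2).sub ((hnorm (e₀ - e₁)).pow 2)).div_const 4).pow 2)
  refine hform.congr fun u hu => ?_
  have hcomp : mfderiv 𝓘(ℝ, Plane) (𝓡 2) (f ∘ e.symm) u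
      = (mfderiv (𝓡 2) (𝓡 2) f (e.symm u)).comp (mfderiv 𝓘(ℝ, Plane) (𝓡 2) e.symm u) :=
    mfderiv_comp u (mdifferentiable_diff2 f _) (mdifferentiableAt_chart_symm p hu)
  have key : ∀ (y : M) (S : Plane →L[ℝ] TangentSpace (𝓡 2) y),
      areaSq (E := TangentSpace (𝓡 2) y) (S e₀) (S e₁) = ‖S e₀‖ ^ 2 * ‖S e₁‖ ^ 2
      - ((‖S (e₀ + e₁)‖ ^ 2 - ‖S (e₀ - e₁)‖ ^ 2) / 4) ^ 2 := fun y S => by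
    rw [areaSq_eq_norm, map_add, map_sub]
  exact (key _ (mfderiv 𝓘(ℝ, Plane) (𝓡 2) (f ∘ e.symm) u)).trans (by rw [hcomp]; rfl)

variable [MeasurableSpace M] [BorelSpace M]

/-- A diffeomorphism that preserves a smooth measure has bounded area distortion, with a bound
that depends on the measure only: a larger distortion at a point would occur on a small ball,
whose volume would change too much. -/
lemma areaElementSq_le {m : Measure M} {c : ℝ≥0} (hc : 0 < c)
    (hm1 : c • riemannianVolume M ≤ m) (hm2 : m ≤ c⁻¹ • riemannianVolume M) {f : Diff2 M}
    (hf : m.map f = m) (p : M) {u : Plane} (hu : u ∈ (chartAt Plane p).target) :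
    √(areaElementSq (f ∘ (chartAt Plane p).symm) u)
      ≤ (c : ℝ)⁻¹ ^ 2 * √(areaElementSq (chartAt Plane p).symm u) := by
  set e := chartAt Plane p
  have hc' : (0 : ℝ) < c := hc
  by_contra hlt
  push Not at hlt
  obtain ⟨t, ht1, ht2⟩ := exists_between hlt
  obtain ⟨r, hr1, hr2⟩ := exists_between ht1
  have hr0 : 0 ≤ r := le_trans (by positivity) hr1.le
  let q := f (e.symm u)
  have hI : ContinuousOn (fun u => √(areaElementSq (f ∘ e.symm) u)) e.target :=
    (continuousOn_areaElementSq f p).sqrt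
  have hI₀ : ContinuousOn (fun u => (c : ℝ)⁻¹ ^ 2 * √(areaElementSq e.symm u)) e.target :=
    ((continuousOn_areaElementSq (Diffeomorph.refl (𝓡 2) M 2) p).sqrt).const_smul ((c : ℝ)⁻¹ ^ 2)
  have hfe : ContinuousOn (f ∘ e.symm) e.target := f.continuous.comp_continuousOn e.continuousOn_symm
  have hn : e.target ∈ 𝓝 u := e.open_target.mem_nhds hu
  have hev : ∀ᶠ v in 𝓝 u, v ∈ e.target ∧ f (e.symm v) ∈ (chartAt Plane q).source ∧
      t < √(areaElementSq (f ∘ e.symm) v) ∧ (c : ℝ)⁻¹ ^ 2 * √(areaElementSq e.symm v) < r := by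
    filter_upwards [hn, (hfe.continuousAt hn).eventually
      ((chartAt Plane q).open_source.mem_nhds (mem_chart_source Plane q)),
      (hI.continuousAt hn).eventually (lt_mem_nhds ht2),
      (hI₀.continuousAt hn).eventually (gt_mem_nhds hr1)] with v h1 h2 h3 h4 using ⟨h1, h2, h3, h4⟩
  obtain ⟨ε, hε, hball⟩ := Metric.eventually_nhds_iff_ball.1 hev
  let U : Set Plane := Metric.ball u ε
  have hUm : MeasurableSet U := measurableSet_ball
  have hUT : U ⊆ e.target := fun v hv => (hball v hv).1
  let A : Set M := e.symm '' U
  have hA : IsOpen A := e.symm.isOpen_image_of_subset_source Metric.isOpen_ball hUT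
  have hfA : IsOpen (f '' A) := f.toHomeomorph.isOpenMap A hA
  have hmA : m (f '' A) = m A := by
    conv_lhs => rw [← hf]
    rw [Measure.map_apply f.continuous.measurable hfA.measurableSet]
    congr 1
    exact f.injective.preimage_image A
  have hAs : A ⊆ e.source := by
    rintro _ ⟨v, hv, rfl⟩; exact e.map_target (hUT hv)
  have h1 : (c : ℝ≥0∞) * (ENNReal.ofReal t * volume U) ≤ m A := by
    calc (c : ℝ≥0∞) * (ENNReal.ofReal t * volume U)
        ≤ c * ∫⁻ v in U, ENNReal.ofReal √(areaElementSq (f ∘ e.symm) v) := by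
          gcongr
          rw [← setLIntegral_const]
          exact setLIntegral_mono' hUm fun v hv => ENNReal.ofReal_le_ofReal (hball v hv).2.2.1.le
      _ = c * chartVolume q (f '' A) := by
          rw [← chartVolume_image f p q hUT hUm fun v hv => (hball v hv).2.1, image_comp]
      _ ≤ c * riemannianVolume M (f '' A) := by
          exact mul_le_mul' le_rfl (le_iSup (fun q : M => chartVolume q) q _)
      _ ≤ m (f '' A) := hm1 _
      _ = m A := hmA
  have h2 : m A ≤ (c⁻¹ : ℝ≥0) * (ENNReal.ofReal ((c : ℝ) ^ 2 * r) * volume U) := by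
    calc m A ≤ (c⁻¹ : ℝ≥0) * riemannianVolume M A := hm2 A
      _ ≤ (c⁻¹ : ℝ≥0) * chartVolume p A := by
          exact mul_le_mul' le_rfl (riemannianVolume_le p hA.measurableSet hAs)
      _ = (c⁻¹ : ℝ≥0) * ∫⁻ v in U, ENNReal.ofReal √(areaElementSq e.symm v) := by
          rw [← chartVolume_image_symm p hUT hUm]
      _ ≤ (c⁻¹ : ℝ≥0) * (ENNReal.ofReal ((c : ℝ) ^ 2 * r) * volume U) := by
          gcongr
          rw [← setLIntegral_const]
          refine setLIntegral_mono' hUm fun v hv => ENNReal.ofReal_le_ofReal ?_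
          have h3 := (hball v hv).2.2.2.le
          rwa [inv_pow, inv_mul_le_iff₀ (by positivity)] at h3
  have h3 : (c : ℝ≥0∞) * (ENNReal.ofReal t * volume U)
      ≤ (c : ℝ≥0∞) * (ENNReal.ofReal r * volume U) := by
    refine (h1.trans h2).trans_eq ?_
    rw [← mul_assoc, ← mul_assoc]
    congr 1
    rw [← ENNReal.ofReal_coe_nnreal, ← ENNReal.ofReal_coe_nnreal,
      ← ENNReal.ofReal_mul (by positivity), ← ENNReal.ofReal_mul (by positivity)]
    congr 1
    push_cast
    field_simp
  have hv0 : volume U ≠ 0 := (Metric.measure_ball_pos volume u hε).ne'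
  have hvt : volume U ≠ ⊤ := measure_ball_lt_top.ne
  have h4 : ENNReal.ofReal t ≤ ENNReal.ofReal r := by
    have h5 := (ENNReal.mul_le_mul_iff_right (by exact_mod_cast hc.ne') ENNReal.coe_ne_top).1 h3
    exact (ENNReal.mul_le_mul_iff_left hv0 hvt).1 h5
  exact absurd ((ENNReal.ofReal_le_ofReal_iff hr0).1 h4) (not_le.2 hr2)

lemma surjective_mfderiv_chart_symm (p : M) {u : Plane} (hu : u ∈ (chartAt Plane p).target) :
    Function.Surjective (mfderiv 𝓘(ℝ, Plane) (𝓡 2) (chartAt Plane p).symm u) := by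
  have hmd : OpenPartialHomeomorph.MDifferentiable (𝓡 2) 𝓘(ℝ, Plane) (chartAt Plane p) := by
    have := isManifold_one (M := M)
    exact mdifferentiable_chart (I := 𝓡 2) p
  have h5 := hmd.comp_symm_deriv hu
  have hinv : Function.Injective (mfderiv 𝓘(ℝ, Plane) (𝓡 2) (chartAt Plane p).symm u) :=
    Function.LeftInverse.injective (g := mfderiv (𝓡 2) 𝓘(ℝ, Plane) (chartAt Plane p)
      ((chartAt Plane p).symm u)) fun a => DFunLike.congr_fun h5 a
  have hfin := finiteDimensional_tangentSpace ((chartAt Plane p).symm u)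
  exact (LinearMap.injective_iff_surjective_of_finrank_eq_finrank
    (V := Plane) (V₂ := TangentSpace (𝓡 2) ((chartAt Plane p).symm u))
    (finrank_euclideanSpace_fin.trans (finrank_tangentSpace _).symm)
    (f := (mfderiv 𝓘(ℝ, Plane) (𝓡 2) (chartAt Plane p).symm u).toLinearMap)).1 hinv

lemma areaSq_mfderiv_le {m : Measure M} {c : ℝ≥0} (hc : 0 < c)
    (hm1 : c • riemannianVolume M ≤ m) (hm2 : m ≤ c⁻¹ • riemannianVolume M) {f : Diff2 M}
    (hf : m.map f = m) (p : M) {u : Plane} (hu : u ∈ (chartAt Plane p).target)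
    (v w : TangentSpace (𝓡 2) ((chartAt Plane p).symm u)) :
    areaSq (mfderiv (𝓡 2) (𝓡 2) f ((chartAt Plane p).symm u) v)
      (mfderiv (𝓡 2) (𝓡 2) f ((chartAt Plane p).symm u) w)
      ≤ ((c : ℝ)⁻¹ ^ 2) ^ 2 * areaSq v w := by
  obtain ⟨a, rfl⟩ := surjective_mfderiv_chart_symm p hu v
  obtain ⟨b, rfl⟩ := surjective_mfderiv_chart_symm p hu w
  have h1 := areaElementSq_le hc hm1 hm2 hf p hu
  set e := chartAt Plane p
  have h2 : areaElementSq (f ∘ e.symm) u ≤ ((c : ℝ)⁻¹ ^ 2) ^ 2 * areaElementSq e.symm u := by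
    have h3 : 0 ≤ areaElementSq (f ∘ e.symm) u := areaSq_nonneg _ _
    have h4 : 0 ≤ areaElementSq e.symm u := areaSq_nonneg _ _
    rw [← Real.sq_sqrt h3, ← Real.sq_sqrt h4, ← mul_pow]
    exact pow_le_pow_left₀ (Real.sqrt_nonneg _) h1 2
  have hcomp : mfderiv 𝓘(ℝ, Plane) (𝓡 2) (f ∘ e.symm) u
      = (mfderiv (𝓡 2) (𝓡 2) f (e.symm u)).comp (mfderiv 𝓘(ℝ, Plane) (𝓡 2) e.symm u) :=
    mfderiv_comp _ (mdifferentiable_diff2 f _) (mdifferentiableAt_chart_symm p hu)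
  rw [areaElementSq, hcomp] at h2
  exact areaSq_le_of_frame (mfderiv 𝓘(ℝ, Plane) (𝓡 2) e.symm u).toLinearMap
    (mfderiv (𝓡 2) (𝓡 2) f (e.symm u)).toLinearMap h2 a b

/-- The derivative of a diffeomorphism that preserves a smooth measure expands areas at most by a
factor that depends on the measure only. -/
lemma exists_areaSq_mfderiv_le {m : Measure M} (hm : IsSmoothMeasure m) :
    ∃ K : ℝ, 0 < K ∧ ∀ f : Diff2 M, m.map f = m → ∀ (x : M) (v w : TangentSpace (𝓡 2) x),
      areaSq (mfderiv (𝓡 2) (𝓡 2) f x v) (mfderiv (𝓡 2) (𝓡 2) f x w) ≤ K * areaSq v w := by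
  obtain ⟨-, c, hc, hm1, hm2⟩ := hm
  have hc' : (0 : ℝ) < c := hc
  refine ⟨((c : ℝ)⁻¹ ^ 2) ^ 2, by positivity, fun f hf x => ?_⟩
  have hx := mem_chart_source Plane x
  have h1 := areaSq_mfderiv_le hc hm1 hm2 hf x ((chartAt Plane x).map_source hx)
  -- the derivative is taken at `e.symm (e x)`, which equals `x` only propositionally
  generalize ((c : ℝ)⁻¹ ^ 2) ^ 2 = K at h1 ⊢
  generalize hy : (chartAt Plane x).symm (chartAt Plane x x) = y at h1
  obtain rfl : y = x := hy.symm.trans ((chartAt Plane x).left_inv hx)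
  exact h1

end AreaDistortion

/-! ### The stable direction of area-bounded products -/

lemma ExpBound.mul {a b : ℕ → ℝ} {l l' : ℝ} (ha : ExpBound a l) (hb : ExpBound b l')
    (hb0 : ∀ n, 0 ≤ b n) : ExpBound (fun n => a n * b n) (l + l') := by
  intro ε hε
  filter_upwards [ha (ε / 2) (half_pos hε), hb (ε / 2) (half_pos hε)] with n h1 h2
  calc a n * b n ≤ Real.exp ((l + ε / 2) * n) * Real.exp ((l' + ε / 2) * n) :=
        mul_le_mul h1 h2 (hb0 n) (Real.exp_pos _).le
    _ = Real.exp ((l + l' + ε) * n) := by rw [← Real.exp_add]; congr 1; ring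

/-- A sequence with exponentially small increments converges, exponentially fast. -/
lemma exists_tendsto_expBound {a : ℕ → ℝ} {l : ℝ} (hl : l < 0)
    (h : ExpBound (fun n => |a (n + 1) - a n|) l) :
    ∃ b, Tendsto a atTop (𝓝 b) ∧ ExpBound (fun n => |a n - b|) l := by
  have hgeo : ∀ ε, 0 < ε → l + ε < 0 → ∃ C, ∀ n, dist (a n) (a (n + 1))
      ≤ C * Real.exp (l + ε) ^ n := fun ε hε _ => by
    obtain ⟨N, hN⟩ := eventually_atTop.1 (h ε hε)
    have hpos : ∀ n, 0 < Real.exp (l + ε) ^ n := fun n => pow_pos (Real.exp_pos _) n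
    refine ⟨1 + ∑ k ∈ Finset.range N, |a (k + 1) - a k| / Real.exp (l + ε) ^ k, fun n => ?_⟩
    have hnn : ∀ k, 0 ≤ |a (k + 1) - a k| / Real.exp (l + ε) ^ k := fun k =>
      div_nonneg (abs_nonneg _) (hpos k).le
    rw [dist_comm, Real.dist_eq, ← div_le_iff₀ (hpos n)]
    rcases lt_or_ge n N with hn | hn
    · have h1 := Finset.single_le_sum (fun k _ => hnn k) (Finset.mem_range.2 hn)
      linarith
    · have h1 := hN n hn
      rw [mul_comm, Real.exp_nat_mul, ← div_le_one (hpos n)] at h1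
      have h2 := Finset.sum_nonneg fun k (_ : k ∈ Finset.range N) => hnn k
      linarith
  have hlt : ∀ ε, l + ε < 0 → Real.exp (l + ε) < 1 := fun ε h =>
    Real.exp_zero ▸ Real.exp_lt_exp.2 h
  obtain ⟨C₀, hC₀⟩ := hgeo (-l / 2) (by linarith) (by linarith)
  obtain ⟨b, hb⟩ := cauchySeq_tendsto_of_complete
    (cauchySeq_of_le_geometric _ C₀ (hlt (-l / 2) (by linarith)) hC₀)
  refine ⟨b, hb, expBound_of_mul fun ε hε => ?_⟩
  let δ := min ε (-l / 2)
  have hδ : 0 < δ := lt_min hε (by linarith)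
  have hlδ : l + δ < 0 := by linarith [min_le_right ε (-l / 2)]
  obtain ⟨C, hC⟩ := hgeo δ hδ hlδ
  have hC0 : 0 ≤ C := by
    have := dist_nonneg.trans (hC 0)
    simpa using this
  refine ⟨C / (1 - Real.exp (l + δ)), Eventually.of_forall fun n => ?_⟩
  have h1 := dist_le_of_le_geometric_of_tendsto _ C (hlt δ hlδ) hC hb n
  rw [Real.dist_eq] at h1
  have h2 : Real.exp (l + δ) ^ n ≤ Real.exp ((l + ε) * n) := by
    rw [← Real.exp_nat_mul, mul_comm]
    refine Real.exp_le_exp.2 ?_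
    gcongr
    exact min_le_left _ _
  calc |a n - b| ≤ C * Real.exp (l + δ) ^ n / (1 - Real.exp (l + δ)) := h1
    _ = C / (1 - Real.exp (l + δ)) * Real.exp (l + δ) ^ n := by ring
    _ ≤ _ := mul_le_mul_of_nonneg_left h2 (div_nonneg hC0 (by linarith [hlt δ hlδ]))

section Contracted

variable {E : Type*} [AddCommGroup E] [Module ℝ E] {F : ℕ → Type*}
  [∀ n, NormedAddCommGroup (F n)] [∀ n, InnerProductSpace ℝ (F n)]

/-- Let a sequence of linear maps `A n` have bounded area distortion and subexponential
increments. If `v` is expanded at the exact rate `l > 0`, then every plane that contains `v`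
contains a vector off the line of `v` that is contracted at the rate `-l`: the limit of the
vectors `w - a v` whose images under `A n` are orthogonal to the image of `v`. -/
lemma exists_expBound_neg (A : ∀ n, E →ₗ[ℝ] F n) {v w : E} (hv : ∀ n, A n v ≠ 0) {K l : ℝ}
    (hl : 0 < l) (hK : ∀ n, areaSq (A n v) (A n w) ≤ K)
    (h1 : ExpBound (fun n => ‖A n v‖) l) (h2 : ExpBound (fun n => ‖A n v‖⁻¹) (-l)) {m : ℕ → ℝ}
    (hm : ∀ n z, ‖A (n + 1) z‖ ≤ Real.exp (m n) * ‖A n z‖)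
    (hm0 : ExpBound (fun n => Real.exp (m n)) 0) :
    ∃ a : ℝ, ExpBound (fun n => ‖A n (w - a • v)‖) (-l) := by
  let a : ℕ → ℝ := fun n => inner ℝ (A n v) (A n w) / ‖A n v‖ ^ 2
  have hs : ∀ n, 0 < ‖A n v‖ := fun n => norm_pos_iff.2 (hv n)
  -- the foot of the perpendicular is orthogonal to `A n v`, hence short
  have horth : ∀ n, inner ℝ (A n v) (A n (w - a n • v)) = 0 := fun n => by
    rw [map_sub, map_smul, inner_sub_right, real_inner_smul_right, real_inner_self_eq_norm_sq]
    simp only [a]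
    rw [div_mul_cancel₀ _ (pow_ne_zero 2 (hs n).ne'), sub_self]
  have hd : ∀ n, ‖A n (w - a n • v)‖ ≤ √K * ‖A n v‖⁻¹ := fun n => by
    have h3 : areaSq (A n v) (A n w) = areaSq (A n v) (A n (w - a n • v)) := by
      have := areaSq_combination (A n v) (A n w) 1 0 (-a n) 1
      rw [map_sub, map_smul]
      simp only [one_smul, zero_smul, add_zero] at this
      rw [show A n w - a n • A n v = -a n • A n v + A n w by module, this]
      ring
    have h4 := hK n
    rw [h3, areaSq, horth, ← mul_pow] at h4
    have h5 : ‖A n v‖ * ‖A n (w - a n • v)‖ ≤ √K := Real.le_sqrt_of_sq_le (by linarith)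
    rwa [← div_eq_mul_inv, le_div_iff₀ (hs n), mul_comm]
  have hdE : ExpBound (fun n => ‖A n (w - a n • v)‖) (-l) :=
    (h2.const_mul (Real.sqrt_nonneg K)).mono hd le_rfl
  -- applying `A (n + 1)` to `w - a n • v` shows how far the next foot is from `a n`
  have hinc : ∀ n, |a (n + 1) - a n|
      ≤ Real.exp (m n) * ‖A n (w - a n • v)‖ * ‖A (n + 1) v‖⁻¹ := fun n => by
    have h3 : a (n + 1) - a n
        = inner ℝ (A (n + 1) v) (A (n + 1) (w - a n • v)) / ‖A (n + 1) v‖ ^ 2 := by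
      rw [map_sub, map_smul, inner_sub_right, real_inner_smul_right, real_inner_self_eq_norm_sq,
        sub_div, mul_div_cancel_right₀ _ (pow_ne_zero 2 (hs (n + 1)).ne')]
    rw [h3, abs_div, abs_of_pos (pow_pos (hs (n + 1)) 2), div_le_iff₀ (pow_pos (hs (n + 1)) 2)]
    refine (abs_real_inner_le_norm _ _).trans ?_
    have h4 := mul_le_mul_of_nonneg_left (hm n (w - a n • v)) (hs (n + 1)).le
    refine h4.trans_eq ?_
    have := (hs (n + 1)).ne'
    field_simp
  have hincE : ExpBound (fun n => |a (n + 1) - a n|) (0 + -l + -l) :=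
    ((hm0.mul hdE fun n => norm_nonneg _).mul h2.shift fun n => (inv_pos.2 (hs _)).le).mono hinc
      le_rfl
  obtain ⟨b, -, hb⟩ := exists_tendsto_expBound (by linarith) hincE
  refine ⟨b, (hdE.add ((hb.mul h1 fun n => (hs n).le).mono (fun n => le_rfl)
    (l' := -l) (by linarith))).mono (fun n => ?_) le_rfl⟩
  have h3 : A n (w - b • v) = A n (w - a n • v) + (a n - b) • A n v := by
    simp only [map_sub, map_smul]; module
  rw [h3]
  refine (norm_add_le _ _).trans ?_
  rw [norm_smul, Real.norm_eq_abs]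

end Contracted

section Stable

variable {M : Type*} [TopologicalSpace M] [ChartedSpace Plane M] [IsManifold (𝓡 2) ∞ M]
  [RiemannianBundle (fun x : M => TangentSpace (𝓡 2) x)]
  [IsContMDiffRiemannianBundle (𝓡 2) ∞ Plane (fun x : M => TangentSpace (𝓡 2) x)]
  [T2Space M] [CompactSpace M] {μ : Measure (Diff2 M)} [IsProbabilityMeasure μ]

lemma tendsto_average_maxStretch (hμ : HasLogMoment μ) :
    ∀ᵐ w ∂(Measure.infinitePi fun _ : ℕ => μ),
      Tendsto (fun n : ℕ => (∑ k ∈ Finset.range n, maxStretch (w k)) / n) atTop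
        (𝓝 (∫ f, maxStretch f ∂μ)) := by
  -- the law of large numbers, as the average along the walk on a one-point space
  let act : Diff2 M → Unit → Unit := fun _ _ => ()
  have hact : Measurable (Function.uncurry act) := measurable_const
  have hst : WalkStationary act μ (Measure.dirac ()) := by
    change (μ.prod (Measure.dirac ())).map (fun _ => ()) = _
    rw [Measure.map_const, measure_univ, one_smul]
  have her : WalkErgodic act μ (Measure.dirac ()) := fun A hA _ => by
    rw [Measure.dirac_apply' _ hA]
    by_cases h : () ∈ A <;> simp [h]
  have h1 := her.tendsto_average hact hst (φ := fun q => maxStretch q.1)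
    (continuous_maxStretch.measurable.comp measurable_fst) ((integrable_maxStretch hμ).comp_fst _)
  have h2 : ∫ q : Diff2 M × Unit, maxStretch q.1 ∂(μ.prod (Measure.dirac ()))
      = ∫ f, maxStretch f ∂μ := by
    rw [integral_fun_fst]; simp
  rw [h2] at h1
  filter_upwards [Measure.ae_ae_of_ae_prod h1] with w hw
  obtain ⟨_, hw⟩ := hw.exists
  exact hw

lemma norm_mfderiv_le_exp_maxStretch (f : Diff2 M) (x : M) (v : TangentSpace (𝓡 2) x) :
    ‖mfderiv (𝓡 2) (𝓡 2) f x v‖ ≤ Real.exp (maxStretch f) * ‖v‖ := by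
  by_cases hv : v = 0
  · simp [hv]
  · have h1 := (le_abs_self _).trans (abs_stretch_le f (unitVec x v hv))
    have h0 := norm_pos_iff.2 hv
    rw [stretch_unitVec, logGrowth, Real.log_le_iff_le_exp
      (div_pos (norm_pos_iff.2 (mfderiv_diff2_ne_zero f x hv)) h0), div_le_iff₀ h0] at h1
    exact h1

/-- If the averages of a sequence converge, its terms are `o(n)`. -/
lemma expBound_exp_of_tendsto_average {a : ℕ → ℝ} {c : ℝ}
    (h : Tendsto (fun n : ℕ => (∑ k ∈ Finset.range n, a k) / n) atTop (𝓝 c)) :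
    ExpBound (fun n => Real.exp (a n)) 0 := by
  have h1 : Tendsto (fun n : ℕ => a n / n) atTop (𝓝 0) := by
    have h2 := (tendsto_add_atTop_iff_nat 1).2 h
    have h3 : Tendsto (fun n : ℕ => ((n + 1 : ℕ) : ℝ) / n) atTop (𝓝 1) := by
      have h4 := (tendsto_inv_atTop_zero.comp (tendsto_natCast_atTop_atTop (R := ℝ))).const_add 1
      rw [add_zero] at h4
      refine h4.congr' ?_
      filter_upwards [eventually_ne_atTop 0] with n hn
      have : (n : ℝ) ≠ 0 := by exact_mod_cast hn
      simp only [Function.comp]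
      push_cast
      field_simp
    have h5 := (h2.mul h3).sub h
    rw [mul_one, sub_self] at h5
    refine h5.congr' ?_
    filter_upwards [eventually_ne_atTop 0] with n hn
    have h6 : (n : ℝ) ≠ 0 := by exact_mod_cast hn
    have h7 : ((n + 1 : ℕ) : ℝ) ≠ 0 := by exact_mod_cast Nat.succ_ne_zero n
    rw [Finset.sum_range_succ]
    field_simp
    ring
  intro ε hε
  filter_upwards [h1.eventually (gt_mem_nhds hε), eventually_gt_atTop 0] with n h2 h3
  rw [div_lt_iff₀ (by exact_mod_cast h3)] at h2
  refine Real.exp_le_exp.2 ?_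
  rw [zero_add]
  exact h2.le

lemma expBound_inv_of_tendsto {w : ℕ → Diff2 M} {x : M} {v : TangentSpace (𝓡 2) x} {l : ℝ}
    (hv : v ≠ 0) (h : Tendsto (growthRate w x v) atTop (𝓝 l)) :
    ExpBound (fun n => ‖mfderiv (𝓡 2) (𝓡 2) (word w n) x v‖⁻¹) (-l) := by
  have h0 := norm_pos_iff.2 hv
  refine expBound_of_mul fun ε hε => ⟨‖v‖⁻¹, ?_⟩
  filter_upwards [h.eventually (lt_mem_nhds (show l - ε < l by linarith)),
    eventually_gt_atTop 0] with n hn hn0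
  have hpos := norm_pos_iff.2 (mfderiv_diff2_ne_zero (word w n) x hv)
  have hn' : (0 : ℝ) < n := by exact_mod_cast hn0
  rw [growthRate, logGrowth, one_div, ← div_eq_inv_mul, lt_div_iff₀ hn',
    Real.lt_log_iff_exp_lt (div_pos hpos h0), lt_div_iff₀ h0] at hn
  rw [show (-l + ε) * n = -((l - ε) * n) by ring, Real.exp_neg, ← mul_inv]
  refine inv_anti₀ (by positivity) ?_
  rw [mul_comm]; exact hn.le

variable [MeasurableSpace M] [BorelSpace M]

lemma map_word {m : Measure M} {w : ℕ → Diff2 M} (hw : ∀ n, m.map (w n) = m) (n : ℕ) :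
    m.map (word w n) = m := by
  induction n with
  | zero => exact Measure.map_id
  | succ n ih =>
    change m.map (w n ∘ word w n) = m
    rw [← Measure.map_map (w n).continuous.measurable (word w n).continuous.measurable, ih, hw]

/-- For a walk that preserves a smooth measure, almost surely every tangent plane that contains a
vector with a positive exponent also contains a stable vector. -/
lemma exists_upperRate_neg (hμ : HasLogMoment μ) {m : Measure M} (hm : IsSmoothMeasure m)
    (hpres : ∀ᵐ (f : Diff2 M) ∂μ, m.map f = m) :
    ∀ᵐ w ∂(Measure.infinitePi fun _ : ℕ => μ), ∀ (x : M) (v : TangentSpace (𝓡 2) x) (l : ℝ),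
      0 < l → v ≠ 0 → Tendsto (growthRate w x v) atTop (𝓝 l) →
        ∃ u : TangentSpace (𝓡 2) x, u ≠ 0 ∧ upperRate w x u < 0 := by
  obtain ⟨K, hK, hKm⟩ := exists_areaSq_mfderiv_le hm
  have hall : ∀ᵐ w ∂(Measure.infinitePi fun _ : ℕ => μ), ∀ n, m.map (w n) = m :=
    ae_all_iff.2 fun n =>
      (measurePreserving_eval_infinitePi (fun _ : ℕ => μ) n).quasiMeasurePreserving.ae hpres
  filter_upwards [hall, tendsto_average_maxStretch hμ] with w hw hav x v l hl hv hlim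
  obtain ⟨z, hz⟩ : ∃ z : TangentSpace (𝓡 2) x, z ∉ Submodule.span ℝ {v} := by
    by_contra hcon
    push Not at hcon
    have h1 : Submodule.span ℝ {v} = ⊤ := eq_top_iff.2 fun z _ => hcon z
    have h2 := finrank_span_singleton (K := ℝ) hv
    rw [h1, finrank_top, finrank_tangentSpace] at h2
    norm_num at h2
  obtain ⟨a, ha⟩ := exists_expBound_neg
    (fun n => (mfderiv (𝓡 2) (𝓡 2) (word w n) x).toLinearMap) (v := v) (w := z)
    (fun n => mfderiv_diff2_ne_zero (word w n) x hv) hl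
    (fun n => hKm (word w n) (map_word hw n) x v z)
    (mem_slowSpace_of_tendsto hv hlim) (expBound_inv_of_tendsto hv hlim)
    (m := fun n => maxStretch (w n))
    (fun n y => by
      change ‖mfderiv (𝓡 2) (𝓡 2) ((word w n).trans (w n)) x y‖ ≤ _
      rw [mfderiv_trans_apply]
      exact norm_mfderiv_le_exp_maxStretch _ _ _)
    (expBound_exp_of_tendsto_average hav)
  have hne : z - a • v ≠ 0 := fun h =>
    hz (Submodule.mem_span_singleton.2 ⟨a, (sub_eq_zero.1 h).symm⟩)
  refine ⟨z - a • v, hne, ((upperRate_le_iff w hne (-l)).2 ha).trans_lt ?_⟩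
  exact_mod_cast neg_lt_zero.2 hl

end Stable

/-! ### Uniform expansion and the exponents of stationary measures -/

section Expanding

variable {M : Type*} [TopologicalSpace M] [ChartedSpace Plane M] [IsManifold (𝓡 2) ∞ M]
  [RiemannianBundle (fun x : M => TangentSpace (𝓡 2) x)]
  [IsContMDiffRiemannianBundle (𝓡 2) ∞ Plane (fun x : M => TangentSpace (𝓡 2) x)]
  [T2Space M] [CompactSpace M] {μ : Measure (Diff2 M)} [IsProbabilityMeasure μ]

lemma integrable_stretch_traj_and_integral_eq (hμ : HasLogMoment μ) (κ : Measure (SphereBundle M))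
    [IsProbabilityMeasure κ] (k : ℕ) :
    Integrable (fun p : (ℕ → Diff2 M) × SphereBundle M =>
      stretch (p.1 k, traj sphereAct p.1 k p.2)) ((Measure.infinitePi fun _ : ℕ => μ).prod κ) ∧
    ∫ p, stretch (p.1 k, traj sphereAct p.1 k p.2) ∂((Measure.infinitePi fun _ : ℕ => μ).prod κ)
      = ∫ s, meanStretch μ s ∂((walkStep sphereAct μ)^[k] κ) := by
  have hpr := isProbabilityMeasure_walkStep_iterate (μ := μ) measurable_sphereAct κ k
  have hmp : MeasurePreserving (fun p : (ℕ → Diff2 M) × SphereBundle M =>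
      (p.1 k, traj sphereAct p.1 k p.2)) ((Measure.infinitePi fun _ : ℕ => μ).prod κ)
      (μ.prod ((walkStep sphereAct μ)^[k] κ)) :=
    ⟨((measurable_pi_apply k).comp measurable_fst).prodMk (measurable_traj measurable_sphereAct k),
      map_letter_traj measurable_sphereAct κ k⟩
  refine ⟨hmp.integrable_comp_of_integrable (integrable_stretch hμ _), ?_⟩
  rw [← integral_stretch hμ, ← hmp.map_eq, integral_map hmp.measurable.aemeasurable
    measurable_stretch.aestronglyMeasurable]

lemma integrable_stretch_word_and_integral_eq (hμ : HasLogMoment μ) (κ : Measure (SphereBundle M))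
    [IsProbabilityMeasure κ] (n : ℕ) :
    Integrable (fun p : (ℕ → Diff2 M) × SphereBundle M => stretch (word p.1 n, p.2))
      ((Measure.infinitePi fun _ : ℕ => μ).prod κ) ∧
    ∫ p, stretch (word p.1 n, p.2) ∂((Measure.infinitePi fun _ : ℕ => μ).prod κ)
      = ∑ k ∈ Finset.range n, ∫ s, meanStretch μ s ∂((walkStep sphereAct μ)^[k] κ) := by
  have h := integrable_stretch_traj_and_integral_eq hμ κ
  simp only [stretch_word]
  refine ⟨integrable_finsetSum _ fun k _ => (h k).1, ?_⟩
  rw [integral_finsetSum _ fun k _ => (h k).1]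
  exact Finset.sum_congr rfl fun k _ => (h k).2

/-- In the uniformly expanding case, the mean growth of the random walk on the sphere bundle over
a fixed number of steps is bounded below, for every initial law. -/
lemma UniformlyExpanding.exists_le_sum (hμ : HasLogMoment μ) (h : UniformlyExpanding μ) :
    ∃ C : ℝ, 0 < C ∧ ∃ N : ℕ, ∀ (κ : Measure (SphereBundle M)) [IsProbabilityMeasure κ],
      C ≤ ∑ k ∈ Finset.range N, ∫ s, meanStretch μ s ∂((walkStep sphereAct μ)^[k] κ) := by
  obtain ⟨C, hC, N, hN⟩ := h
  have hs : ∀ s : SphereBundle M,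
      C < ∫ w, stretch (word w N, s) ∂(Measure.infinitePi fun _ : ℕ => μ) := fun s => by
    have h1 := (integrable_stretch_word_and_integral_eq hμ (Measure.dirac s) N)
    rw [← (integrable_stretch_convPow_and_integral_eq hμ s N).2,
      integral_prod_symm _ h1.1] at h1
    have h2 := h1.2
    rw [integral_dirac] at h2
    rw [h2]
    simp only [stretch_eq_logGrowth]
    exact hN _ _ s.vec_ne_zero
  refine ⟨C, hC, N, fun κ hκ => ?_⟩
  have h1 := integrable_stretch_word_and_integral_eq hμ κ N
  rw [← h1.2, integral_prod_symm _ h1.1]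
  calc C = ∫ _s, C ∂κ := by simp
    _ ≤ _ := integral_mono (integrable_const C) h1.1.integral_prod_right fun s => (hs s).le

/-- Under uniform expansion a fixed tangent vector cannot almost surely be contracted: Fatou's
lemma compares its growth with the sums of the maximal stretches, which obey the law of large
numbers. -/
lemma UniformlyExpanding.not_ae_upperRate_neg (hμ : HasLogMoment μ) (h : UniformlyExpanding μ)
    {x : M} {v : TangentSpace (𝓡 2) x} (hv : v ≠ 0) :
    ¬ ∀ᵐ w ∂(Measure.infinitePi fun _ : ℕ => μ), upperRate w x v < 0 := by
  intro hneg
  obtain ⟨C, hC, N, hCN⟩ := h.exists_le_sum hμ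
  set P : Measure (ℕ → Diff2 M) := Measure.infinitePi fun _ : ℕ => μ with hP
  let s := unitVec x v hv
  have hN : 0 < N := Nat.pos_of_ne_zero (by
    rintro rfl
    have h1 := hCN (Measure.dirac s)
    rw [Finset.range_zero, Finset.sum_empty] at h1
    linarith)
  let T : ℕ → (ℕ → Diff2 M) → ℝ := fun n w => ∑ k ∈ Finset.range n, maxStretch (w k)
  let S : ℕ → (ℕ → Diff2 M) → ℝ := fun n w => stretch (word w n, s)
  set c := ∫ f, maxStretch f ∂μ
  have hTi : ∀ n, Integrable (T n) P ∧ ∫ w, T n w ∂P = n * c := fun n => by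
    have h1 : ∀ k : ℕ, Integrable (fun w : ℕ → Diff2 M => maxStretch (w k)) P ∧
        ∫ w : ℕ → Diff2 M, maxStretch (w k) ∂P = c := fun k => by
      have hmp := measurePreserving_eval_infinitePi (fun _ : ℕ => μ) k
      refine ⟨hmp.integrable_comp_of_integrable (integrable_maxStretch hμ), ?_⟩
      have h2 := integral_map (μ := P) hmp.measurable.aemeasurable
        (continuous_maxStretch (M := M)).measurable.aestronglyMeasurable
      rw [hmp.map_eq] at h2
      exact h2.symm
    refine ⟨integrable_finsetSum _ fun k _ => (h1 k).1, ?_⟩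
    simp only [T]
    rw [integral_finsetSum _ fun k _ => (h1 k).1, Finset.sum_congr rfl fun k _ => (h1 k).2]
    simp
  have hSi : ∀ n, Integrable (S n) P ∧ ∫ w, S n w ∂P = ∑ k ∈ Finset.range n,
      ∫ s', meanStretch μ s' ∂((walkStep sphereAct μ)^[k] (Measure.dirac s)) := fun n => by
    have h1 := integrable_stretch_word_and_integral_eq hμ (Measure.dirac s) n
    have hmp : MeasurePreserving (fun w : ℕ → Diff2 M => (w, s)) P (P.prod (Measure.dirac s)) :=
      ⟨measurable_prodMk_right, by rw [Measure.prod_dirac]⟩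
    refine ⟨hmp.integrable_comp_of_integrable h1.1, ?_⟩
    rw [← h1.2, integral_prod_symm _ h1.1, integral_dirac]
  have hSC : ∀ n : ℕ, n * C ≤ ∫ w, S (n * N) w ∂P := fun n => by
    rw [(hSi _).2]
    induction n with
    | zero => simp
    | succ n ih =>
      have hpr := isProbabilityMeasure_walkStep_iterate (μ := μ) measurable_sphereAct
        (Measure.dirac s) (n * N)
      have h1 := hCN ((walkStep sphereAct μ)^[n * N] (Measure.dirac s))
      rw [Nat.succ_mul, Finset.sum_range_add]
      have h2 : ∀ k, (walkStep sphereAct μ)^[n * N + k] (Measure.dirac s)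
          = (walkStep sphereAct μ)^[k] ((walkStep sphereAct μ)^[n * N] (Measure.dirac s)) :=
        fun k => by rw [add_comm, Function.iterate_add_apply]
      simp only [h2]
      push_cast
      linarith
  have hST : ∀ n w, S n w ≤ T n w := fun n w => by
    simp only [S, T, stretch_word]
    exact Finset.sum_le_sum fun k _ => (le_abs_self _).trans (abs_stretch_le _ _)
  -- Fatou's lemma needs nonnegative functions: subtract the growth rate from the average of the
  -- maximal stretches. If `v` is contracted almost surely, the lower limit is at least `c`, but the
  -- integrals are at most `c - C / N`.
  let Z : ℕ → (ℕ → Diff2 M) → ℝ := fun n w =>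
    (T ((n + 1) * N) w - S ((n + 1) * N) w) / (((n + 1) * N : ℕ) : ℝ)
  have hpos : ∀ n : ℕ, (0 : ℝ) < (((n + 1) * N : ℕ) : ℝ) := fun n => by
    exact_mod_cast Nat.mul_pos n.succ_pos hN
  have hZ0 : ∀ n w, 0 ≤ Z n w := fun n w =>
    div_nonneg (sub_nonneg.2 (hST _ _)) (hpos n).le
  have hZi : ∀ n, Integrable (Z n) P := fun n => ((hTi _).1.sub (hSi _).1).div_const _
  have hZC : ∀ n, ∫ w, Z n w ∂P ≤ c - C / N := fun n => by
    simp only [Z]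
    rw [integral_div, integral_sub (hTi _).1 (hSi _).1, (hTi _).2, div_le_iff₀ (hpos n)]
    have h1 := hSC (n + 1)
    have h2 : (N : ℝ) ≠ 0 := by exact_mod_cast hN.ne'
    have h3 : (c - C / N) * (((n + 1) * N : ℕ) : ℝ)
        = (((n + 1) * N : ℕ) : ℝ) * c - ((n + 1 : ℕ) : ℝ) * C := by
      push_cast; field_simp
    rw [h3]
    linarith
  have hlow : ∀ᵐ w ∂P, ENNReal.ofReal c ≤ liminf (fun n => ENNReal.ofReal (Z n w)) atTop := by
    filter_upwards [hneg, tendsto_average_maxStretch hμ] with w h1 h2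
    have hsub : Tendsto (fun n : ℕ => (n + 1) * N) atTop atTop :=
      tendsto_atTop_mono (fun n => (Nat.le_succ n).trans (Nat.le_mul_of_pos_right _ hN)) tendsto_id
    have h3 := (ENNReal.continuous_ofReal.tendsto c).comp (h2.comp hsub)
    rw [← h3.liminf_eq]
    refine liminf_le_liminf ?_
    have h4 := hsub.eventually (eventually_lt_of_limsup_lt h1)
    filter_upwards [h4] with n hn
    refine ENNReal.ofReal_le_ofReal ?_
    have h5 : growthRate w x v ((n + 1) * N) < 0 := by exact_mod_cast hn
    have h6 : S ((n + 1) * N) w ≤ 0 := by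
      rw [growthRate, ← stretch_unitVec _ x v hv, one_div, ← div_eq_inv_mul,
        div_lt_iff₀ (hpos n), zero_mul] at h5
      exact h5.le
    change T ((n + 1) * N) w / (((n + 1) * N : ℕ) : ℝ) ≤ _
    simp only [Z]
    gcongr
    linarith
  have hfatou : ENNReal.ofReal c ≤ ENNReal.ofReal (c - C / N) := by
    calc ENNReal.ofReal c = ∫⁻ _w, ENNReal.ofReal c ∂P := by simp
      _ ≤ ∫⁻ w, liminf (fun n => ENNReal.ofReal (Z n w)) atTop ∂P := lintegral_mono_ae hlow
      _ ≤ liminf (fun n => ∫⁻ w, ENNReal.ofReal (Z n w) ∂P) atTop :=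
        lintegral_liminf_le' fun n => (hZi n).aestronglyMeasurable.aemeasurable.ennreal_ofReal
      _ ≤ liminf (fun _ : ℕ => ENNReal.ofReal (c - C / N)) atTop := by
        refine liminf_le_liminf (Eventually.of_forall fun n => ?_)
        rw [← ofReal_integral_eq_lintegral_ofReal (hZi n) (Eventually.of_forall (hZ0 n))]
        exact ENNReal.ofReal_le_ofReal (hZC n)
      _ = ENNReal.ofReal (c - C / N) := liminf_const _
  have hnn : 0 ≤ c - C / N := (integral_nonneg (hZ0 0)).trans (hZC 0)
  have h1 := (ENNReal.ofReal_le_ofReal_iff hnn).1 hfatou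
  have h2 : 0 < C / N := div_pos hC (by exact_mod_cast hN)
  linarith

variable [MeasurableSpace M] [BorelSpace M]

/-- There is a Borel unit vector field. -/
lemma exists_measurable_section :
    ∃ σ : M → SphereBundle M, Measurable σ ∧ ∀ x, (σ x).base = x := by
  have := secondCountableTopology_of_compact (M := M)
  obtain ⟨F, hF⟩ := exists_measurable_frame (M := M)
  let e : Plane := EuclideanSpace.single 0 1
  have hne : ∀ x, F x e ≠ 0 := fun x => (map_ne_zero_iff _ (F x).injective).2 (by simp [e])
  refine ⟨fun x => unitVec x (F x e) (hne x), ?_, fun x => rfl⟩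
  have hFe : Measurable fun x : M => (⟨x, F x e⟩ : TangentBundle (𝓡 2) M) :=
    hF.comp measurable_prodMk_right
  have hn : Measurable fun x : M => ‖F x e‖⁻¹ :=
    ((continuous_norm_tangentBundle (M := M)).measurable.comp hFe).inv
  have h1 : Measurable fun x : M => (⟨x, F x (‖F x e‖⁻¹ • e)⟩ : TangentBundle (𝓡 2) M) :=
    hF.comp (measurable_id.prodMk (hn.smul_const e))
  refine measurable_of_isOpen fun O hO => ?_
  obtain ⟨O', hO', rfl⟩ := isOpen_induced_iff.1 hO
  have h2 := h1 hO'.measurableSet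
  convert h2 using 1
  ext x
  simp only [mem_preimage, map_smul]
  rfl

variable {ν : Measure M}

/-- Under uniform expansion, an ergodic stationary measure has a positive exponent: lift it to an
ergodic stationary measure on the sphere bundle, whose mean stretch is positive. -/
lemma UniformlyExpanding.exists_isLyapunovExponent (hμ : HasLogMoment μ)
    (h : UniformlyExpanding μ) (hν : IsErgodicStationary μ ν) :
    ∃ l : ℝ, 0 < l ∧ IsLyapunovExponent μ ν l := by
  have := hν.prob
  have := secondCountableTopology_of_compact (M := M)
  obtain ⟨hst, her⟩ := isErgodicStationary_iff.1 hν
  obtain ⟨σ, hσ, hσb⟩ := exists_measurable_section (M := M)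
  have hpr : IsProbabilityMeasure (ν.map σ) := Measure.isProbabilityMeasure_map hσ.aemeasurable
  have hlift : (ν.map σ).map SphereBundle.base = ν := by
    rw [Measure.map_map SphereBundle.continuous_base.measurable hσ]
    exact (congrArg (fun g => ν.map g) (funext hσb)).trans Measure.map_id
  obtain ⟨η, hη, hηs, hηe, hην⟩ := exists_walkErgodic_lift measurable_sphereAct
    (fun f => continuous_sphereAct.comp (continuous_const.prodMk continuous_id))
    measurable_diff2_apply SphereBundle.continuous_base (fun f s => base_sphereAct f s) hst her
    (ν.map σ) hlift
  refine ⟨∫ s, meanStretch μ s ∂η, ?_, ?_⟩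
  · obtain ⟨C, hC, N, hCN⟩ := h.exists_le_sum hμ
    have h1 := hCN η
    have h2 : ∀ k, (walkStep sphereAct μ)^[k] η = η := fun k =>
      Function.iterate_fixed (show walkStep sphereAct μ η = η from hηs) k
    simp only [h2, Finset.sum_const, Finset.card_range, nsmul_eq_mul] at h1
    exact pos_of_mul_pos_right (hC.trans_le h1) (Nat.cast_nonneg N)
  · have h1 := ae_exists_of_ae_map SphereBundle.continuous_base (tendsto_growthRate hμ hηs hηe)
    rw [hην] at h1
    refine h1.mono ?_
    rintro ⟨w, x⟩ ⟨s, rfl, hs⟩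
    exact ⟨s.1.2, s.vec_ne_zero, hs⟩

/-- Under uniform expansion, the stable distribution of a walk that preserves a smooth measure is
random: otherwise some fixed vector would almost surely be contracted. -/
lemma UniformlyExpanding.not_stableNonRandom (hμ : HasLogMoment μ) (h : UniformlyExpanding μ)
    {m : Measure M} (hm : IsSmoothMeasure m) (hpres : ∀ᵐ (f : Diff2 M) ∂μ, m.map f = m)
    (hν : IsErgodicStationary μ ν) : ¬ StableNonRandom μ ν := by
  rintro ⟨k, V, -, -, hV⟩
  have := hν.prob
  obtain ⟨l, hl, hLyap⟩ := h.exists_isLyapunovExponent hμ hν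
  have hu : ∀ᵐ p ∂(pathMeasure μ ν), ∃ u : TangentSpace (𝓡 2) p.2, u ≠ 0 ∧
      upperRate p.1 p.2 u < 0 := by
    have h1 : ∀ᵐ p ∂(pathMeasure μ ν), ∀ (x : M) (v : TangentSpace (𝓡 2) x) (l : ℝ),
        0 < l → v ≠ 0 → Tendsto (growthRate p.1 x v) atTop (𝓝 l) →
        ∃ u : TangentSpace (𝓡 2) x, u ≠ 0 ∧ upperRate p.1 x u < 0 :=
      Measure.quasiMeasurePreserving_fst.ae (exists_upperRate_neg hμ hm hpres)
    filter_upwards [h1, hLyap] with p h2 h3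
    obtain ⟨v, hv, hlim⟩ := h3
    exact h2 _ v l hl hv hlim
  have hboth := (Measure.measurePreserving_swap
    (μ := ν) (ν := Measure.infinitePi fun _ : ℕ => μ)).quasiMeasurePreserving.ae (hV.and hu)
  obtain ⟨x, hx⟩ := (Measure.ae_ae_of_ae_prod hboth).exists
  obtain ⟨w, hw1, u, hu0, hu1⟩ := hx.exists
  have huV : u ∈ (V x : Set (TangentSpace (𝓡 2) x)) := by
    change (V x : Set (TangentSpace (𝓡 2) x)) = stableSet w x at hw1
    rw [hw1]; exact Or.inr hu1
  refine h.not_ae_upperRate_neg hμ hu0 (hx.mono fun w' hw' => ?_)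
  have h1 : (V x : Set (TangentSpace (𝓡 2) x)) = stableSet w' x := hw'.1
  rw [h1] at huV
  exact huV.resolve_left hu0

lemma exists_mem_slowSpace_of_upperRate_neg {w : ℕ → Diff2 M} {x : M} {u : TangentSpace (𝓡 2) x}
    (hu : u ≠ 0) (h : upperRate w x u < 0) : ∃ l : ℝ, l < 0 ∧ u ∈ slowSpace w l x := by
  obtain ⟨l, hl1, hl2⟩ := EReal.lt_iff_exists_real_btwn.1 h
  exact ⟨l, by exact_mod_cast hl2, (upperRate_le_iff w hu l).1 hl1.le⟩

lemma slowSpace_mono {w : ℕ → Diff2 M} {x : M} {l l' : ℝ} (hl : l ≤ l') :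
    slowSpace w l x ≤ slowSpace w l' x :=
  fun _ hv => ExpBound.mono hv (fun _ => le_rfl) hl

/-- If a plane contains vectors with positive and with negative rates, a nonzero subspace of
vectors with nonpositive rates is the stable subspace. -/
lemma eq_stableSet {w : ℕ → Diff2 M} {x : M} {V : Submodule ℝ (TangentSpace (𝓡 2) x)} {l l' : ℝ}
    (hV : V ≠ ⊥) (hl : l ≤ 0) (hVl : ∀ v ∈ V, v ≠ 0 → upperRate w x v ≤ (l : EReal))
    {u v : TangentSpace (𝓡 2) x} (hu : u ≠ 0) (hu' : upperRate w x u < 0) (hl' : 0 < l')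
    (hv : v ≠ 0) (hv' : Tendsto (growthRate w x v) atTop (𝓝 l')) :
    (V : Set (TangentSpace (𝓡 2) x)) = stableSet w x := by
  have hW : slowSpace w 0 x ≠ ⊤ := fun htop => by
    have h1 : v ∈ slowSpace w 0 x := htop ▸ Submodule.mem_top
    have h2 := (upperRate_le_iff w hv 0).2 h1
    rw [upperRate_eq_of_tendsto hv'] at h2
    exact absurd (by exact_mod_cast h2) (not_le.2 hl')
  have hVW : V = slowSpace w 0 x := submodule_tangentSpace_eq_of_le (fun y hy => by
    by_cases h0 : y = 0
    · rw [h0]; exact zero_mem _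
    · exact slowSpace_mono hl ((upperRate_le_iff w h0 l).1 (hVl y hy h0))) hV hW
  obtain ⟨r, hr, hur⟩ := exists_mem_slowSpace_of_upperRate_neg hu hu'
  have huW : slowSpace w r x = slowSpace w 0 x :=
    submodule_tangentSpace_eq_of_le (slowSpace_mono hr.le)
      ((Submodule.ne_bot_iff _).2 ⟨u, hur, hu⟩) hW
  ext y
  rw [SetLike.mem_coe, hVW]
  by_cases h0 : y = 0
  · rw [h0]; exact iff_of_true (zero_mem _) (Or.inl rfl)
  constructor
  · intro hy
    rw [← huW] at hy
    exact Or.inr (((upperRate_le_iff w h0 r).2 hy).trans_lt (by exact_mod_cast hr))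
  · intro hy
    obtain ⟨r', hr', hy'⟩ := exists_mem_slowSpace_of_upperRate_neg h0 (hy.resolve_left h0)
    exact slowSpace_mono hr'.le hy'

/-- If every ergodic stationary measure has a positive exponent and a random stable distribution,
the walk is uniformly expanding: otherwise the subbundle with nonpositive top exponent would be a
non-random stable distribution. -/
lemma uniformlyExpanding_of_forall (hμ : HasLogMoment μ) {m : Measure M} (hm : IsSmoothMeasure m)
    (hpres : ∀ᵐ (f : Diff2 M) ∂μ, m.map f = m)
    (H : ∀ ν : Measure M, IsErgodicStationary μ ν →
      (∃ l : ℝ, 0 < l ∧ IsLyapunovExponent μ ν l) ∧ ¬ StableNonRandom μ ν) :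
    UniformlyExpanding μ := by
  by_contra h
  obtain ⟨η, hηp, hηs, hηe, hη0⟩ := exists_walkErgodic_meanStretch_nonpos hμ h
  obtain ⟨hν, k, V, -, hkV, hinv, htop⟩ := exists_isTopExponentIn hμ hηs hηe
  have := hν.prob
  obtain ⟨⟨l', hl', hLyap⟩, hrand⟩ := H _ hν
  refine hrand ⟨k, V, hkV, hinv, ?_⟩
  have h1 : ∀ᵐ p ∂(pathMeasure μ (η.map SphereBundle.base)),
      ∀ (x : M) (v : TangentSpace (𝓡 2) x) (l : ℝ),
      0 < l → v ≠ 0 → Tendsto (growthRate p.1 x v) atTop (𝓝 l) →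
      ∃ u : TangentSpace (𝓡 2) x, u ≠ 0 ∧ upperRate p.1 x u < 0 :=
    Measure.quasiMeasurePreserving_fst.ae (exists_upperRate_neg hμ hm hpres)
  filter_upwards [h1, htop, hLyap] with p h2 h3 h4
  obtain ⟨⟨y, hyV, hy0, -⟩, hVl⟩ := h3
  obtain ⟨v, hv, hlim⟩ := h4
  obtain ⟨u, hu, hu'⟩ := h2 _ v l' hl' hv hlim
  exact eq_stableSet ((Submodule.ne_bot_iff _).2 ⟨y, hyV, hy0⟩) hη0 hVl hu hu' hl' hv hlim

end Expanding

end RandomSurface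

theorem proposition3p14 {M : Type*} [TopologicalSpace M] [T2Space M] [CompactSpace M]
    [ConnectedSpace M] [ChartedSpace (EuclideanSpace ℝ (Fin 2)) M] [IsManifold (𝓡 2) ∞ M]
    [RiemannianBundle (fun x : M => TangentSpace (𝓡 2) x)]
    [IsContMDiffRiemannianBundle (𝓡 2) ∞ (EuclideanSpace ℝ (Fin 2))
      (fun x : M => TangentSpace (𝓡 2) x)]
    [MeasurableSpace M] [BorelSpace M]
    (μ : Measure (RandomSurface.Diff2 M)) [IsProbabilityMeasure μ]
    (hμ : RandomSurface.HasLogMoment μ) :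
    (¬ RandomSurface.UniformlyExpanding μ →
      ∃ ν : Measure M, RandomSurface.IsErgodicStationary μ ν ∧
        ∃ (k : ℕ) (V : (x : M) → Submodule ℝ (TangentSpace (𝓡 2) x)),
          0 < k ∧ RandomSurface.IsMeasurableSubbundle ν k V ∧
          RandomSurface.IsInvariantSubbundle μ ν V ∧
          ∃ l : ℝ, l ≤ 0 ∧ RandomSurface.IsTopExponentIn μ ν V l) ∧
    (∀ m : Measure M, RandomSurface.IsSmoothMeasure m → (∀ᵐ (f : RandomSurface.Diff2 M) ∂μ, Measure.map f m = m) →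
      (RandomSurface.UniformlyExpanding μ ↔
        ∀ ν : Measure M, RandomSurface.IsErgodicStationary μ ν →
          (∃ l : ℝ, 0 < l ∧ RandomSurface.IsLyapunovExponent μ ν l) ∧
          ¬ RandomSurface.StableNonRandom μ ν)) := by
  refine ⟨fun h => ?_, fun m hm hpres => ⟨fun h ν hν => ?_, fun H => ?_⟩⟩
  · obtain ⟨η, hη, hηs, hηe, hη0⟩ :=
      RandomSurface.exists_walkErgodic_meanStretch_nonpos hμ h
    obtain ⟨hν, k, V, hk, hkV, hinv, htop⟩ := RandomSurface.exists_isTopExponentIn hμ hηs hηe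
    exact ⟨_, hν, k, V, hk, hkV, hinv, _, hη0, htop⟩
  · exact ⟨h.exists_isLyapunovExponent hμ hν, h.not_stableNonRandom hμ hm hpres hν⟩
  · exact RandomSurface.uniformlyExpanding_of_forall hμ hm hpres H
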